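/- **Theorem 1.10.** Let $E$ be the natural two-dimensional representation of $\mathrm{SL}_2(\mathbf{C})$. For a partition $\lambda$ let $\ell(\lambda)$ be its number of parts, $a(\lambda)$ its first part ($a(\varnothing)=0$), and $\nabla^\lambda$ the corresponding Schur functor. Write $\lambda \equiv_{\ell,m} \mu$ if $\nabla^\lambda \mathrm{Sym}^\ell E \cong \nabla^\mu \mathrm{Sym}^m E$ as representations of $\mathrm{SL}_2(\mathbf{C})$. If $\ell(\lambda) \le r$, let $\lambda^{\circ r}$ be the complement of $\lambda$ in the $r \times a(\lambda)$ box, defined by $\lambda^{\circ r}_{r+1-i} = a(\lambda) - \lambda_i$ for $1 \le i \le r$. (a) Let $\ell \le 4$ and let $\lambda$, $\mu$ be partitions with $\ell(\lambda), \ell(\mu) \le \ell$. Then $\lambda \equiv_{\ell,\ell} \mu$ if and only if $\lambda = \mu$ or $\lambda^{\circ(\ell+1)} = \mu$. (b) For every $\ell \ge 5$ there are infinitely many pairs $(\lambda,\mu)$ of partitions with $\ell(\lambda), \ell(\mu) \le \ell$ such that $\lambda \ne \mu$, $\lambda \ne \mu^{\circ(\ell+1)}$ and $\lambda \equiv_{\ell,\ell}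 \mu$. Moreover, for every integer $k \ge 0$ the pair $(\lambda_{k,\ell}, \mu_{k,\ell})$ is such a pair, where $$\lambda_{k,\ell} = \begin{cases} (8+5k,\,7+4k,\,2+2k,\,2+k) & \ell = 5\\ (6+k,\,4+k,\,3+k,\,3+k,\,3) & \ell = 6\\ (6+k,\,4+k,\,4+k,\,3+k,\,3+k,\,3) & \ell = 7\\ (5+k,\,4+k,\,(3+k)^4,\,3,\,1^{\ell-8}) & \ell \ge 8\end{cases}$$ $$\mu_{k,\ell} = \begin{cases} (8+5k,\,6+4k,\,3+2k,\,k) & \ell = 5\\ (6+k,\,3+k,\,3+k,\,3,\,1) & \ell = 6\\ (6+k,\,3+k,\,3+k,\,3,\,1,\,1) & \ell = 7\\ (5+k,\,(3+k)^{\ell-8},\,2+k,\,2+k,\,2,\,1) & \ell \ge 8\end{cases}$$ (exponents denote repeated parts; a final zero is not a part). -/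

import Mathlib

open scoped TensorProduct MatrixGroups

noncomputable section

namespace Plethysm

/-! ### Symmetric powers of a representation -/

section SymmetricPowers

variable {G V : Type*} [Group G] [AddCommGroup V] [Module ℂ V]

/-- The action of `G` on the symmetric algebra of a representation `V`: each `g` acts by the
algebra endomorphism extending its action on `V`. -/
def symAlgRep (ρ : Representation ℂ G V) : Representation ℂ G (SymmetricAlgebra ℂ V) where
  toFun g := (SymmetricAlgebra.lift (SymmetricAlgebra.ι ℂ V ∘ₗ ρ g)).toLinearMap
  map_one' := by
    have h : SymmetricAlgebra.ι ℂ V ∘ₗ ρ 1 = SymmetricAlgebra.ι ℂ V := by ext v; simp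
    rw [h, SymmetricAlgebra.lift_ι]
    rfl
  map_mul' g h := by
    have key : SymmetricAlgebra.lift (SymmetricAlgebra.ι ℂ V ∘ₗ ρ (g * h)) =
        (SymmetricAlgebra.lift (SymmetricAlgebra.ι ℂ V ∘ₗ ρ g)).comp
          (SymmetricAlgebra.lift (SymmetricAlgebra.ι ℂ V ∘ₗ ρ h)) := by
      apply SymmetricAlgebra.algHom_ext
      ext v
      simp
    rw [key]
    rfl

lemma symAlgRep_ι (ρ : Representation ℂ G V) (g : G) (v : V) :
    symAlgRep ρ g (SymmetricAlgebra.ι ℂ V v) = SymmetricAlgebra.ι ℂ V (ρ g v) :=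
  SymmetricAlgebra.lift_ι_apply _ _

lemma symAlgRep_prod (ρ : Representation ℂ G V) (g : G) {κ : Type*} (s : Finset κ)
    (f : κ → SymmetricAlgebra ℂ V) :
    symAlgRep ρ g (∏ j ∈ s, f j) = ∏ j ∈ s, symAlgRep ρ g (f j) :=
  map_prod (SymmetricAlgebra.lift (SymmetricAlgebra.ι ℂ V ∘ₗ ρ g)) f s

/-- `Sym ^ n V`, as a subrepresentation of the symmetric algebra: the linear span of all products
of `n` elements of `V`. -/
def symPowSub (n : ℕ) (ρ : Representation ℂ G V) : Subrepresentation (symAlgRep ρ) where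
  toSubmodule := Submodule.span ℂ
    (Set.range fun v : Fin n → V => ∏ j, SymmetricAlgebra.ι ℂ V (v j))
  apply_mem_toSubmodule g := by
    suffices h : Submodule.span ℂ
        (Set.range fun v : Fin n → V => ∏ j, SymmetricAlgebra.ι ℂ V (v j)) ≤
        (Submodule.span ℂ
          (Set.range fun v : Fin n → V => ∏ j, SymmetricAlgebra.ι ℂ V (v j))).comap
          (symAlgRep ρ g) from fun x hx => h hx
    rw [Submodule.span_le]
    rintro _ ⟨v, rfl⟩
    refine Submodule.subset_span ⟨fun j => ρ g (v j), ?_⟩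
    simp only [symAlgRep_prod, symAlgRep_ι]

/-- The representation of `G` on `Sym ^ n V`. -/
abbrev symPowRep (n : ℕ) (ρ : Representation ℂ G V) :
    Representation ℂ G (symPowSub n ρ).toSubmodule :=
  (symPowSub n ρ).toRepresentation

end SymmetricPowers

/-! ### Schur functors

A partition is a `YoungDiagram`; rows and columns are numbered from `0`, so that
`lam.rowLen i` is the part of index `i + 1`, and `lam.colLen 0` is the number of (non-zero) parts. -/

/-- The group of all permutations of the boxes that permute within themselves the boxes in each
column. -/
def columnGroup (lam : YoungDiagram) : Subgroup (Equiv.Perm lam.cells) where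
  carrier := {τ | ∀ b, (τ b).1.2 = b.1.2}
  one_mem' _ := rfl
  mul_mem' {σ τ} hσ hτ b := by
    rw [Equiv.Perm.mul_apply, hσ, hτ]
  inv_mem' {τ} hτ b := by
    simpa using (hτ (τ⁻¹ b)).symm

section SchurFunctor

variable {G V : Type*} [Group G] [AddCommGroup V] [Module ℂ V]

variable (V) in
/-- The tensor product over the rows `i` of `lam` of copies of the symmetric algebra of `V`; its
multihomogeneous component of multidegree `(lam.rowLen i)_i` is `⨂ i, Sym ^ (lam.rowLen i) V`. -/
abbrev RowTensor (lam : YoungDiagram) : Type _ :=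
  ⨂[ℂ] _i : Fin (lam.colLen 0), SymmetricAlgebra ℂ V

/-- For a tableau `t` of shape `lam` with entries in `V`, the tensor product over the rows of
`lam` of the product of the entries of `t` in that row. -/
def rowTabloid (lam : YoungDiagram) (t : lam.cells → V) : RowTensor V lam :=
  PiTensorProduct.tprod ℂ fun i =>
    ∏ b : lam.cells with b.1.1 = (i : ℕ), SymmetricAlgebra.ι ℂ V (t b)

open scoped Classical in
/-- The `GL`-polytabloid of a tableau `t`: the signed sum of the row tabloids of `τ · t`, over
the column group, where `(τ · t) b = t (τ⁻¹ b)`. -/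
def polytabloid (lam : YoungDiagram) (t : lam.cells → V) : RowTensor V lam :=
  ∑ τ : columnGroup lam,
    ((Equiv.Perm.sign (τ : Equiv.Perm lam.cells) : ℤ) : ℂ) •
      rowTabloid lam fun b => t ((τ : Equiv.Perm lam.cells)⁻¹ b)

/-- The diagonal action of `G` on the tensor product over the rows. -/
def rowTensorRep (lam : YoungDiagram) (ρ : Representation ℂ G V) :
    Representation ℂ G (RowTensor V lam) where
  toFun g := PiTensorProduct.map fun _ => symAlgRep ρ g
  map_one' := by
    rw [map_one]
    exact PiTensorProduct.map_one
  map_mul' g h := by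
    rw [map_mul]
    exact PiTensorProduct.map_mul _ _

lemma rowTensorRep_rowTabloid (lam : YoungDiagram) (ρ : Representation ℂ G V) (g : G)
    (t : lam.cells → V) :
    rowTensorRep lam ρ g (rowTabloid lam t) = rowTabloid lam fun b => ρ g (t b) := by
  change PiTensorProduct.map (fun _ => symAlgRep ρ g) (PiTensorProduct.tprod ℂ _) = _
  rw [PiTensorProduct.map_tprod]
  simp only [symAlgRep_prod, symAlgRep_ι]
  rfl

lemma rowTensorRep_polytabloid (lam : YoungDiagram) (ρ : Representation ℂ G V) (g : G)
    (t : lam.cells → V) :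
    rowTensorRep lam ρ g (polytabloid lam t) = polytabloid lam fun b => ρ g (t b) := by
  simp only [polytabloid, map_sum, map_smul, rowTensorRep_rowTabloid]

/-- `∇ ^ lam V`: the linear span of all `GL`-polytabloids of shape `lam`. By multilinearity it
makes no difference whether tableaux have entries in `V` or in a fixed basis of `V`. -/
def schurSub (lam : YoungDiagram) (ρ : Representation ℂ G V) :
    Subrepresentation (rowTensorRep lam ρ) where
  toSubmodule := Submodule.span ℂ (Set.range (polytabloid (V := V) lam))
  apply_mem_toSubmodule g := by
    suffices h : Submodule.span ℂ (Set.range (polytabloid (V := V) lam)) ≤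
        (Submodule.span ℂ (Set.range (polytabloid (V := V) lam))).comap (rowTensorRep lam ρ g) from
      fun x hx => h hx
    rw [Submodule.span_le]
    rintro _ ⟨t, rfl⟩
    exact Submodule.subset_span ⟨fun b => ρ g (t b), (rowTensorRep_polytabloid lam ρ g t).symm⟩

/-- The representation of `G` on `∇ ^ lam V`. -/
abbrev schurRep (lam : YoungDiagram) (ρ : Representation ℂ G V) :
    Representation ℂ G (schurSub lam ρ).toSubmodule :=
  (schurSub lam ρ).toRepresentation

end SchurFunctor

/-! ### Plethystic equivalence -/

/-- The natural two-dimensional representation `E` of `SL₂(ℂ)`. -/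
def natRep : Representation ℂ SL(2, ℂ) (Fin 2 → ℂ) where
  toFun g := Matrix.toLin' (g : Matrix (Fin 2) (Fin 2) ℂ)
  map_one' := by
    rw [Matrix.SpecialLinearGroup.coe_one, Matrix.toLin'_one]
    rfl
  map_mul' g h := by
    rw [Matrix.SpecialLinearGroup.coe_mul, Matrix.toLin'_mul]
    rfl

/-- The plethystic equivalence of `(lam, ℓ)` and `(mu, m)`: `∇ ^ lam Sym ^ ℓ E` and
`∇ ^ mu Sym ^ m E` are isomorphic representations of `SL₂(ℂ)`. -/
def PlethysticEquiv (lam : YoungDiagram) (ℓ : ℕ) (mu : YoungDiagram) (m : ℕ) : Prop :=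
  Nonempty ((schurRep lam (symPowRep ℓ natRep)).Equiv (schurRep mu (symPowRep m natRep)))

/-! ### Complements and exceptional pairs -/

/-- For a partition `lam` with at most `r` parts and largest part `a`, its complement in the
`r × a` box: the row of index `i < r` has length `a - lam.rowLen (r - 1 - i)`. -/
def complement (r : ℕ) (lam : YoungDiagram) : YoungDiagram where
  cells := (Finset.range r ×ˢ Finset.range (lam.rowLen 0)).filter fun c =>
    c.2 < lam.rowLen 0 - lam.rowLen (r - 1 - c.1)
  isLowerSet := by
    rintro ⟨i, j⟩ ⟨i', j'⟩ ⟨hi : i' ≤ i, hj : j' ≤ j⟩ h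
    simp only [Finset.coe_filter, Finset.mem_product, Finset.mem_range, Set.mem_ofPred_eq] at h ⊢
    have := lam.rowLen_anti (r - 1 - i) (r - 1 - i') (by omega)
    omega

/-- An exceptional pair for `ℓ`: partitions with at most `ℓ` parts that are equivalent in equal
degree `ℓ`, are different, and are not complements of each other in a box with `ℓ + 1` rows. -/
def IsExceptional (ℓ : ℕ) (lam mu : YoungDiagram) : Prop :=
  lam.colLen 0 ≤ ℓ ∧ mu.colLen 0 ≤ ℓ ∧ PlethysticEquiv lam ℓ mu ℓ ∧
    lam ≠ mu ∧ lam ≠ complement (ℓ + 1) mu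

/-- The parts of the first member of the explicit pair with parameters `k` and `ℓ ≥ 5`. -/
def exceptionalParts₁ (k ℓ : ℕ) : List ℕ :=
  if ℓ = 5 then [8 + 5 * k, 7 + 4 * k, 2 + 2 * k, 2 + k]
  else if ℓ = 6 then [6 + k, 4 + k, 3 + k, 3 + k, 3]
  else if ℓ = 7 then [6 + k, 4 + k, 4 + k, 3 + k, 3 + k, 3]
  else [5 + k, 4 + k, 3 + k, 3 + k, 3 + k, 3 + k, 3] ++ List.replicate (ℓ - 8) 1

/-- The parts of the second member of the explicit pair with parameters `k` and `ℓ ≥ 5`; the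
last entry for `ℓ = 5` is zero, hence not a part, when `k = 0`. -/
def exceptionalParts₂ (k ℓ : ℕ) : List ℕ :=
  if ℓ = 5 then [8 + 5 * k, 6 + 4 * k, 3 + 2 * k, k]
  else if ℓ = 6 then [6 + k, 3 + k, 3 + k, 3, 1]
  else if ℓ = 7 then [6 + k, 3 + k, 3 + k, 3, 1, 1]
  else [5 + k] ++ List.replicate (ℓ - 8) (3 + k) ++ [2 + k, 2 + k, 2, 1]

lemma exceptionalParts₁_sorted (k ℓ : ℕ) : (exceptionalParts₁ k ℓ).SortedGE := by
  rw [List.sortedGE_iff_pairwise]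
  unfold exceptionalParts₁
  split_ifs <;> simp [List.pairwise_replicate] <;> omega

lemma exceptionalParts₂_sorted (k ℓ : ℕ) : (exceptionalParts₂ k ℓ).SortedGE := by
  rw [List.sortedGE_iff_pairwise]
  unfold exceptionalParts₂
  split_ifs <;> simp [List.pairwise_append, List.pairwise_replicate]
  all_goals grind

/-- The first member of the explicit pair with parameters `k` and `ℓ`. -/
def exceptional₁ (k ℓ : ℕ) : YoungDiagram :=
  YoungDiagram.ofRowLens (exceptionalParts₁ k ℓ) (exceptionalParts₁_sorted k ℓ)

/-- The second member of the explicit pair with parameters `k` and `ℓ`. -/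
def exceptional₂ (k ℓ : ℕ) : YoungDiagram :=
  YoungDiagram.ofRowLens (exceptionalParts₂ k ℓ) (exceptionalParts₂_sorted k ℓ)

end Plethysm

end

noncomputable section

namespace Plethysm

open Module

/-! ### Multisets of exponents -/

/-! Representations are compared through the traces of the diagonal torus. That equal traces force
an isomorphism rests on an algebraic form of the unitarian trick: the representations concerned
carry an inner product for which the adjoint of `g` acts as its conjugate transpose (`HasStar`).
Orthogonal complements are then stable, and a vector `v` of top weight `n` is fixed by the upper
unitriangular matrices. Hence ⟪v, g v⟫ = (g₀₀)ⁿ ⟪v, v⟫ on the big cell, so the Gram matrix of the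
orbit of `v` depends only on its weight and norm, and so does the cyclic subrepresentation it
generates. Peeling these off by induction on dimension gives `IsStar.nonempty_equiv`. The form
passes to Symⁿ and to Schur functors because these are spanned by the values of equivariant
multilinear maps.

Semistandard polytabloids form a basis of weight vectors of a Schur functor: Garnir relations give
spanning, and triangularity gives independence. The trace is therefore the Schur polynomial at qⁿ,
qⁿ⁻², …, q⁻ⁿ. The bialternant formula `schurSum_mul_alternant`, obtained by matching the branching
rules of tableaux and of alternants, turns it into the product over i < j of q^(βᵢ - βⱼ) - q^(βⱼ -
βᵢ), where β is the bead set, divided by a product that depends only on `n`. The factors can be read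
off from their product, so in equal degree the equivalence says that the two sets of ℓ + 1 beads
have the same multiset of differences (`plethysticEquiv_iff_diffs`).

Complementation reflects the bead set and so preserves differences. With at most ℓ parts the least
bead is 0, so (a) says that a set of at most five integers is determined by its differences up to
translation and reflection, which is an elementary comparison of gaps. For six or more beads this
fails. If B is the generating function of the beads, the differences are encoded by B(q)B(1/q), and
for the explicit families the equality of these products is a rational identity in q, qᵏ and, when ℓ
≥ 8, q^(ℓ-8). -/

lemma coeff_sum_map_X_pow (M : Multiset ℕ) (k : ℕ) :
    (M.map fun m => (Polynomial.X ^ m : Polynomial ℝ)).sum.coeff k = M.count k := by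
  induction M using Multiset.induction_on with
  | empty => simp
  | cons a M ih =>
    rw [Multiset.map_cons, Multiset.sum_cons, Polynomial.coeff_add, ih, Polynomial.coeff_X_pow,
      Multiset.count_cons]
    push_cast
    rw [add_comm]

/-- A finite multiset of integers is determined by its generating Laurent polynomial. -/
lemma multiset_eq_of_sum_zpow_eq {M N : Multiset ℤ}
    (h : ∀ q : ℝ, 1 < q → (M.map fun m => q ^ m).sum = (N.map fun m => q ^ m).sum) : M = N := by
  -- Shifting all exponents by `C` gives honest polynomials, which are determined by their values at
  -- infinitely many points.
  obtain ⟨C, hC⟩ : ∃ C : ℕ, ∀ m ∈ M + N, -(C : ℤ) ≤ m := by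
    refine ⟨((M + N).map Int.natAbs).sum, fun m hm => ?_⟩
    have := Multiset.single_le_sum (fun _ _ => Nat.zero_le _) _
      (Multiset.mem_map_of_mem Int.natAbs hm)
    omega
  have key : ∀ K : Multiset ℤ, (∀ m ∈ K, -(C : ℤ) ≤ m) → ∀ q : ℝ, 1 < q →
      ((K.map fun m : ℤ => (m + (C : ℤ)).toNat).map fun m => (Polynomial.X ^ m : Polynomial ℝ)).sum.eval q =
        (K.map fun m => q ^ m).sum * q ^ C := by
    intro K hK q hq
    rw [Polynomial.eval_multisetSum, Multiset.map_map, Multiset.map_map, ← Multiset.sum_map_mul_right]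
    congr 1
    refine Multiset.map_congr rfl fun m hm => ?_
    have := hK m hm
    have e : (((m + (C : ℤ)).toNat : ℕ) : ℤ) = m + C := Int.toNat_of_nonneg (by omega)
    simp only [Function.comp_apply, Polynomial.eval_pow, Polynomial.eval_X]
    rw [← zpow_natCast, e, zpow_add₀ (by positivity), zpow_natCast]
  have hM := key M fun m hm => hC m (Multiset.mem_add.2 (.inl hm))
  have hN := key N fun m hm => hC m (Multiset.mem_add.2 (.inr hm))
  have hP := Polynomial.eq_of_infinite_eval_eq _ _
    ((Set.Ioi_infinite (1 : ℝ)).mono fun q (hq : 1 < q) =>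
      show Polynomial.eval q _ = Polynomial.eval q _ from
        (hM q hq).trans ((congrArg (· * q ^ C) (h q hq)).trans (hN q hq).symm))
  have hMN : (M.map fun m : ℤ => (m + (C : ℤ)).toNat) = N.map fun m : ℤ => (m + (C : ℤ)).toNat := by
    ext k
    have := congrArg (fun P => Polynomial.coeff P k) hP
    simp only [coeff_sum_map_X_pow] at this
    exact_mod_cast this
  have back : ∀ K : Multiset ℤ, (∀ m ∈ K, -(C : ℤ) ≤ m) →
      ((K.map fun m : ℤ => (m + (C : ℤ)).toNat).map fun k : ℕ => (k : ℤ) - C) = K := by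
    intro K hK
    rw [Multiset.map_map]
    conv_rhs => rw [← Multiset.map_id K]
    refine Multiset.map_congr rfl fun m hm => ?_
    have := hK m hm
    simp only [Function.comp_apply, id]
    omega
  rw [← back M fun m hm => hC m (Multiset.mem_add.2 (.inl hm)), hMN,
    back N fun m hm => hC m (Multiset.mem_add.2 (.inr hm))]

/-! ### Elements of `SL₂(ℂ)` -/

/-- The diagonal matrix with entries `q`, `q⁻¹`. -/
def torus (q : ℂˣ) : SL(2, ℂ) := ⟨!![(q : ℂ), 0; 0, ((q⁻¹ : ℂˣ) : ℂ)], by simp⟩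

/-- The upper unitriangular matrix with off-diagonal entry `t`. -/
def upper (t : ℂ) : SL(2, ℂ) := ⟨!![1, t; 0, 1], by simp⟩

/-- The lower unitriangular matrix with off-diagonal entry `t`. -/
def lower (t : ℂ) : SL(2, ℂ) := ⟨!![1, 0; t, 1], by simp⟩

/-- The conjugate transpose. -/
def adj (g : SL(2, ℂ)) : SL(2, ℂ) :=
  ⟨(g : Matrix (Fin 2) (Fin 2) ℂ).conjTranspose, by simp [Matrix.det_conjTranspose]⟩

lemma coe_torus (q : ℂˣ) : (torus q : Matrix (Fin 2) (Fin 2) ℂ) =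
    !![(q : ℂ), 0; 0, ((q⁻¹ : ℂˣ) : ℂ)] := rfl

lemma coe_upper (t : ℂ) : (upper t : Matrix (Fin 2) (Fin 2) ℂ) = !![1, t; 0, 1] := rfl

lemma coe_lower (t : ℂ) : (lower t : Matrix (Fin 2) (Fin 2) ℂ) = !![1, 0; t, 1] := rfl

lemma adj_adj (g : SL(2, ℂ)) : adj (adj g) = g := by
  apply Subtype.ext
  simp [adj]

lemma adj_lower (t : ℂ) : adj (lower t) = upper (star t) := by
  apply Subtype.ext
  ext i j
  fin_cases i <;> fin_cases j <;> simp [adj, lower, upper]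

lemma adj_torus (q : ℂˣ) : adj (torus q) = torus (star q) := by
  apply Subtype.ext
  ext i j
  fin_cases i <;> fin_cases j <;> simp [adj, torus]

lemma torus_mul_upper (q : ℂˣ) (t : ℂ) :
    torus q * upper t * torus q⁻¹ = upper ((q : ℂ) ^ 2 * t) := by
  apply Subtype.ext
  ext i j
  fin_cases i <;> fin_cases j <;> simp [coe_torus, coe_upper, Matrix.mul_apply, Fin.sum_univ_two]
  ring

lemma upper_zero : upper 0 = 1 := by
  apply Subtype.ext
  ext i j
  fin_cases i <;> fin_cases j <;> simp [upper]

lemma lower_zero : lower 0 = 1 := by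
  apply Subtype.ext
  ext i j
  fin_cases i <;> fin_cases j <;> simp [lower]

lemma continuous_upper : Continuous upper := by
  refine Continuous.subtype_mk (continuous_matrix fun i j => ?_) _
  fin_cases i <;> fin_cases j <;> simp <;> fun_prop

lemma continuous_lower : Continuous lower := by
  refine Continuous.subtype_mk (continuous_matrix fun i j => ?_) _
  fin_cases i <;> fin_cases j <;> simp <;> fun_prop

/-- The Gauss decomposition on the big cell, where the upper left entry is invertible. -/
lemma eq_lower_mul_torus_mul_upper (g : SL(2, ℂ)) (q : ℂˣ) (h : g 0 0 = q) :
    g = lower (g 1 0 / q) * torus q * upper (g 0 1 / q) := by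
  have hd : g 0 0 * g 1 1 - g 0 1 * g 1 0 = 1 := by
    rw [← Matrix.det_fin_two]; exact g.2
  have hq : (q : ℂ) ≠ 0 := q.ne_zero
  apply Subtype.ext
  ext i j
  fin_cases i <;> fin_cases j <;>
    simp [coe_torus, coe_upper, coe_lower, Matrix.mul_apply, Fin.sum_univ_two, h]
  · field_simp
  · field_simp
    rw [← h]
    linear_combination hd

/-! ### Weight vectors -/

section Weights

variable {V W : Type*} [AddCommGroup V] [Module ℂ V] [AddCommGroup W] [Module ℂ W]

/-- The vectors that are eigenvectors for the diagonal torus, with an integral weight. -/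
def weightVectors (σ : Representation ℂ SL(2, ℂ) V) : Set V :=
  {x | ∃ m : ℤ, ∀ q : ℂˣ, σ (torus q) x = (q : ℂ) ^ m • x}

lemma exists_weight_basis [FiniteDimensional ℂ V] (σ : Representation ℂ SL(2, ℂ) V)
    (h : Submodule.span ℂ (weightVectors σ) = ⊤) :
    ∃ (s : Set V) (_ : Fintype s) (b : Basis s ℂ V) (m : s → ℤ),
      ∀ i, ∀ q : ℂˣ, σ (torus q) (b i) = (q : ℂ) ^ m i • b i := by
  have hmem : ∀ i, Basis.ofSpan h.ge i ∈ weightVectors σ :=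
    fun i => Basis.ofSpan_subset h.ge ⟨i, rfl⟩
  choose m hm using hmem
  exact ⟨_, FiniteDimensional.fintypeBasisIndex (Basis.ofSpan h.ge), Basis.ofSpan h.ge, m, hm⟩

lemma trace_torus {ι : Type*} [Fintype ι] (σ : Representation ℂ SL(2, ℂ) V) (b : Basis ι ℂ V)
    (m : ι → ℤ) (h : ∀ i, ∀ q : ℂˣ, σ (torus q) (b i) = (q : ℂ) ^ m i • b i) (q : ℂˣ) :
    LinearMap.trace ℂ V (σ (torus q)) = ∑ i, (q : ℂ) ^ m i := by
  classical
  rw [LinearMap.trace_eq_matrix_trace ℂ b, Matrix.trace]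
  refine Finset.sum_congr rfl fun i _ => ?_
  rw [Matrix.diag_apply, LinearMap.toMatrix_apply, h]
  simp

lemma span_weightVectors_of_surjective {σ : Representation ℂ SL(2, ℂ) V}
    {τ : Representation ℂ SL(2, ℂ) W} (f : V →ₗ[ℂ] W) (hf : Function.Surjective f)
    (hfe : ∀ g x, f (σ g x) = τ g (f x)) (h : Submodule.span ℂ (weightVectors σ) = ⊤) :
    Submodule.span ℂ (weightVectors τ) = ⊤ := by
  rw [eq_top_iff, ← LinearMap.range_eq_top.2 hf, ← Submodule.map_top, ← h, Submodule.map_span]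
  refine Submodule.span_mono ?_
  rintro _ ⟨x, ⟨m, hm⟩, rfl⟩
  exact ⟨m, fun q => by rw [← hfe, hm, map_smul]⟩

/-- Bases of weight vectors of representations with the same torus traces have the same weights. -/
lemma map_weights_eq {ι κ : Type*} [Fintype ι] [Fintype κ] {σ : Representation ℂ SL(2, ℂ) V}
    {τ : Representation ℂ SL(2, ℂ) W} (b : Basis ι ℂ V) (m : ι → ℤ)
    (h : ∀ i, ∀ q : ℂˣ, σ (torus q) (b i) = (q : ℂ) ^ m i • b i) (c : Basis κ ℂ W) (n : κ → ℤ)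
    (h' : ∀ i, ∀ q : ℂˣ, τ (torus q) (c i) = (q : ℂ) ^ n i • c i)
    (htr : ∀ q : ℂˣ, LinearMap.trace ℂ V (σ (torus q)) = LinearMap.trace ℂ W (τ (torus q))) :
    Finset.univ.val.map m = Finset.univ.val.map n := by
  refine multiset_eq_of_sum_zpow_eq fun q hq => ?_
  have hq0 : (q : ℂ) ≠ 0 := by
    have : q ≠ 0 := by linarith
    exact_mod_cast this
  have := htr (Units.mk0 (q : ℂ) hq0)
  rw [trace_torus σ b m h, trace_torus τ c n h'] at this
  simp only [Units.val_mk0] at this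
  rw [Multiset.map_map, Multiset.map_map]
  change ∑ i, q ^ m i = ∑ i, q ^ n i
  exact_mod_cast this

end Weights

/-! ### Representations with a form for which the adjoint of `g` is its conjugate transpose -/

section Star

variable {H H' : Type*} [NormedAddCommGroup H] [InnerProductSpace ℂ H]
  [NormedAddCommGroup H'] [InnerProductSpace ℂ H']

local notation "⟪" x ", " y "⟫" => inner ℂ x y

/-- A representation of `SL₂(ℂ)` on an inner product space, with continuous matrix coefficients,
such that the adjoint of the action of `g` is the action of the conjugate transpose of `g`. -/
structure IsStar (σ : Representation ℂ SL(2, ℂ) H) : Prop where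
  inner_map : ∀ g x y, ⟪x, σ g y⟫ = ⟪σ (adj g) x, y⟫
  cont : ∀ x y, Continuous fun g => ⟪x, σ g y⟫

variable {σ : Representation ℂ SL(2, ℂ) H} {σ' : Representation ℂ SL(2, ℂ) H'}

/-- A highest weight vector is fixed by the upper unitriangular matrices. -/
lemma IsStar.upper_apply (hσ : IsStar σ) {ι : Type*} (b : Basis ι ℂ H) (m : ι → ℤ)
    (hb : ∀ i, ∀ q : ℂˣ, σ (torus q) (b i) = (q : ℂ) ^ m i • b i) {n : ℤ} (hn : ∀ i, m i ≤ n)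
    {v : H} (hv : ∀ q : ℂˣ, σ (torus q) v = (q : ℂ) ^ n • v) (t : ℂ) : σ (upper t) v = v := by
  refine InnerProductSpace.ext_inner_left_basis b fun i => ?_
  set f : ℂ → ℂ := fun t => ⟪b i, σ (upper t) v⟫ with hf
  have hf0 : f 0 = ⟪b i, v⟫ := by simp [hf, upper_zero]
  have hcont : Continuous f := (hσ.cont (b i) v).comp continuous_upper
  obtain ⟨k, hk⟩ : ∃ k : ℕ, n = m i + k := ⟨(n - m i).toNat, by have := hn i; omega⟩
  -- Conjugation by the torus element 1/2 contracts `t` by 1/4. Moving that element across the form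
  -- makes it act on `b i` with weight `m i`, against weight `n` on `v`, and `k` is the difference
  -- of the two.
  have hscale : ∀ t, f t = (2⁻¹ : ℂ) ^ k * f ((2⁻¹ : ℂ) ^ 2 * t) := by
    intro t
    let q : ℂˣ := Units.mk0 (2⁻¹ : ℂ) (by norm_num)
    have hq : star q = q := by
      apply Units.ext
      simp [q]
    have h1 : σ (upper ((2⁻¹ : ℂ) ^ 2 * t)) v = (2⁻¹ : ℂ) ^ (-n) • σ (torus q) (σ (upper t) v) := by
      have : upper ((2⁻¹ : ℂ) ^ 2 * t) = torus q * upper t * torus q⁻¹ := by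
        rw [torus_mul_upper]; rfl
      rw [this, map_mul, map_mul, Module.End.mul_apply, Module.End.mul_apply, hv q⁻¹, map_smul,
        map_smul]
      simp [q]
    simp only [hf]
    rw [h1, inner_smul_right, hσ.inner_map (torus q), adj_torus, hq, hb, inner_smul_left, hk]
    simp only [q, Units.val_mk0, map_zpow₀, map_inv₀, Complex.conj_ofNat]
    rw [← mul_assoc, ← mul_assoc, ← zpow_natCast, ← zpow_add₀ (by norm_num),
      ← zpow_add₀ (by norm_num)]
    simp
  have hiter : ∀ j : ℕ, ∀ t, f t = ((2⁻¹ : ℂ) ^ k) ^ j * f (((2⁻¹ : ℂ) ^ 2) ^ j * t) := by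
    intro j
    induction j with
    | zero => simp
    | succ j ih =>
      intro t
      have e : ((2⁻¹ : ℂ) ^ 2) ^ (j + 1) * t = (2⁻¹ : ℂ) ^ 2 * (((2⁻¹ : ℂ) ^ 2) ^ j * t) := by ring
      rw [e, pow_succ ((2⁻¹ : ℂ) ^ k) j, mul_assoc, ← hscale]
      exact ih t
  have hlim : ∀ t, Filter.Tendsto (fun j : ℕ => f (((2⁻¹ : ℂ) ^ 2) ^ j * t)) Filter.atTop
      (nhds (f 0)) := by
    intro t
    refine (hcont.tendsto 0).comp ?_
    have := (tendsto_pow_atTop_nhds_zero_of_norm_lt_one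
      (show ‖((2⁻¹ : ℂ) ^ 2)‖ < 1 by norm_num)).mul_const t
    simpa using this
  change f t = ⟪b i, v⟫
  rw [← hf0]
  -- Iterating the scaling and using continuity at 0: for `k = 0` the coefficient is constantly `f
  -- 0`, and for `k > 0` it vanishes identically.
  rcases Nat.eq_zero_or_pos k with rfl | hk0
  · have : (fun j : ℕ => f (((2⁻¹ : ℂ) ^ 2) ^ j * t)) = fun _ => f t := by
      funext j
      rw [hiter j t]; simp
    exact tendsto_nhds_unique tendsto_const_nhds (this ▸ hlim t)
  · have hz : ∀ t, f t = 0 := by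
      intro t
      have h1 : Filter.Tendsto (fun j : ℕ => ((2⁻¹ : ℂ) ^ k) ^ j) Filter.atTop (nhds 0) := by
        refine tendsto_pow_atTop_nhds_zero_of_norm_lt_one ?_
        rw [norm_pow]
        exact pow_lt_one₀ (norm_nonneg _) (by norm_num) hk0.ne'
      have h2 := h1.mul (hlim t)
      rw [zero_mul] at h2
      have : (fun j : ℕ => ((2⁻¹ : ℂ) ^ k) ^ j * f (((2⁻¹ : ℂ) ^ 2) ^ j * t)) = fun _ => f t := by
        funext j
        rw [← hiter j t]
      exact tendsto_nhds_unique tendsto_const_nhds (this ▸ h2)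
    rw [hz, hz]

/-- In the Gauss decomposition of `g`, the upper factor fixes the right-hand `v`. The lower factor
becomes upper when moved to the left-hand `v`, which it also fixes. Only the torus factor
contributes. -/
lemma IsStar.inner_apply_of_upper_fixed (hσ : IsStar σ) {n : ℤ} {v : H}
    (hv : ∀ q : ℂˣ, σ (torus q) v = (q : ℂ) ^ n • v) (hu : ∀ t, σ (upper t) v = v)
    (g : SL(2, ℂ)) (hg : g 0 0 ≠ 0) : ⟪v, σ g v⟫ = (g 0 0) ^ n * ⟪v, v⟫ := by
  rw [eq_lower_mul_torus_mul_upper g (Units.mk0 _ hg) rfl, map_mul, map_mul, Module.End.mul_apply,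
    Module.End.mul_apply, hu, hv, hσ.inner_map, adj_lower, hu, inner_smul_right]
  congr 2
  simp [coe_torus, coe_upper, coe_lower, Matrix.mul_apply, Fin.sum_univ_two]

/-- On the big cell both sides are given by the same formula. A matrix with g₀₀ = 0 is the limit as
s → 0 of `g * lower s`, whose upper left entry g₀₁ s is nonzero for s ≠ 0, and matrix coefficients
are continuous. -/
lemma IsStar.inner_apply_eq (hσ : IsStar σ) (hσ' : IsStar σ') {n : ℤ} {v : H} {w : H'}
    (hv : ∀ q : ℂˣ, σ (torus q) v = (q : ℂ) ^ n • v) (hu : ∀ t, σ (upper t) v = v)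
    (hw : ∀ q : ℂˣ, σ' (torus q) w = (q : ℂ) ^ n • w) (hu' : ∀ t, σ' (upper t) w = w)
    (hvw : ⟪v, v⟫ = ⟪w, w⟫) (g : SL(2, ℂ)) : ⟪v, σ g v⟫ = ⟪w, σ' g w⟫ := by
  by_cases hg : g 0 0 = 0
  · have hb : g 0 1 ≠ 0 := by
      intro h
      have hd : g 0 0 * g 1 1 - g 0 1 * g 1 0 = 1 := by
        rw [← Matrix.det_fin_two]; exact g.2
      rw [hg, h] at hd
      simp at hd
    have hc : Continuous fun s : ℂ => g * lower s := continuous_const.mul continuous_lower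
    have key := Continuous.ext_on (dense_compl_singleton (0 : ℂ)) ((hσ.cont v v).comp hc)
      ((hσ'.cont w w).comp hc) fun s hs => by
        have : (g * lower s) 0 0 ≠ 0 := by
          simpa [coe_lower, Matrix.mul_apply, Fin.sum_univ_two, hg, hb] using hs
        simp only [Function.comp_apply]
        rw [hσ.inner_apply_of_upper_fixed hv hu _ this, hσ'.inner_apply_of_upper_fixed hw hu' _ this,
          hvw]
    simpa [lower_zero] using congrFun key 0
  · rw [hσ.inner_apply_of_upper_fixed hv hu _ hg, hσ'.inner_apply_of_upper_fixed hw hu' _ hg, hvw]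

end Star

/-! ### Complementary subrepresentations -/

section Complement

variable {G V : Type*} [Group G] [AddCommGroup V] [Module ℂ V] {σ : Representation ℂ G V}

lemma coe_toRepresentation_apply (A : Subrepresentation σ) (g : G) (x : A.toSubmodule) :
    (A.toRepresentation g x : V) = σ g x := rfl

lemma prodEquivOfIsCompl_toRepresentation (A B : Subrepresentation σ)
    (h : IsCompl A.toSubmodule B.toSubmodule) (g : G) (x : A.toSubmodule × B.toSubmodule) :
    Submodule.prodEquivOfIsCompl _ _ h (A.toRepresentation g x.1, B.toRepresentation g x.2) =
      σ g (Submodule.prodEquivOfIsCompl _ _ h x) := by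
  simp [Submodule.coe_prodEquivOfIsCompl', coe_toRepresentation_apply]

lemma trace_eq_add_of_isCompl [FiniteDimensional ℂ V] (A B : Subrepresentation σ)
    (h : IsCompl A.toSubmodule B.toSubmodule) (g : G) :
    LinearMap.trace ℂ V (σ g) = LinearMap.trace ℂ _ (A.toRepresentation g) +
      LinearMap.trace ℂ _ (B.toRepresentation g) := by
  rw [← LinearMap.trace_prodMap', ← LinearMap.trace_conj' _ (Submodule.prodEquivOfIsCompl _ _ h)]
  congr 1
  ext x
  obtain ⟨y, rfl⟩ := (Submodule.prodEquivOfIsCompl _ _ h).surjective x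
  rw [LinearEquiv.conj_apply_apply, LinearEquiv.symm_apply_apply,
    ← prodEquivOfIsCompl_toRepresentation]
  rfl

lemma trace_eq_of_equiv {W : Type*} [AddCommGroup W] [Module ℂ W] {τ : Representation ℂ G W}
    (e : σ.Equiv τ) (g : G) : LinearMap.trace ℂ V (σ g) = LinearMap.trace ℂ W (τ g) := by
  rw [← LinearMap.trace_conj' (σ g) e.toLinearEquiv]
  congr 1
  exact e.conj_apply_self g

lemma nonempty_equiv_of_isCompl {W : Type*} [AddCommGroup W] [Module ℂ W]
    {τ : Representation ℂ G W} (A B : Subrepresentation σ)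
    (h : IsCompl A.toSubmodule B.toSubmodule) (A' B' : Subrepresentation τ)
    (h' : IsCompl A'.toSubmodule B'.toSubmodule)
    (eA : Nonempty (A.toRepresentation.Equiv A'.toRepresentation))
    (eB : Nonempty (B.toRepresentation.Equiv B'.toRepresentation)) : Nonempty (σ.Equiv τ) := by
  obtain ⟨eA⟩ := eA
  obtain ⟨eB⟩ := eB
  refine ⟨.mk ((Submodule.prodEquivOfIsCompl _ _ h).symm ≪≫ₗ
    (eA.toLinearEquiv.prodCongr eB.toLinearEquiv) ≪≫ₗ
      Submodule.prodEquivOfIsCompl _ _ h') fun g => ?_⟩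
  ext x
  obtain ⟨y, rfl⟩ := (Submodule.prodEquivOfIsCompl _ _ h).surjective x
  simp only [LinearMap.comp_apply, LinearEquiv.coe_coe, LinearEquiv.trans_apply]
  rw [← prodEquivOfIsCompl_toRepresentation A B h, LinearEquiv.symm_apply_apply,
    LinearEquiv.symm_apply_apply, ← prodEquivOfIsCompl_toRepresentation A' B' h']
  congr 1
  refine Prod.ext ?_ ?_
  · exact LinearMap.congr_fun (eA.isIntertwining' g) y.1
  · exact LinearMap.congr_fun (eB.isIntertwining' g) y.2

/-- A direct summand is an equivariant quotient, by projection along the other summand. -/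
lemma span_weightVectors_left {V : Type*} [AddCommGroup V] [Module ℂ V]
    {σ : Representation ℂ SL(2, ℂ) V} (A B : Subrepresentation σ)
    (h : IsCompl A.toSubmodule B.toSubmodule) (hw : Submodule.span ℂ (weightVectors σ) = ⊤) :
    Submodule.span ℂ (weightVectors A.toRepresentation) = ⊤ := by
  refine span_weightVectors_of_surjective
    (LinearMap.fst ℂ _ _ ∘ₗ (Submodule.prodEquivOfIsCompl _ _ h).symm.toLinearMap)
    ((LinearMap.fst_surjective (R := ℂ) (M := A.toSubmodule) (M₂ := B.toSubmodule)).comp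
      (LinearEquiv.surjective _)) (fun g x => ?_) hw
  obtain ⟨y, rfl⟩ := (Submodule.prodEquivOfIsCompl _ _ h).surjective x
  simp only [LinearMap.comp_apply, LinearEquiv.coe_coe]
  rw [← prodEquivOfIsCompl_toRepresentation A B h, LinearEquiv.symm_apply_apply,
    LinearEquiv.symm_apply_apply]
  rfl

end Complement

/-! ### Cyclic subrepresentations -/

section Cyclic

variable {G V : Type*} [Group G] [AddCommGroup V] [Module ℂ V] (σ : Representation ℂ G V)

/-- The combination `∑ g, c g • σ g v`. -/
def cyclicMap (v : V) : (G →₀ ℂ) →ₗ[ℂ] V := Finsupp.linearCombination ℂ fun g => σ g v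

lemma apply_cyclicMap (v : V) (g : G) (c : G →₀ ℂ) :
    σ g (cyclicMap σ v c) = cyclicMap σ v (Finsupp.lmapDomain ℂ ℂ (g * ·) c) := by
  induction c using Finsupp.induction_linear with
  | zero => simp
  | add f h hf hh => simp only [map_add, hf, hh]
  | single h c => simp [cyclicMap, Finsupp.linearCombination_single]

/-- The subrepresentation generated by a vector. -/
def cyclic (v : V) : Subrepresentation σ where
  toSubmodule := LinearMap.range (cyclicMap σ v)
  apply_mem_toSubmodule g := by
    rintro _ ⟨c, rfl⟩
    exact ⟨_, (apply_cyclicMap σ v g c).symm⟩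

lemma mem_cyclic (v : V) : v ∈ (cyclic σ v).toSubmodule :=
  ⟨Finsupp.single 1 1, by simp [cyclicMap, Finsupp.linearCombination_single]⟩

/-- Cyclic representations with the same relations are isomorphic. -/
lemma nonempty_cyclic_equiv {W : Type*} [AddCommGroup W] [Module ℂ W] (τ : Representation ℂ G W)
    (v : V) (w : W) (h : LinearMap.ker (cyclicMap σ v) = LinearMap.ker (cyclicMap τ w)) :
    Nonempty ((cyclic σ v).toRepresentation.Equiv (cyclic τ w).toRepresentation) := by
  set e : LinearMap.range (cyclicMap σ v) ≃ₗ[ℂ] LinearMap.range (cyclicMap τ w) :=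
    (cyclicMap σ v).quotKerEquivRange.symm ≪≫ₗ Submodule.quotEquivOfEq _ _ h ≪≫ₗ
      (cyclicMap τ w).quotKerEquivRange with he
  have key : ∀ c, e ((cyclicMap σ v).rangeRestrict c) = (cyclicMap τ w).rangeRestrict c := by
    intro c
    have : (cyclicMap σ v).rangeRestrict c =
        (cyclicMap σ v).quotKerEquivRange (Submodule.Quotient.mk c) := rfl
    rw [this, he]
    simp only [LinearEquiv.trans_apply, LinearEquiv.symm_apply_apply]
    rfl
  refine ⟨.mk e fun g => ?_⟩
  ext x
  obtain ⟨c, hc⟩ := x.2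
  obtain rfl : x = (cyclicMap σ v).rangeRestrict c := Subtype.ext hc.symm
  have h1 : (cyclic σ v).toRepresentation g ((cyclicMap σ v).rangeRestrict c) =
      (cyclicMap σ v).rangeRestrict (Finsupp.lmapDomain ℂ ℂ (g * ·) c) :=
    Subtype.ext (apply_cyclicMap σ v g c)
  have h2 : (cyclic τ w).toRepresentation g ((cyclicMap τ w).rangeRestrict c) =
      (cyclicMap τ w).rangeRestrict (Finsupp.lmapDomain ℂ ℂ (g * ·) c) :=
    Subtype.ext (apply_cyclicMap τ w g c)
  change ((e ((cyclic σ v).toRepresentation g ((cyclicMap σ v).rangeRestrict c)) :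
    LinearMap.range (cyclicMap τ w)) : W) = ((cyclic τ w).toRepresentation g
      (e ((cyclicMap σ v).rangeRestrict c)) : LinearMap.range (cyclicMap τ w))
  rw [h1, key, key, h2]

end Cyclic

/-! ### Uniqueness of representations with given weights -/

section Uniqueness

local notation "⟪" x ", " y "⟫" => inner ℂ x y

variable {H H' : Type*} [NormedAddCommGroup H] [InnerProductSpace ℂ H]
  [NormedAddCommGroup H'] [InnerProductSpace ℂ H']
  {σ : Representation ℂ SL(2, ℂ) H} {σ' : Representation ℂ SL(2, ℂ) H'}

/-- The orthogonal complement of a subrepresentation. -/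
def IsStar.orthogonal (hσ : IsStar σ) (A : Subrepresentation σ) : Subrepresentation σ where
  toSubmodule := A.toSubmoduleᗮ
  apply_mem_toSubmodule g x hx := by
    rw [Submodule.mem_orthogonal] at hx ⊢
    intro u hu
    rw [hσ.inner_map]
    exact hx _ (A.apply_mem_toSubmodule _ hu)

lemma IsStar.toRepresentation (hσ : IsStar σ) (A : Subrepresentation σ) :
    IsStar A.toRepresentation where
  inner_map g x y := hσ.inner_map g (x : H) (y : H)
  cont x y := hσ.cont (x : H) (y : H)

/-- Since ⟪k v, l v⟫ = ⟪v, (adj k · l) v⟫, the hypothesis identifies the Gram matrices of the two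
orbits. By definiteness a linear relation in an orbit is a vector on which the Gram form vanishes.
-/
lemma IsStar.ker_cyclicMap_eq (hσ : IsStar σ) (hσ' : IsStar σ') {v : H} {w : H'}
    (h : ∀ g, ⟪v, σ g v⟫ = ⟪w, σ' g w⟫) :
    LinearMap.ker (cyclicMap σ v) = LinearMap.ker (cyclicMap σ' w) := by
  have h2 : ∀ c d, ⟪cyclicMap σ v c, cyclicMap σ v d⟫ = ⟪cyclicMap σ' w c, cyclicMap σ' w d⟫ := by
    intro c d
    induction c using Finsupp.induction_linear with
    | zero => simp
    | add f k hf hk => simp only [map_add, inner_add_left, hf, hk]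
    | single k c =>
      induction d using Finsupp.induction_linear with
      | zero => simp
      | add f k hf hk => simp only [map_add, inner_add_right, hf, hk]
      | single l d =>
        have := h (adj k * l)
        rw [map_mul, map_mul, Module.End.mul_apply, Module.End.mul_apply, hσ.inner_map,
          hσ'.inner_map, adj_adj] at this
        simp only [cyclicMap, Finsupp.linearCombination_single, inner_smul_left, inner_smul_right,
          this]
  ext c
  rw [LinearMap.mem_ker, LinearMap.mem_ker, ← inner_self_eq_zero (𝕜 := ℂ), h2, inner_self_eq_zero]

lemma exists_normalized {n : ℤ} {v : H} (hv : v ≠ 0)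
    (hw : ∀ q : ℂˣ, σ (torus q) v = (q : ℂ) ^ n • v) :
    ∃ v : H, v ≠ 0 ∧ ⟪v, v⟫ = 1 ∧ ∀ q : ℂˣ, σ (torus q) v = (q : ℂ) ^ n • v := by
  have h0 : (‖v‖ : ℂ)⁻¹ ≠ 0 := by simpa using hv
  refine ⟨(‖v‖ : ℂ)⁻¹ • v, smul_ne_zero h0 hv, ?_, fun q => by rw [map_smul, hw, smul_comm]⟩
  rw [inner_self_eq_norm_sq_to_K, norm_smul]
  have : ‖v‖ ≠ 0 := by simpa using hv
  simp [this]

end Uniqueness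

/-- A representation with a star form that is spanned by weight vectors is determined by the
traces of the torus elements. -/
theorem IsStar.nonempty_equiv (N : ℕ) : ∀ {H H' : Type} [NormedAddCommGroup H]
    [InnerProductSpace ℂ H] [NormedAddCommGroup H'] [InnerProductSpace ℂ H']
    [FiniteDimensional ℂ H] [FiniteDimensional ℂ H']
    {σ : Representation ℂ SL(2, ℂ) H} {σ' : Representation ℂ SL(2, ℂ) H'},
    finrank ℂ H ≤ N → IsStar σ → IsStar σ' →
    Submodule.span ℂ (weightVectors σ) = ⊤ → Submodule.span ℂ (weightVectors σ') = ⊤ →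
    (∀ q : ℂˣ, LinearMap.trace ℂ H (σ (torus q)) = LinearMap.trace ℂ H' (σ' (torus q))) →
    Nonempty (σ.Equiv σ') := by
  induction N with
  | zero =>
    intro H H' _ _ _ _ _ _ σ σ' hN _ _ _ _ htr
    have ht : torus 1 = 1 := by
      apply Subtype.ext
      ext i j
      fin_cases i <;> fin_cases j <;> simp [torus]
    -- The trace at the identity is the dimension, so both spaces are zero.
    have h1 := htr 1
    rw [ht, map_one σ, map_one σ', LinearMap.trace_one, LinearMap.trace_one] at h1
    have h2 : finrank ℂ H = 0 := by omega
    have h3 : finrank ℂ H' = 0 := by rw [h2] at h1; exact_mod_cast h1.symm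
    have := finrank_zero_iff.1 h2
    have := finrank_zero_iff.1 h3
    exact ⟨.mk (LinearEquiv.ofFinrankEq _ _ (h2.trans h3.symm)) fun g =>
      LinearMap.ext fun x => Subsingleton.elim _ _⟩
  | succ N ih =>
    intro H H' _ _ _ _ _ _ σ σ' hN hσ hσ' hw hw' htr
    by_cases h0 : finrank ℂ H ≤ N
    · exact ih h0 hσ hσ' hw hw' htr
    obtain ⟨s, _, b, m, hb⟩ := exists_weight_basis σ hw
    obtain ⟨s', _, b', m', hb'⟩ := exists_weight_basis σ' hw'
    have hmm := map_weights_eq b m hb b' m' hb' htr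
    have hne : Nonempty s := by
      by_contra h
      rw [not_nonempty_iff] at h
      have := finrank_eq_card_basis b
      rw [Fintype.card_eq_zero] at this
      omega
    -- The two weight multisets coincide, so the top weight of `σ` is attained in `σ'` and is
    -- maximal there too.
    obtain ⟨i, hi⟩ := Finite.exists_max m
    obtain ⟨i', hi'⟩ : ∃ i', m' i' = m i := by
      have : m i ∈ Finset.univ.val.map m' := by
        rw [← hmm]; exact Multiset.mem_map_of_mem _ (Finset.mem_univ i)
      simpa using this
    have hmax' : ∀ j, m' j ≤ m i := by
      intro j
      have : m' j ∈ Finset.univ.val.map m := by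
        rw [hmm]; exact Multiset.mem_map_of_mem _ (Finset.mem_univ j)
      obtain ⟨k, -, hk⟩ := Multiset.mem_map.1 this
      exact hk ▸ hi k
    obtain ⟨v, hv0, hv1, hv⟩ := exists_normalized (b.ne_zero i) (hb i)
    obtain ⟨w, hw0, hw1, hwt⟩ := exists_normalized (b'.ne_zero i') (hb' i')
    rw [hi'] at hwt
    have hgram := hσ.inner_apply_eq hσ' hv (hσ.upper_apply b m hb hi hv) hwt
      (hσ'.upper_apply b' m' hb' hmax' hwt) (hv1.trans hw1.symm)
    obtain ⟨e⟩ := nonempty_cyclic_equiv σ σ' v w (hσ.ker_cyclicMap_eq hσ' hgram)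
    -- The cyclic parts are isomorphic and nonzero, so their orthogonal complements have equal
    -- traces and smaller dimension, and the induction applies to them.
    have hA : IsCompl (cyclic σ v).toSubmodule (hσ.orthogonal (cyclic σ v)).toSubmodule :=
      Submodule.isCompl_orthogonal _
    have hA' : IsCompl (cyclic σ' w).toSubmodule (hσ'.orthogonal (cyclic σ' w)).toSubmodule :=
      Submodule.isCompl_orthogonal _
    refine nonempty_equiv_of_isCompl _ _ hA _ _ hA' ⟨e⟩ (ih ?_ (hσ.toRepresentation _)
      (hσ'.toRepresentation _) (span_weightVectors_left _ _ hA.symm hw)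
      (span_weightVectors_left _ _ hA'.symm hw') fun q => ?_)
    · have h1 := Submodule.finrank_add_eq_of_isCompl hA
      have h2 : 0 < finrank ℂ (cyclic σ v).toSubmodule := by
        have : Nontrivial (cyclic σ v).toSubmodule :=
          ⟨⟨⟨v, mem_cyclic σ v⟩, 0, fun h => hv0 (congrArg Subtype.val h)⟩⟩
        exact finrank_pos
      omega
    · have h1 := trace_eq_add_of_isCompl _ _ hA (torus q)
      have h2 := trace_eq_add_of_isCompl _ _ hA' (torus q)
      rw [htr q, h2, trace_eq_of_equiv e] at h1
      exact (add_left_cancel h1).symm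

/-! ### Constructions of representations with a star form -/

section HasStar

local notation "⟪" x ", " y "⟫" => inner ℂ x y

/-- The representation is isomorphic to one with a star form. -/
def HasStar {V : Type*} [AddCommGroup V] [Module ℂ V] (ρ : Representation ℂ SL(2, ℂ) V) : Prop :=
  ∃ (H : Type) (_ : NormedAddCommGroup H) (_ : InnerProductSpace ℂ H) (_ : FiniteDimensional ℂ H)
    (σ : Representation ℂ SL(2, ℂ) H), IsStar σ ∧ Nonempty (σ.Equiv ρ)

lemma HasStar.nonempty_equiv {V W : Type*} [AddCommGroup V] [Module ℂ V] [AddCommGroup W]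
    [Module ℂ W] {ρ : Representation ℂ SL(2, ℂ) V} {τ : Representation ℂ SL(2, ℂ) W}
    (hρ : HasStar ρ) (hτ : HasStar τ)
    (hw : Submodule.span ℂ (weightVectors ρ) = ⊤) (hw' : Submodule.span ℂ (weightVectors τ) = ⊤)
    (htr : ∀ q : ℂˣ, LinearMap.trace ℂ V (ρ (torus q)) = LinearMap.trace ℂ W (τ (torus q))) :
    Nonempty (ρ.Equiv τ) := by
  obtain ⟨H, _, _, _, σ, hσ, ⟨e⟩⟩ := hρ
  obtain ⟨H', _, _, _, σ', hσ', ⟨e'⟩⟩ := hτ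
  obtain ⟨f⟩ := IsStar.nonempty_equiv _ le_rfl hσ hσ'
    (span_weightVectors_of_surjective e.symm.toLinearEquiv.toLinearMap
      e.symm.toLinearEquiv.surjective
      (fun g x => LinearMap.congr_fun (e.symm.isIntertwining' g) x) hw)
    (span_weightVectors_of_surjective e'.symm.toLinearEquiv.toLinearMap
      e'.symm.toLinearEquiv.surjective
      (fun g x => LinearMap.congr_fun (e'.symm.isIntertwining' g) x) hw')
    fun q => by rw [trace_eq_of_equiv e, trace_eq_of_equiv e', htr]
  exact ⟨e.symm.trans (f.trans e')⟩

variable {H : Type} [NormedAddCommGroup H] [InnerProductSpace ℂ H]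
  {σ : Representation ℂ SL(2, ℂ) H}

lemma IsStar.of_basis {ι : Type*} [Fintype ι] (b : Basis ι ℂ H)
    (h : ∀ g i j, ⟪b i, σ g (b j)⟫ = ⟪σ (adj g) (b i), b j⟫)
    (hc : ∀ i j, Continuous fun g => ⟪b i, σ g (b j)⟫) : IsStar σ where
  inner_map g x y := by
    rw [← b.sum_repr x, ← b.sum_repr y]
    simp only [map_sum, map_smul, sum_inner, inner_sum, inner_smul_left, inner_smul_right, h]
  cont x y := by
    rw [← b.sum_repr x, ← b.sum_repr y]
    simp only [map_sum, map_smul, sum_inner, inner_sum, inner_smul_left, inner_smul_right]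
    fun_prop

variable [FiniteDimensional ℂ H]

/-- The orthogonal complement of the kernel is stable, inherits the form, and maps isomorphically
onto the quotient. -/
lemma IsStar.hasStar_of_surjective (hσ : IsStar σ) {W : Type*} [AddCommGroup W] [Module ℂ W]
    {τ : Representation ℂ SL(2, ℂ) W} (f : H →ₗ[ℂ] W) (hf : Function.Surjective f)
    (hfe : ∀ g x, f (σ g x) = τ g (f x)) : HasStar τ := by
  let A : Subrepresentation σ :=
    { toSubmodule := LinearMap.ker f
      apply_mem_toSubmodule := fun g x hx => by
        rw [LinearMap.mem_ker] at hx ⊢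
        rw [hfe, hx, map_zero] }
  let B := hσ.orthogonal A
  have hAB : IsCompl A.toSubmodule B.toSubmodule := Submodule.isCompl_orthogonal _
  have hbij : Function.Bijective (f ∘ₗ B.toSubmodule.subtype) := by
    constructor
    · rw [← LinearMap.ker_eq_bot, LinearMap.ker_eq_bot']
      intro x hx
      have : (x : H) ∈ A.toSubmodule ⊓ B.toSubmodule := ⟨hx, x.2⟩
      rw [hAB.inf_eq_bot, Submodule.mem_bot] at this
      exact Subtype.ext this
    · intro w
      obtain ⟨x, rfl⟩ := hf w
      have : x ∈ A.toSubmodule ⊔ B.toSubmodule := by rw [hAB.sup_eq_top]; trivial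
      obtain ⟨a, ha, y, hy, rfl⟩ := Submodule.mem_sup.1 this
      refine ⟨⟨y, hy⟩, ?_⟩
      have ha' : f a = 0 := ha
      simp [ha']
  exact ⟨B.toSubmodule, inferInstance, inferInstance, inferInstance, B.toRepresentation,
    hσ.toRepresentation B, ⟨.mk (LinearEquiv.ofBijective _ hbij) fun g =>
      LinearMap.ext fun x => hfe g x⟩⟩

variable {κ : Type} [Fintype κ]

/-- The Kronecker power of a matrix. -/
def kroneckerPow {n : ℕ} (κ : Type) [Fintype κ] (M : Matrix (Fin n) (Fin n) ℂ) :
    Matrix (κ → Fin n) (κ → Fin n) ℂ := .of fun I J => ∏ k, M (I k) (J k)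

lemma kroneckerPow_mul [DecidableEq κ] {n : ℕ} (M N : Matrix (Fin n) (Fin n) ℂ) :
    kroneckerPow κ (M * N) = kroneckerPow κ M * kroneckerPow κ N := by
  ext I J
  simp only [kroneckerPow, Matrix.of_apply, Matrix.mul_apply]
  rw [Finset.prod_univ_sum, Fintype.piFinset_univ]
  exact Finset.sum_congr rfl fun K _ => Finset.prod_mul_distrib

lemma kroneckerPow_one {n : ℕ} : kroneckerPow κ (1 : Matrix (Fin n) (Fin n) ℂ) = 1 := by
  ext I J
  simp only [kroneckerPow, Matrix.of_apply, Matrix.one_apply, Finset.prod_ite_zero, funext_iff]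
  simp

/-- The span of the values of an equivariant multilinear map on a representation with a star form
has a star form. -/
lemma IsStar.hasStar_of_multilinearMap [DecidableEq κ] (hσ : IsStar σ) {X : Type*} [AddCommGroup X] [Module ℂ X]
    {τ : Representation ℂ SL(2, ℂ) X} (P : MultilinearMap ℂ (fun _ : κ => H) X)
    (hP : ∀ g v, P (fun k => σ g (v k)) = τ g (P v))
    (hspan : Submodule.span ℂ (Set.range P) = ⊤) : HasStar τ := by
  let b := stdOrthonormalBasis ℂ H
  let n := finrank ℂ H
  let M : SL(2, ℂ) → Matrix (Fin n) (Fin n) ℂ := fun g =>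
    LinearMap.toMatrix b.toBasis b.toBasis (σ g)
  have hM : ∀ g i j, M g i j = ⟪b i, σ g (b j)⟫ := by
    intro g i j
    simp only [M, LinearMap.toMatrix_apply, OrthonormalBasis.coe_toBasis]
    exact b.repr_apply_apply _ _
  -- A tensor power of `H` in coordinates, with the product basis declared orthonormal. In an
  -- orthonormal basis the star condition says that the matrix of `adj g` is the conjugate transpose
  -- of that of `g`, and this passes entrywise to Kronecker powers.
  let c := EuclideanSpace.basisFun (κ → Fin n) ℂ
  let N : Representation ℂ SL(2, ℂ) (EuclideanSpace ℂ (κ → Fin n)) :=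
    { toFun := fun g => Matrix.toLinAlgEquiv c.toBasis (kroneckerPow κ (M g))
      map_one' := by
        simp only [M, map_one]
        rw [Module.End.one_eq_id, LinearMap.toMatrix_id, kroneckerPow_one, map_one]
      map_mul' := fun g h => by
        simp only [M, map_mul]
        rw [Module.End.mul_eq_comp, LinearMap.toMatrix_comp _ b.toBasis, kroneckerPow_mul, map_mul] }
  have hN : ∀ g I J, ⟪c I, N g (c J)⟫ = ∏ k, M g (I k) (J k) := by
    intro g I J
    change ⟪c I, Matrix.toLinAlgEquiv c.toBasis (kroneckerPow κ (M g)) (c J)⟫ = _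
    rw [← c.coe_toBasis, Matrix.toLinAlgEquiv_self, c.coe_toBasis, inner_sum]
    simp only [inner_smul_right, c.inner_eq_ite]
    simp [kroneckerPow]
  have hNstar : IsStar N := by
    refine .of_basis c.toBasis (fun g I J => ?_) fun I J => ?_
    · rw [c.coe_toBasis, hN, ← inner_conj_symm, hN, map_prod]
      refine Finset.prod_congr rfl fun k _ => ?_
      rw [hM, hM, inner_conj_symm, hσ.inner_map]
    · simp only [c.coe_toBasis, hN, hM]
      exact continuous_finsetProd _ fun k _ => hσ.cont _ _
  have hexp : ∀ a : κ → Fin n → ℂ, P (fun k => ∑ i, a k i • b i) =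
      ∑ I : κ → Fin n, (∏ k, a k (I k)) • P fun k => b (I k) := by
    intro a
    rw [MultilinearMap.map_sum]
    refine Finset.sum_congr rfl fun I _ => ?_
    rw [MultilinearMap.map_smul_univ]
  -- The linearisation of `P`. It is onto because the values of `P` span, so the star form descends
  -- along it.
  let f : EuclideanSpace ℂ (κ → Fin n) →ₗ[ℂ] X := c.toBasis.constr ℂ fun I => P fun k => b (I k)
  have hf : ∀ I, f (c I) = P fun k => b (I k) := fun I => by
    rw [← c.coe_toBasis]; exact c.toBasis.constr_basis ℂ _ I
  refine hNstar.hasStar_of_surjective f ?_ fun g x => ?_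
  · rw [← LinearMap.range_eq_top, eq_top_iff, ← hspan, Submodule.span_le]
    rintro _ ⟨v, rfl⟩
    have : v = fun k => ∑ i, b.repr (v k) i • b i := funext fun k => (b.sum_repr (v k)).symm
    rw [this, hexp]
    exact Submodule.sum_mem _ fun I _ => Submodule.smul_mem _ _ ⟨c I, hf I⟩
  · have : f ∘ₗ N g = τ g ∘ₗ f := by
      refine c.toBasis.ext fun J => ?_
      rw [LinearMap.comp_apply, LinearMap.comp_apply, c.coe_toBasis, hf, ← hP]
      have h1 : N g (c J) = ∑ I, (∏ k, M g (I k) (J k)) • c I := by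
        conv_lhs => rw [← c.sum_repr' (N g (c J))]
        simp only [hN]
      have h2 : (fun k => σ g (b (J k))) = fun k => ∑ i, M g i (J k) • b i := by
        funext k
        conv_lhs => rw [← b.sum_repr' (σ g (b (J k)))]
        simp only [hM]
        rfl
      rw [h1, h2, map_sum, hexp fun k i => M g i (J k)]
      simp only [map_smul, hf]
    exact LinearMap.congr_fun this x

lemma HasStar.of_multilinearMap [DecidableEq κ] {V X : Type*} [AddCommGroup V] [Module ℂ V] [AddCommGroup X]
    [Module ℂ X] {ρ : Representation ℂ SL(2, ℂ) V} (hρ : HasStar ρ)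
    {τ : Representation ℂ SL(2, ℂ) X} (P : MultilinearMap ℂ (fun _ : κ => V) X)
    (hP : ∀ g v, P (fun k => ρ g (v k)) = τ g (P v))
    (hspan : Submodule.span ℂ (Set.range P) = ⊤) : HasStar τ := by
  obtain ⟨H, _, _, _, σ, hσ, ⟨e⟩⟩ := hρ
  refine hσ.hasStar_of_multilinearMap (P.compLinearMap fun _ => e.toLinearEquiv.toLinearMap)
    (fun g v => ?_) ?_
  · simp only [MultilinearMap.compLinearMap_apply, ← hP]
    congr 1
    funext k
    exact LinearMap.congr_fun (e.isIntertwining' g) (v k)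
  · rw [eq_top_iff, ← hspan]
    refine Submodule.span_mono ?_
    rintro _ ⟨v, rfl⟩
    exact ⟨fun k => e.toLinearEquiv.symm (v k), congrArg P (funext fun k =>
      e.toLinearEquiv.apply_symm_apply (v k))⟩

/-- The standard hermitian form on ℂ² works, by the definition of the conjugate transpose. -/
lemma hasStar_natRep : HasStar natRep := by
  let e : EuclideanSpace ℂ (Fin 2) ≃ₗ[ℂ] (Fin 2 → ℂ) := WithLp.linearEquiv 2 ℂ (Fin 2 → ℂ)
  let c := EuclideanSpace.basisFun (Fin 2) ℂ
  let σ : Representation ℂ SL(2, ℂ) (EuclideanSpace ℂ (Fin 2)) :=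
    { toFun := fun g => e.symm.conj (natRep g)
      map_one' := by rw [map_one]; exact LinearEquiv.conj_id _
      map_mul' := fun g h => by rw [map_mul]; exact LinearEquiv.conj_comp _ _ _ }
  have hσ : ∀ g i j, ⟪c i, σ g (c j)⟫ = g i j := by
    intro g i j
    simp [σ, c, e, natRep, LinearEquiv.conj_apply, EuclideanSpace.inner_single_left]
  refine ⟨_, inferInstance, inferInstance, inferInstance, σ, .of_basis c.toBasis (fun g i j => ?_)
    fun i j => ?_, ⟨.mk e fun g => ?_⟩⟩
  · rw [c.coe_toBasis, hσ, ← inner_conj_symm, hσ]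
    simp [adj]
  · simp only [c.coe_toBasis, hσ]
    fun_prop
  · ext x
    simp [σ, LinearEquiv.conj_apply]

end HasStar

/-! ### Symmetric powers and Schur functors -/

section Functors

variable {V : Type*} [AddCommGroup V] [Module ℂ V]

lemma hasStar_symPowRep (n : ℕ) {ρ : Representation ℂ SL(2, ℂ) V} (hρ : HasStar ρ) :
    HasStar (symPowRep n ρ) := by
  let P : MultilinearMap ℂ (fun _ : Fin n => V) (SymmetricAlgebra ℂ V) :=
    (MultilinearMap.mkPiAlgebra ℂ (Fin n) (SymmetricAlgebra ℂ V)).compLinearMap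
      fun _ => SymmetricAlgebra.ι ℂ V
  have hP : ∀ v, P v = ∏ j, SymmetricAlgebra.ι ℂ V (v j) := fun v => rfl
  let Q := P.codRestrict (symPowSub n ρ).toSubmodule fun v => Submodule.subset_span ⟨v, rfl⟩
  refine hρ.of_multilinearMap Q (fun g v => ?_) ?_
  · apply Subtype.ext
    change P _ = symAlgRep ρ g (P v)
    simp only [hP, symAlgRep_prod, symAlgRep_ι]
  · have : Set.range Q = (Subtype.val : (symPowSub n ρ).toSubmodule → _) ⁻¹'
        Set.range fun v : Fin n → V => ∏ j, SymmetricAlgebra.ι ℂ V (v j) := by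
      ext x
      constructor
      · rintro ⟨v, rfl⟩
        exact ⟨v, rfl⟩
      · rintro ⟨v, hv⟩
        exact ⟨v, Subtype.ext hv⟩
    rw [this]
    exact Submodule.span_span_coe_preimage

variable (V) in
/-- The row tabloid as a multilinear map. -/
def rowTabloidMap (lam : YoungDiagram) :
    MultilinearMap ℂ (fun _ : lam.cells => V) (RowTensor V lam) :=
  -- Changing the entry in box `b` affects only the tensor factor of its row, and that factor is
  -- linear in the new entry.
  have key : ∀ [DecidableEq lam.cells] (t : lam.cells → V) (b : lam.cells) (x : V),
      rowTabloid lam (Function.update t b x) =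
        PiTensorProduct.tprod ℂ (Function.update
          (fun i : Fin (lam.colLen 0) =>
            ∏ c : lam.cells with c.1.1 = (i : ℕ), SymmetricAlgebra.ι ℂ V (t c))
          ⟨b.1.1, YoungDiagram.mem_iff_lt_colLen.1 (lam.up_left_mem le_rfl (Nat.zero_le b.1.2)
            ((YoungDiagram.mem_cells _).1 b.2))⟩
          (SymmetricAlgebra.ι ℂ V x *
            ∏ c ∈ ({c : lam.cells | c.1.1 = b.1.1} : Finset _).erase b,
              SymmetricAlgebra.ι ℂ V (t c))) := by
    intro _ t b x
    unfold rowTabloid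
    congr 1
    funext i
    by_cases hi : b.1.1 = (i : ℕ)
    · have hi' : (⟨b.1.1, YoungDiagram.mem_iff_lt_colLen.1 (lam.up_left_mem le_rfl
          (Nat.zero_le b.1.2) ((YoungDiagram.mem_cells _).1 b.2))⟩ : Fin (lam.colLen 0)) = i :=
        Fin.ext hi
      rw [hi', Function.update_self, ← Finset.mul_prod_erase _ _ (a := b) (by simp [hi]),
        Function.update_self, hi]
      congr 1
      refine Finset.prod_congr rfl fun c hc => ?_
      rw [Function.update_of_ne (Finset.ne_of_mem_erase hc)]
    · rw [Function.update_of_ne fun h => hi (congrArg Fin.val h).symm]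
      refine Finset.prod_congr rfl fun c hc => ?_
      rw [Function.update_of_ne]
      rintro rfl
      exact hi (Finset.mem_filter.1 hc).2
  { toFun := rowTabloid lam
    map_update_add' := fun t b x y => by
      rw [key, key, key, map_add, add_mul, MultilinearMap.map_update_add]
    map_update_smul' := fun t b c x => by
      rw [key, key, map_smul, smul_mul_assoc, MultilinearMap.map_update_smul] }

open scoped Classical in
variable (V) in
/-- The polytabloid as a multilinear map. -/
def polytabloidMap (lam : YoungDiagram) :
    MultilinearMap ℂ (fun _ : lam.cells => V) (RowTensor V lam) :=
  ∑ τ : columnGroup lam, ((Equiv.Perm.sign (τ : Equiv.Perm lam.cells) : ℤ) : ℂ) •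
    (rowTabloidMap V lam).domDomCongr (τ : Equiv.Perm lam.cells)⁻¹

lemma polytabloidMap_apply (lam : YoungDiagram) (t : lam.cells → V) :
    polytabloidMap V lam t = polytabloid lam t := by
  rw [polytabloidMap, sum_apply]
  rfl

lemma hasStar_schurRep (lam : YoungDiagram) {ρ : Representation ℂ SL(2, ℂ) V} (hρ : HasStar ρ) :
    HasStar (V := (schurSub lam ρ).toSubmodule) (schurRep lam ρ) := by
  classical
  let Q := (polytabloidMap V lam).codRestrict (schurSub lam ρ).toSubmodule
    fun v => Submodule.subset_span ⟨v, (polytabloidMap_apply lam v).symm⟩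
  have hQ : ∀ v, (Q v : RowTensor V lam) = polytabloid lam v := polytabloidMap_apply lam
  refine hρ.of_multilinearMap Q (fun g v => ?_) ?_
  · apply Subtype.ext
    rw [hQ]
    change _ = rowTensorRep lam ρ g (Q v)
    rw [hQ, rowTensorRep_polytabloid]
  · have : Set.range Q = (Subtype.val : (schurSub lam ρ).toSubmodule → _) ⁻¹'
        Set.range (polytabloid (V := V) lam) := by
      ext x
      constructor
      · rintro ⟨v, rfl⟩
        exact ⟨v, (hQ v).symm⟩
      · rintro ⟨v, hv⟩
        exact ⟨v, Subtype.ext ((hQ v).trans hv)⟩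
    rw [this]
    exact Submodule.span_span_coe_preimage

end Functors

/-! ### Relations between polytabloids -/

section Relations

variable {V : Type*} [AddCommGroup V] [Module ℂ V] (lam : YoungDiagram)

lemma rowTabloid_comp_perm (t : lam.cells → V) (σ : Equiv.Perm lam.cells)
    (hσ : ∀ b, (σ b).1.1 = b.1.1) : rowTabloid lam (fun b => t (σ b)) = rowTabloid lam t := by
  unfold rowTabloid
  congr 1
  funext i
  refine Finset.prod_equiv σ (fun b => ?_) fun b _ => rfl
  simp [hσ]

/-- Reindex the column group by τ ↦ τσ⁻¹. -/
lemma polytabloid_comp_perm (t : lam.cells → V) (σ : columnGroup lam) :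
    polytabloid lam (fun b => t ((σ : Equiv.Perm lam.cells) b)) =
      ((Equiv.Perm.sign (σ : Equiv.Perm lam.cells) : ℤ) : ℂ) • polytabloid lam t := by
  classical
  unfold polytabloid
  rw [Finset.smul_sum]
  refine Finset.sum_equiv (Equiv.mulRight σ⁻¹) (by simp) fun τ _ => ?_
  rw [smul_smul]
  congr 1
  · simp only [Equiv.coe_mulRight, Subgroup.coe_mul, InvMemClass.coe_inv, map_mul, map_inv,
      Int.units_inv_eq_self]
    have h := Int.units_mul_self (Equiv.Perm.sign (σ : Equiv.Perm lam.cells))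
    have h' : ((Equiv.Perm.sign (σ : Equiv.Perm lam.cells) : ℤ) : ℂ) *
        ((Equiv.Perm.sign (σ : Equiv.Perm lam.cells) : ℤ) : ℂ) = 1 := by
      rw [← Int.cast_mul, ← Units.val_mul, h]
      simp
    push_cast
    linear_combination (-((Equiv.Perm.sign (τ : Equiv.Perm lam.cells) : ℤ) : ℂ)) * h'

/-- Exchanging the two boxes fixes the tableau and negates the polytabloid, and 2 is invertible. -/
lemma polytabloid_eq_zero (t : lam.cells → V) {b c : lam.cells} (hbc : b ≠ c)
    (hcol : b.1.2 = c.1.2) (ht : t b = t c) : polytabloid lam t = 0 := by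
  classical
  have hmem : Equiv.swap b c ∈ columnGroup lam := by
    intro x
    rcases Equiv.swap_apply_eq_iff.1 (rfl : Equiv.swap b c x = Equiv.swap b c x) with _
    by_cases hb : x = b
    · subst hb; rw [Equiv.swap_apply_left, hcol]
    · by_cases hc : x = c
      · subst hc; rw [Equiv.swap_apply_right, hcol]
      · rw [Equiv.swap_apply_of_ne_of_ne hb hc]
  have h := polytabloid_comp_perm lam t ⟨_, hmem⟩
  have ht' : (fun x => t (Equiv.swap b c x)) = t := by
    funext x
    by_cases hb : x = b
    · subst hb; rw [Equiv.swap_apply_left, ht]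
    · by_cases hc : x = c
      · subst hc; rw [Equiv.swap_apply_right, ht]
      · rw [Equiv.swap_apply_of_ne_of_ne hb hc]
  simp only [ht', Equiv.Perm.sign_swap hbc, Units.val_neg, Units.val_one, Int.cast_neg,
    Int.cast_one] at h
  have h2 : (2 : ℂ) • polytabloid lam t = 0 := by
    rw [two_smul]
    nth_rewrite 1 [h]
    exact neg_add_cancel _
  exact (smul_eq_zero.1 h2).resolve_left two_ne_zero

open scoped Classical in
/-- The Garnir relation: if every column permutation moves two boxes of `S` into the same row,
then the antisymmetrisation of a polytabloid over the permutations of `S` vanishes. -/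
lemma sum_sign_smul_polytabloid (t : lam.cells → V) (S : Finset lam.cells)
    (hS : ∀ τ ∈ columnGroup lam, ∃ b ∈ S, ∃ c ∈ S, b ≠ c ∧ (τ b).1.1 = (τ c).1.1) :
    ∑ σ : Equiv.Perm lam.cells with ∀ b ∉ S, σ b = b,
      ((Equiv.Perm.sign σ : ℤ) : ℂ) • polytabloid lam (fun b => t (σ b)) = 0 := by
  unfold polytabloid
  simp only [Finset.smul_sum]
  rw [Finset.sum_comm]
  refine Finset.sum_eq_zero fun τ _ => ?_
  obtain ⟨b, hb, c, hc, hbc, hrow⟩ := hS τ τ.2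
  -- For a fixed `τ`, which puts `b` and `c` in one row, the permutations `σ` and `σ * swap b c`
  -- give the same row tabloid with opposite signs.
  refine Finset.sum_involution (fun σ _ => σ * Equiv.swap b c) ?_ ?_ ?_ ?_
  · intro σ _
    have h1 : rowTabloid lam (fun x => t ((σ * Equiv.swap b c)
        ((τ : Equiv.Perm lam.cells)⁻¹ x))) =
        rowTabloid lam (fun x => t (σ ((τ : Equiv.Perm lam.cells)⁻¹ x))) := by
      rw [← rowTabloid_comp_perm lam (fun x => t (σ ((τ : Equiv.Perm lam.cells)⁻¹ x)))
        (Equiv.swap ((τ : Equiv.Perm lam.cells) b) ((τ : Equiv.Perm lam.cells) c))]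
      · congr 1
        funext x
        rw [Equiv.Perm.mul_apply]
        congr 2
        obtain ⟨y, rfl⟩ := (τ : Equiv.Perm lam.cells).surjective x
        rw [Equiv.Perm.inv_def, Equiv.symm_apply_apply, Equiv.swap_apply_apply]
        simp
      · intro x
        by_cases hb : x = (τ : Equiv.Perm lam.cells) b
        · rw [hb, Equiv.swap_apply_left, hrow]
        · by_cases hc : x = (τ : Equiv.Perm lam.cells) c
          · rw [hc, Equiv.swap_apply_right, hrow]
          · rw [Equiv.swap_apply_of_ne_of_ne hb hc]
    rw [h1, map_mul, Equiv.Perm.sign_swap hbc]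
    simp
  · intro σ _ _ h
    have := mul_left_cancel (h.trans (mul_one σ).symm)
    rw [Equiv.swap_eq_one_iff] at this
    exact hbc this
  · intro σ hσ
    simp only [Finset.mem_filter, Finset.mem_univ, true_and] at hσ ⊢
    intro x hx
    rw [Equiv.Perm.mul_apply, Equiv.swap_apply_of_ne_of_ne (by rintro rfl; exact hx hb)
      (by rintro rfl; exact hx hc), hσ x hx]
  · intro σ _
    simp [mul_assoc]

end Relations

/-! ### Semistandard tableaux -/

section Semistandard

variable {d : ℕ} (lam : YoungDiagram)

/-- Semistandard tableaux: weakly increasing along rows and strictly increasing down columns. -/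
def IsSemistandard (t : lam.cells → Fin d) : Prop :=
  (∀ b c, b.1.1 = c.1.1 → b.1.2 ≤ c.1.2 → t b ≤ t c) ∧
    ∀ b c, b.1.2 = c.1.2 → b.1.1 < c.1.1 → t b < t c

variable {V : Type*} [AddCommGroup V] [Module ℂ V] (v : Fin d → V)

/-- The key straightening step: a polytabloid with a descent in a row is a combination of
polytabloids with larger column measure. -/
lemma polytabloid_mem_span_of_descent (t : lam.cells → Fin d)
    (hcol : ∀ b c, b.1.2 = c.1.2 → b.1.1 < c.1.1 → t b < t c) {i j : ℕ}
    (h0 : (i, j) ∈ lam.cells) (h1 : (i, j + 1) ∈ lam.cells)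
    (hlt : t ⟨(i, j + 1), h1⟩ < t ⟨(i, j), h0⟩) :
    polytabloid lam (v ∘ t) ∈ Submodule.span ℂ ((fun t' => polytabloid lam (v ∘ t')) ''
      {t' : lam.cells → Fin d |
        ∑ b, (t b : ℕ) * b.1.2 < ∑ b, (t' b : ℕ) * b.1.2}) := by
  classical
  -- The Garnir set of the descent: column `j` from row `i` downwards, with column `j + 1` down to
  -- row `i`.
  let A : Finset lam.cells := {b | b.1.2 = j ∧ i ≤ b.1.1}
  let B : Finset lam.cells := {b | b.1.2 = j + 1 ∧ b.1.1 ≤ i}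
  have hA : ∀ b, b ∈ A ↔ b.1.2 = j ∧ i ≤ b.1.1 := fun b => by simp [A]
  have hB : ∀ b, b ∈ B ↔ b.1.2 = j + 1 ∧ b.1.1 ≤ i := fun b => by simp [B]
  have hmono : ∀ b c : lam.cells, b.1.2 = c.1.2 → b.1.1 ≤ c.1.1 → t b ≤ t c := by
    intro b c h h'
    rcases h'.lt_or_eq with h'' | h''
    · exact (hcol b c h h'').le
    · rw [show b = c from Subtype.ext (Prod.ext h'' h)]
  have htA : ∀ b ∈ A, t ⟨(i, j + 1), h1⟩ < t b := fun b hb =>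
    hlt.trans_le (hmono _ _ ((hA b).1 hb).1.symm ((hA b).1 hb).2)
  have htB : ∀ b ∈ B, t b ≤ t ⟨(i, j + 1), h1⟩ := fun b hb =>
    hmono _ _ ((hB b).1 hb).1 ((hB b).1 hb).2
  have hS : ∀ τ ∈ columnGroup lam, ∃ b ∈ A ∪ B, ∃ c ∈ A ∪ B, b ≠ c ∧ (τ b).1.1 = (τ c).1.1 := by
    intro τ hτ
    have hi : i < lam.colLen j := YoungDiagram.mem_iff_lt_colLen.1 h0
    have hp : ∀ k, k < lam.colLen j → (k, j) ∈ lam.cells := fun k hk =>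
      (YoungDiagram.mem_cells _).2 (YoungDiagram.mem_iff_lt_colLen.2 hk)
    have hp' : ∀ k, k ≤ i → (k, j + 1) ∈ lam.cells := fun k hk =>
      (YoungDiagram.mem_cells _).2 (lam.up_left_mem hk le_rfl ((YoungDiagram.mem_cells _).1 h1))
    -- The Garnir set has `lam.colLen j + 1` boxes, and column permutations keep them in columns `j`
    -- and `j + 1`, hence in only `lam.colLen j` rows. Two of them must share a row.
    let f : Fin (lam.colLen j + 1) → lam.cells := fun k =>
      if h : (k : ℕ) ≤ i then ⟨(k, j + 1), hp' k h⟩ else ⟨((k : ℕ) - 1, j), hp _ (by omega)⟩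
    have hfS : ∀ k, f k ∈ A ∪ B := by
      intro k
      rw [Finset.mem_union, hA, hB]
      by_cases h : (k : ℕ) ≤ i
      · right; simp [f, h]
      · left
        simp only [f, h, dif_neg, not_false_eq_true, true_and]
        omega
    have hfinj : Function.Injective f := by
      intro k l hkl
      have := congrArg Subtype.val hkl
      by_cases h : (k : ℕ) ≤ i <;> by_cases h' : (l : ℕ) ≤ i <;>
        simp [f, h, h', Prod.ext_iff] at this <;> apply Fin.ext <;> omega
    have hrow : ∀ k, (τ (f k)).1.1 < lam.colLen j := by
      intro k
      have h2 : (τ (f k)).1.2 = j ∨ (τ (f k)).1.2 = j + 1 := by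
        rw [hτ]
        rcases Finset.mem_union.1 (hfS k) with h | h
        · exact .inl ((hA _).1 h).1
        · exact .inr ((hB _).1 h).1
      refine YoungDiagram.mem_iff_lt_colLen.1 (lam.up_left_mem le_rfl (?_ : j ≤ (τ (f k)).1.2)
        ((YoungDiagram.mem_cells _).1 (τ (f k)).2))
      omega
    obtain ⟨k, l, hkl, h⟩ := Fintype.exists_ne_map_eq_of_card_lt
      (fun k => (⟨_, hrow k⟩ : Fin (lam.colLen j))) (by simp)
    exact ⟨f k, hfS k, f l, hfS l, fun e => hkl (hfinj e), congrArg Fin.val h⟩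
  have hgarnir := sum_sign_smul_polytabloid lam (v ∘ t) (A ∪ B) hS
  -- Permutations that preserve `A` and `B` are column permutations, and each returns the original
  -- polytabloid with its sign cancelled. The others move some entry of `A` into `B`.
  rw [← Finset.sum_filter_add_sum_filter_not _ fun σ => ∀ a ∈ A, σ⁻¹ a ∉ B] at hgarnir
  have hdisj : ∀ b, b ∈ A → b ∉ B := fun b h h' => by
    rw [hA] at h; rw [hB] at h'; omega
  have hkeep : ∀ σ : Equiv.Perm lam.cells, (∀ b ∉ A ∪ B, σ b = b) → ∀ b ∉ A ∪ B, σ⁻¹ b = b :=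
    fun σ h b hb => by rw [Equiv.Perm.inv_eq_iff_eq, h b hb]
  have hstay : ∀ σ : Equiv.Perm lam.cells, (∀ b ∉ A ∪ B, σ b = b) → ∀ b ∈ A ∪ B,
      σ⁻¹ b ∈ A ∪ B := by
    intro σ h b hb
    by_contra hn
    have := h _ hn
    rw [Equiv.Perm.inv_def, Equiv.apply_symm_apply] at this
    exact hn (this ▸ hb)
  have hfirst : ∀ σ ∈ ((Finset.univ.filter fun σ : Equiv.Perm lam.cells =>
      ∀ b ∉ A ∪ B, σ b = b).filter fun σ => ∀ a ∈ A, σ⁻¹ a ∉ B),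
      ((Equiv.Perm.sign σ : ℤ) : ℂ) • polytabloid lam (fun b => (v ∘ t) (σ b)) =
        polytabloid lam (v ∘ t) := by
    intro σ hσ
    simp only [Finset.mem_filter, Finset.mem_univ, true_and] at hσ
    obtain ⟨hσ1, hσ2⟩ := hσ
    have hAA : ∀ a ∈ A, σ⁻¹ a ∈ A := fun a ha =>
      (Finset.mem_union.1 (hstay σ hσ1 a (Finset.mem_union_left _ ha))).resolve_right (hσ2 a ha)
    have hAimg : A.map (σ⁻¹ : Equiv.Perm lam.cells).toEmbedding = A := by
      refine Finset.eq_of_subset_of_card_le ?_ (by simp)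
      intro x hx
      obtain ⟨a, ha, rfl⟩ := Finset.mem_map.1 hx
      exact hAA a ha
    have hBB : ∀ b ∈ B, σ⁻¹ b ∈ B := by
      intro b hb
      refine (Finset.mem_union.1 (hstay σ hσ1 b (Finset.mem_union_right _ hb))).resolve_left ?_
      intro h
      rw [← hAimg] at h
      obtain ⟨a, ha, hab⟩ := Finset.mem_map.1 h
      have := (σ⁻¹ : Equiv.Perm lam.cells).injective hab
      exact hdisj a ha (this ▸ hb)
    have hmem : σ⁻¹ ∈ columnGroup lam := by
      intro b
      by_cases hbS : b ∈ A ∪ B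
      · rcases Finset.mem_union.1 hbS with h | h
        · rw [((hA _).1 (hAA b h)).1, ((hA _).1 h).1]
        · rw [((hB _).1 (hBB b h)).1, ((hB _).1 h).1]
      · rw [hkeep σ hσ1 b hbS]
    have hmem' : σ ∈ columnGroup lam := by simpa using inv_mem hmem
    have := polytabloid_comp_perm lam (v ∘ t) ⟨σ, hmem'⟩
    rw [this, smul_smul, ← Int.cast_mul, ← Units.val_mul, Int.units_mul_self]
    simp
  rw [Finset.sum_congr rfl hfirst, Finset.sum_const, ← Nat.cast_smul_eq_nsmul ℂ] at hgarnir
  have hpos : ((((Finset.univ.filter fun σ : Equiv.Perm lam.cells =>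
      ∀ b ∉ A ∪ B, σ b = b).filter fun σ => ∀ a ∈ A, σ⁻¹ a ∉ B).card : ℕ) : ℂ) ≠ 0 := by
    rw [Nat.cast_ne_zero, ← Nat.pos_iff_ne_zero, Finset.card_pos]
    refine ⟨1, ?_⟩
    simp only [Finset.mem_filter, Finset.mem_univ, true_and, inv_one, Equiv.Perm.one_apply,
      implies_true]
    exact hdisj
  rw [← Submodule.smul_mem_iff _ hpos, eq_neg_of_add_eq_zero_left hgarnir]
  refine Submodule.neg_mem _ (Submodule.sum_mem _ fun σ hσ => Submodule.smul_mem _ _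
    (Submodule.subset_span ⟨fun b => t (σ b), ?_, rfl⟩))
  simp only [Finset.mem_filter, Finset.mem_univ, true_and, not_forall, not_not] at hσ
  obtain ⟨hσ1, a, ha, haB⟩ := hσ
  change ∑ b, (t b : ℕ) * b.1.2 < ∑ b, (t (σ b) : ℕ) * b.1.2
  have hre : ∑ b, (t (σ b) : ℕ) * b.1.2 = ∑ b, (t b : ℕ) * (σ⁻¹ b).1.2 :=
    Finset.sum_equiv σ (by simp) fun b _ => by simp
  have hre2 : ∑ b : lam.cells, (((σ⁻¹ b).1.2 : ℕ) : ℤ) = ∑ b : lam.cells, ((b.1.2 : ℕ) : ℤ) :=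
    Finset.sum_equiv σ⁻¹ (by simp) fun b _ => rfl
  rw [hre]
  -- This threshold separates the entries: those in `A` exceed it and those in `B` do not.
  -- Subtracting it is harmless as column indices are only permuted, and it makes every term of the
  -- change in measure nonnegative, and positive at `a`.
  set θ : ℤ := ((t ⟨(i, j + 1), h1⟩ : ℕ) : ℤ) with hθ
  have hpos : 0 < ∑ b : lam.cells, (((t b : ℕ) : ℤ) - θ) * (((σ⁻¹ b).1.2 : ℤ) - (b.1.2 : ℤ)) := by
    have hterm : ∀ b : lam.cells,
        0 ≤ (((t b : ℕ) : ℤ) - θ) * (((σ⁻¹ b).1.2 : ℤ) - (b.1.2 : ℤ)) := by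
      intro b
      by_cases hbS : b ∈ A ∪ B
      · have hstayb := Finset.mem_union.1 (hstay σ hσ1 b hbS)
        have hc : (σ⁻¹ b).1.2 = j ∨ (σ⁻¹ b).1.2 = j + 1 := by
          rcases hstayb with h | h
          · exact .inl ((hA _).1 h).1
          · exact .inr ((hB _).1 h).1
        rcases Finset.mem_union.1 hbS with h | h
        · have h2 := htA b h
          have h3 := ((hA _).1 h).1
          rw [Fin.lt_def] at h2
          exact mul_nonneg (by omega) (by omega)
        · have h2 := htB b h
          have h3 := ((hB _).1 h).1
          rw [Fin.le_def] at h2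
          exact mul_nonneg_of_nonpos_of_nonpos (by omega) (by omega)
      · rw [hkeep σ hσ1 b hbS]; simp
    refine Finset.sum_pos' (fun b _ => hterm b) ⟨a, Finset.mem_univ _, ?_⟩
    have h2 := htA a ha
    have h3 := ((hA _).1 ha).1
    have h4 := ((hB _).1 haB).1
    rw [Fin.lt_def] at h2
    exact mul_pos (by omega) (by omega)
  have hexp : ∑ b : lam.cells, (((t b : ℕ) : ℤ) - θ) * (((σ⁻¹ b).1.2 : ℤ) - (b.1.2 : ℤ)) =
      (∑ b : lam.cells, ((t b : ℕ) : ℤ) * ((σ⁻¹ b).1.2 : ℤ)) -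
        ∑ b : lam.cells, ((t b : ℕ) : ℤ) * (b.1.2 : ℤ) := by
    simp only [sub_mul, mul_sub, Finset.sum_sub_distrib, ← Finset.mul_sum, hre2]
    ring
  rw [hexp] at hpos
  have : (∑ b : lam.cells, ((t b : ℕ) : ℤ) * (b.1.2 : ℤ)) <
    ∑ b : lam.cells, ((t b : ℕ) : ℤ) * ((σ⁻¹ b).1.2 : ℤ) := by linarith
  exact_mod_cast this

end Semistandard

/-! ### Straightening into semistandard polytabloids. -/

section SemistandardSpan

variable {d : ℕ} (lam : YoungDiagram) {V : Type*} [AddCommGroup V] [Module ℂ V]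

/-- Straightening, as an extremal argument: a counterexample of maximal measure has neither a column
violation, which a swap repairs while raising `Z` and keeping `W`, nor a row descent, for which the
Garnir relation raises `W`. -/
lemma polytabloid_mem_span_semistandard (v : Fin d → V) (t : lam.cells → Fin d) :
    polytabloid lam (v ∘ t) ∈ Submodule.span ℂ ((fun t' => polytabloid lam (v ∘ t')) ''
      {t' : lam.cells → Fin d | IsSemistandard lam t'}) := by
  classical
  set S := Submodule.span ℂ ((fun t' => polytabloid lam (v ∘ t')) ''
      {t' : lam.cells → Fin d | IsSemistandard lam t'}) with hS
  let R : ℕ := ∑ b : lam.cells, b.1.1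
  let W : (lam.cells → Fin d) → ℕ := fun t => ∑ b, (t b : ℕ) * b.1.2
  let Z : (lam.cells → Fin d) → ℕ := fun t => ∑ b, (t b : ℕ) * b.1.1
  -- Since `Z ≤ d * R`, this encodes the lexicographic order on pairs (`W`, `Z`).
  let M : (lam.cells → Fin d) → ℕ := fun t => W t * (d * R + 1) + Z t
  have hZ : ∀ t, Z t ≤ d * R := fun t => by
    rw [Finset.mul_sum]
    exact Finset.sum_le_sum fun b _ => Nat.mul_le_mul_right _ (t b).2.le
  by_contra hbad
  obtain ⟨t, ht, hmax⟩ := Set.exists_max_image {t : lam.cells → Fin d | polytabloid lam (v ∘ t) ∉ S}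
    M (Set.toFinite _) ⟨t, hbad⟩
  have hgood : ∀ t', M t < M t' → polytabloid lam (v ∘ t') ∈ S := fun t' h => by
    by_contra h'
    exact absurd (hmax t' h') (not_le.2 h)
  refine ht ?_
  by_cases hcol : ∀ b c : lam.cells, b.1.2 = c.1.2 → b.1.1 < c.1.1 → t b < t c
  · by_cases hadj : ∀ i j (h0 : (i, j) ∈ lam.cells) (h1 : (i, j + 1) ∈ lam.cells),
        t ⟨(i, j), h0⟩ ≤ t ⟨(i, j + 1), h1⟩
    · have hrow : ∀ n i j (h0 : (i, j) ∈ lam.cells) (h1 : (i, j + n) ∈ lam.cells),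
          t ⟨(i, j), h0⟩ ≤ t ⟨(i, j + n), h1⟩ := by
        intro n
        induction n with
        | zero => intros; exact le_rfl
        | succ n ih =>
          intro i j h0 h1
          have h2 : (i, j + n) ∈ lam.cells := (YoungDiagram.mem_cells _).2
            (lam.up_left_mem le_rfl (by omega) ((YoungDiagram.mem_cells _).1 h1))
          exact (ih i j h0 h2).trans (hadj _ _ h2 h1)
      refine Submodule.subset_span ⟨t, ⟨?_, hcol⟩, rfl⟩
      rintro ⟨⟨i, j⟩, hb⟩ ⟨⟨i', j'⟩, hc⟩ (rfl : i = i') (hj : j ≤ j')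
      obtain ⟨n, rfl⟩ := Nat.exists_eq_add_of_le hj
      exact hrow n i j hb hc
    · push Not at hadj
      obtain ⟨i, j, h0, h1, hlt⟩ := hadj
      refine Submodule.span_le.2 ?_ (polytabloid_mem_span_of_descent lam v t hcol h0 h1 hlt)
      rintro _ ⟨t', ht' : W t < W t', rfl⟩
      refine hgood t' ?_
      have := hZ t
      calc M t ≤ W t * (d * R + 1) + d * R := Nat.add_le_add_left this _
        _ < (W t + 1) * (d * R + 1) := by rw [add_mul]; omega
        _ ≤ W t' * (d * R + 1) := Nat.mul_le_mul_right _ ht'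
        _ ≤ M t' := Nat.le_add_right _ _
  · push Not at hcol
    obtain ⟨b, c, hbc, hlt, hle⟩ := hcol
    have hne : b ≠ c := by rintro rfl; exact lt_irrefl _ hlt
    rcases hle.lt_or_eq with hlt' | heq
    · have hmem : Equiv.swap b c ∈ columnGroup lam := by
        intro x
        by_cases hb : x = b
        · subst hb; rw [Equiv.swap_apply_left, hbc]
        · by_cases hc : x = c
          · subst hc; rw [Equiv.swap_apply_right, hbc]
          · rw [Equiv.swap_apply_of_ne_of_ne hb hc]
      have h := polytabloid_comp_perm lam (v ∘ t) ⟨_, hmem⟩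
      have hswap : polytabloid lam (v ∘ fun x => t (Equiv.swap b c x)) ∈ S := by
        refine hgood _ ?_
        have h1 : W (fun x => t (Equiv.swap b c x)) = W t :=
          Finset.sum_equiv (Equiv.swap b c) (by simp) fun x _ => by rw [hmem x]
        have h2 : Z t < Z (fun x => t (Equiv.swap b c x)) := by
          have h3 : ∑ x : lam.cells, (((t (Equiv.swap b c x) : ℕ) : ℤ) - (t x : ℕ)) * (x.1.1 : ℤ) =
              (((t c : ℕ) : ℤ) - (t b : ℕ)) * (b.1.1 : ℤ) +
                (((t b : ℕ) : ℤ) - (t c : ℕ)) * (c.1.1 : ℤ) := by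
            rw [Fintype.sum_eq_add b c hne fun x hx => by
              rw [Equiv.swap_apply_of_ne_of_ne hx.1 hx.2]; simp]
            rw [Equiv.swap_apply_left, Equiv.swap_apply_right]
          simp only [sub_mul, Finset.sum_sub_distrib] at h3
          rw [Fin.lt_def] at hlt'
          have h4 : (0 : ℤ) < (((t b : ℕ) : ℤ) - (t c : ℕ)) * ((c.1.1 : ℤ) - (b.1.1 : ℤ)) :=
            mul_pos (by omega) (by omega)
          have h5 : (∑ x : lam.cells, ((t x : ℕ) : ℤ) * (x.1.1 : ℤ)) <
              ∑ x : lam.cells, ((t (Equiv.swap b c x) : ℕ) : ℤ) * (x.1.1 : ℤ) := by linarith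
          exact_mod_cast h5
        simp only [M, h1]
        omega
      have h' : polytabloid lam (v ∘ fun x => t (Equiv.swap b c x)) = -polytabloid lam (v ∘ t) := by
        rw [← neg_one_smul ℂ (polytabloid lam (v ∘ t))]
        refine h.trans ?_
        simp only [Equiv.Perm.sign_swap hne, Units.val_neg, Units.val_one, Int.cast_neg,
          Int.cast_one]
      rw [h'] at hswap
      exact (Submodule.neg_mem_iff _).1 hswap
    · rw [polytabloid_eq_zero lam (v ∘ t) hne hbc (congrArg v heq.symm)]
      exact Submodule.zero_mem _

lemma span_semistandard (b : Basis (Fin d) ℂ V) :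
    Submodule.span ℂ (Set.range (polytabloid (V := V) lam)) =
      Submodule.span ℂ (Set.range fun T : {T : lam.cells → Fin d // IsSemistandard lam T} =>
        polytabloid lam (b ∘ T.1)) := by
  classical
  refine le_antisymm (Submodule.span_le.2 ?_) (Submodule.span_mono ?_)
  · rintro _ ⟨t, rfl⟩
    have : t = fun k => ∑ i, b.repr (t k) i • b i := funext fun k => (b.sum_repr (t k)).symm
    rw [this, ← polytabloidMap_apply, MultilinearMap.map_sum]
    refine Submodule.sum_mem _ fun I _ => ?_
    rw [MultilinearMap.map_smul_univ, polytabloidMap_apply]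
    refine Submodule.smul_mem _ _ (Submodule.span_mono ?_
      (polytabloid_mem_span_semistandard lam b I))
    rintro _ ⟨t', ht', rfl⟩
    exact ⟨⟨t', ht'⟩, rfl⟩
  · rintro _ ⟨T, rfl⟩
    exact ⟨b ∘ T.1, rfl⟩

/-! ### Linear independence -/

/-- The multiplicities of the entries in row `i` of a tableau. -/
def rowContent (t : lam.cells → Fin d) (i : ℕ) : Fin d →₀ ℕ :=
  ∑ b : lam.cells with b.1.1 = i, Finsupp.single (t b) 1

/-- The linear functional taking the coefficient of the row tabloid of `T`. -/
def tabloidCoeff (b : Basis (Fin d) ℂ V) (T : lam.cells → Fin d) : RowTensor V lam →ₗ[ℂ] ℂ :=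
  PiTensorProduct.lift ((MultilinearMap.mkPiAlgebra ℂ (Fin (lam.colLen 0)) ℂ).compLinearMap
    fun i => MvPolynomial.lcoeff ℂ (rowContent lam T i) ∘ₗ
      (SymmetricAlgebra.equivMvPolynomial b).toLinearMap)

open scoped Classical in
lemma tabloidCoeff_rowTabloid (b : Basis (Fin d) ℂ V) (T t : lam.cells → Fin d) :
    tabloidCoeff lam b T (rowTabloid lam (b ∘ t)) =
      if ∀ i : Fin (lam.colLen 0), rowContent lam t i = rowContent lam T i then 1 else 0 := by
  rw [tabloidCoeff, rowTabloid, PiTensorProduct.lift.tprod, MultilinearMap.compLinearMap_apply,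
    MultilinearMap.mkPiAlgebra_apply]
  have : ∀ i : Fin (lam.colLen 0), (MvPolynomial.lcoeff ℂ (rowContent lam T i) ∘ₗ
      (SymmetricAlgebra.equivMvPolynomial b).toLinearMap)
        (∏ c : lam.cells with c.1.1 = (i : ℕ), SymmetricAlgebra.ι ℂ V ((b ∘ t) c)) =
      if rowContent lam t i = rowContent lam T i then 1 else 0 := by
    intro i
    rw [LinearMap.comp_apply, AlgEquiv.toLinearMap_apply, map_prod]
    simp only [Function.comp_apply, SymmetricAlgebra.equivMvPolynomial_ι_apply]
    have hX : ∏ c : lam.cells with c.1.1 = (i : ℕ), (MvPolynomial.X (t c) : MvPolynomial (Fin d) ℂ) =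
        MvPolynomial.monomial (rowContent lam t i) 1 := by
      rw [rowContent, MvPolynomial.monomial_sum_one]
      rfl
    rw [hX]
    exact MvPolynomial.coeff_monomial _ _ _
  simp only [this]
  rw [Finset.prod_ite_zero]
  simp

variable {lam}

lemma rowContent_apply (t : lam.cells → Fin d) (i : ℕ) (u : Fin d) :
    rowContent lam t i u = (Finset.univ.filter fun b : lam.cells => b.1.1 = i ∧ t b = u).card := by
  classical
  rw [rowContent, Finsupp.finsetSum_apply, ← Finset.filter_filter, Finset.card_filter]
  exact Finset.sum_congr rfl fun b _ => by rw [Finsupp.single_apply]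

/-- A weakly increasing row is the sorted list of its content. Concretely, if `T b < T' b`, fewer
entries of that row of `T'` than of `T` are at most `T b`. -/
lemma eq_of_rowContent_eq {T T' : lam.cells → Fin d}
    (hT : ∀ b c : lam.cells, b.1.1 = c.1.1 → b.1.2 ≤ c.1.2 → T b ≤ T c)
    (hT' : ∀ b c : lam.cells, b.1.1 = c.1.1 → b.1.2 ≤ c.1.2 → T' b ≤ T' c)
    (h : ∀ i, rowContent lam T i = rowContent lam T' i) : T = T' := by
  classical
  have key : ∀ T T' : lam.cells → Fin d,
      (∀ b c : lam.cells, b.1.1 = c.1.1 → b.1.2 ≤ c.1.2 → T b ≤ T c) →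
      (∀ b c : lam.cells, b.1.1 = c.1.1 → b.1.2 ≤ c.1.2 → T' b ≤ T' c) →
      (∀ i, rowContent lam T i = rowContent lam T' i) → ∀ b, T' b ≤ T b := by
    intro T T' hT hT' h b
    by_contra hlt
    rw [not_le] at hlt
    have hcard : ∀ t : lam.cells → Fin d,
        (Finset.univ.filter fun c : lam.cells => c.1.1 = b.1.1 ∧ t c ≤ T b).card =
          ∑ u ∈ Finset.Iic (T b), rowContent lam t b.1.1 u := by
      intro t
      simp only [rowContent_apply]
      rw [Finset.card_eq_sum_card_fiberwise (f := t) (t := Finset.Iic (T b))]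
      · refine Finset.sum_congr rfl fun u hu => ?_
        congr 1
        ext c
        simp only [Finset.mem_filter, Finset.mem_univ, true_and, Finset.mem_Iic] at hu ⊢
        constructor
        · rintro ⟨⟨h1, h2⟩, h3⟩; exact ⟨h1, h3⟩
        · rintro ⟨h1, h3⟩; exact ⟨⟨h1, h3 ▸ hu⟩, h3⟩
      · intro c hc
        simpa using (Finset.mem_filter.1 hc).2.2
    have hlt2 : (Finset.univ.filter fun c : lam.cells => c.1.1 = b.1.1 ∧ T' c ≤ T b).card <
        (Finset.univ.filter fun c : lam.cells => c.1.1 = b.1.1 ∧ T c ≤ T b).card := by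
      refine Finset.card_lt_card ((Finset.ssubset_iff_of_subset ?_).2 ⟨b, ?_, ?_⟩)
      · intro c hc
        simp only [Finset.mem_filter, Finset.mem_univ, true_and] at hc ⊢
        refine ⟨hc.1, hT c b hc.1 ?_⟩
        by_contra hcb
        exact absurd (hT' b c hc.1.symm (by omega)) (not_le.2 (hc.2.trans_lt hlt))
      · simp
      · simpa using hlt
    rw [hcard, hcard] at hlt2
    simp only [h, lt_self_iff_false] at hlt2
  funext b
  exact le_antisymm (key T' T hT' hT (fun i => (h i).symm) b) (key T T' hT hT' h b)

/-- The sum of the products of the entries with their row indices. -/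
def rowMeasure (t : lam.cells → Fin d) : ℕ := ∑ b, b.1.1 * (t b : ℕ)

/-- The point is that the row measure depends only on the row tabloid. -/
lemma rowMeasure_eq (t : lam.cells → Fin d) : rowMeasure t =
    ∑ i : Fin (lam.colLen 0), (i : ℕ) * (rowContent lam t i).sum fun u n => n * (u : ℕ) := by
  classical
  have hlt : ∀ b : lam.cells, b.1.1 < lam.colLen 0 := fun b =>
    YoungDiagram.mem_iff_lt_colLen.1 (lam.up_left_mem le_rfl (Nat.zero_le b.1.2)
      ((YoungDiagram.mem_cells _).1 b.2))
  rw [rowMeasure, ← Finset.sum_fiberwise (g := fun b : lam.cells =>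
    (⟨b.1.1, hlt b⟩ : Fin (lam.colLen 0)))]
  refine Finset.sum_congr rfl fun i _ => ?_
  rw [rowContent, ← Finsupp.sum_finsetSum_index (fun _ => by simp) (fun _ _ _ => add_mul _ _ _),
    Finset.mul_sum]
  refine Finset.sum_congr ?_ fun b hb => ?_
  · ext b
    simp [Fin.ext_iff]
  · rw [Finsupp.sum_single_index (by simp), (Finset.mem_filter.1 hb).2]
    simp

/-- Column permutations decrease the row measure of a column-strict tableau. -/
lemma eq_one_of_rowMeasure_le {T : lam.cells → Fin d}
    (hT : ∀ b c : lam.cells, b.1.2 = c.1.2 → b.1.1 < c.1.1 → T b < T c)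
    {σ : Equiv.Perm lam.cells} (hσ : σ ∈ columnGroup lam)
    (h : rowMeasure T ≤ rowMeasure fun b => T (σ b)) : σ = 1 := by
  classical
  have hlt : ∀ b : lam.cells, b.1.1 < lam.colLen 0 := fun b =>
    YoungDiagram.mem_iff_lt_colLen.1 (lam.up_left_mem le_rfl (Nat.zero_le b.1.2)
      ((YoungDiagram.mem_cells _).1 b.2))
  set K := lam.colLen 0 with hK
  -- `e` ranks boxes by (column, row) and `g` by (column, entry), both lexicographically. Column
  -- strictness makes `g` increase with `e`. For a column permutation, only the row measure varies
  -- in ∑ e · (g ∘ σ), so the rearrangement inequality applies, and its equality case makes `σ`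
  -- preserve the order given by `e`.
  let e : lam.cells → ℕ := fun b => b.1.2 * K + b.1.1
  let g : lam.cells → ℕ := fun b => b.1.2 * d + (T b : ℕ)
  have hlex : ∀ n x y u w : ℕ, u < n → w < n → x * n + u < y * n + w → x < y ∨ (x = y ∧ u < w) := by
    intro n x y u w hu hw h
    rcases lt_trichotomy x y with hxy | hxy | hxy
    · exact .inl hxy
    · subst hxy; exact .inr ⟨rfl, by omega⟩
    · have := Nat.mul_le_mul_right n hxy
      rw [Nat.succ_mul] at this
      omega
  have heinj : Function.Injective e := by
    intro b c hbc
    have h1 := hlt b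
    have h2 := hlt c
    have hcol : b.1.2 = c.1.2 := by
      rcases lt_trichotomy b.1.2 c.1.2 with hxy | hxy | hxy
      · have := Nat.mul_le_mul_right K hxy
        rw [Nat.succ_mul] at this
        simp only [e] at hbc
        omega
      · exact hxy
      · have := Nat.mul_le_mul_right K hxy
        rw [Nat.succ_mul] at this
        simp only [e] at hbc
        omega
    refine Subtype.ext (Prod.ext ?_ hcol)
    simp only [e, hcol] at hbc
    omega
  have heg : ∀ b c, e b < e c → g b < g c := by
    intro b c hbc
    rcases hlex K _ _ _ _ (hlt b) (hlt c) hbc with h1 | ⟨h1, h2⟩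
    · have := Nat.mul_le_mul_right d h1
      rw [Nat.succ_mul] at this
      have := (T b).2
      simp only [g]
      omega
    · have := hT b c h1 h2
      rw [Fin.lt_def] at this
      simp only [g, h1]
      omega
  have hmono : Monovary e g := by
    intro b c hbc
    by_contra hle
    exact absurd (heg c b (not_le.1 hle)) (not_lt.2 hbc.le)
  have hsum : ∀ σ ∈ columnGroup lam, ∑ b, e b * g (σ b) =
      (∑ b : lam.cells, b.1.2 * K * (b.1.2 * d)) + (∑ b : lam.cells, b.1.2 * K * (T b : ℕ)) +
        (∑ b : lam.cells, b.1.1 * (b.1.2 * d)) + rowMeasure fun b => T (σ b) := by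
    intro σ hσ
    have h1 : ∑ b : lam.cells, b.1.2 * K * (T b : ℕ) =
        ∑ b : lam.cells, b.1.2 * K * (T (σ b) : ℕ) :=
      (Finset.sum_equiv σ (by simp) fun b _ => by rw [hσ b]).symm
    rw [h1, rowMeasure, ← Finset.sum_add_distrib, ← Finset.sum_add_distrib,
      ← Finset.sum_add_distrib]
    refine Finset.sum_congr rfl fun b _ => ?_
    simp only [e, g, hσ b]
    ring
  have hmono' : Monovary e (g ∘ σ) := by
    by_contra hn
    have h1 := hmono.sum_mul_comp_perm_lt_sum_mul_iff.2 hn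
    have h2 := hsum 1 (one_mem _)
    simp only [Equiv.Perm.one_apply] at h2
    change rowMeasure (fun b => T b) ≤ _ at h
    rw [hsum σ hσ, h2] at h1
    omega
  have hstrict : ∀ b c, e b < e c → e (σ b) < e (σ c) := by
    intro b c hbc
    rcases lt_trichotomy (e (σ b)) (e (σ c)) with h1 | h1 | h1
    · exact h1
    · exact absurd (σ.injective (heinj h1)) (by rintro rfl; exact lt_irrefl _ hbc)
    · exact absurd (hmono' (heg _ _ h1)) (not_le.2 hbc)
  by_contra hne
  -- An order-preserving permutation of a finite chain is trivial: the preimage of the least moved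
  -- box is larger, so its image would be a smaller moved box.
  obtain ⟨a, ha, hmin⟩ := Set.exists_min_image {a : lam.cells | σ a ≠ a} e (Set.toFinite _) (by
    by_contra hem
    rw [Set.not_nonempty_iff_eq_empty, Set.eq_empty_iff_forall_notMem] at hem
    exact hne (Equiv.ext fun a => not_not.1 (hem a)))
  have hb : σ (σ.symm a) ≠ σ.symm a := by
    rw [Equiv.apply_symm_apply]
    intro h'
    exact ha (by conv_lhs => rw [h', Equiv.apply_symm_apply])
  have h1 : e a < e (σ.symm a) := by
    refine lt_of_le_of_ne (hmin _ hb) fun h' => ?_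
    have := heinj h'
    rw [Equiv.apply_symm_apply] at hb
    exact hb this
  have h2 := hstrict _ _ h1
  rw [Equiv.apply_symm_apply] at h2
  have h3 : σ (σ a) ≠ σ a := fun h' => ha (σ.injective h')
  exact absurd (hmin _ h3) (not_le.2 h2)

/-- Triangularity for the row measure. Among the tableaux in a relation choose `T₀` of largest row
measure and take the coefficient of its row tabloid. A nontrivial column permutation strictly lowers
the measure of a semistandard tableau, so only the identity term of `T₀` itself contributes. -/
lemma linearIndependent_semistandard (b : Basis (Fin d) ℂ V) :
    LinearIndependent ℂ fun T : {T : lam.cells → Fin d // IsSemistandard lam T} =>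
      polytabloid lam (b ∘ T.1) := by
  classical
  rw [Fintype.linearIndependent_iff]
  intro c hc
  by_contra hne
  push Not at hne
  obtain ⟨T₁, hT₁⟩ := hne
  obtain ⟨T₀, hT₀, hmax⟩ := Set.exists_max_image {T | c T ≠ 0} (fun T => rowMeasure T.1)
    (Set.toFinite _) ⟨T₁, hT₁⟩
  have h := congrArg (tabloidCoeff lam b T₀.1) hc
  rw [map_sum, map_zero, Finset.sum_eq_single T₀] at h
  · rw [map_smul, polytabloid, map_sum, Finset.sum_eq_single 1] at h
    · rw [map_smul] at h
      have h1 : tabloidCoeff lam b T₀.1 (rowTabloid lam fun x => (b ∘ T₀.1)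
          (((1 : columnGroup lam) : Equiv.Perm lam.cells)⁻¹ x)) = 1 := by
        have := tabloidCoeff_rowTabloid lam b T₀.1 T₀.1
        rwa [if_pos fun _ => rfl] at this
      rw [h1] at h
      simp at h
      exact hT₀ h
    · intro τ _ hτ
      rw [map_smul]
      change _ • tabloidCoeff lam b T₀.1 (rowTabloid lam (b ∘ fun x => T₀.1
        ((τ : Equiv.Perm lam.cells)⁻¹ x))) = 0
      rw [tabloidCoeff_rowTabloid, if_neg, smul_zero]
      intro hcont
      have h1 : rowMeasure T₀.1 = rowMeasure fun x => T₀.1 ((τ : Equiv.Perm lam.cells)⁻¹ x) := by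
        rw [rowMeasure_eq, rowMeasure_eq]
        simp only [hcont]
      have := eq_one_of_rowMeasure_le T₀.2.2 (inv_mem τ.2) h1.le
      rw [inv_eq_one] at this
      exact hτ (Subtype.ext this)
    · simp
  · intro T _ hT
    by_cases hcT : c T = 0
    · rw [hcT, zero_smul, map_zero]
    rw [map_smul, polytabloid, map_sum, Finset.sum_eq_zero, smul_zero]
    intro τ _
    rw [map_smul]
    change _ • tabloidCoeff lam b T₀.1 (rowTabloid lam (b ∘ fun x => T.1
      ((τ : Equiv.Perm lam.cells)⁻¹ x))) = 0
    rw [tabloidCoeff_rowTabloid, if_neg, smul_zero]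
    intro hcont
    have h1 : rowMeasure T₀.1 = rowMeasure fun x => T.1 ((τ : Equiv.Perm lam.cells)⁻¹ x) := by
      rw [rowMeasure_eq, rowMeasure_eq]
      simp only [hcont]
    have h2 := eq_one_of_rowMeasure_le T.2.2 (inv_mem τ.2) ((hmax T hcT).trans h1.le)
    rw [h2] at hcont
    refine hT (Subtype.ext (eq_of_rowContent_eq T.2.1 T₀.2.1 fun i => ?_))
    by_cases hi : i < lam.colLen 0
    · exact hcont ⟨i, hi⟩
    · have hz : ∀ t : lam.cells → Fin d, rowContent lam t i = 0 := by
        intro t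
        rw [rowContent, Finset.sum_eq_zero]
        intro x hx
        refine absurd ?_ hi
        rw [← (Finset.mem_filter.1 hx).2]
        exact YoungDiagram.mem_iff_lt_colLen.1 (lam.up_left_mem le_rfl (Nat.zero_le x.1.2)
          ((YoungDiagram.mem_cells _).1 x.2))
      rw [hz, hz]
  · simp

end SemistandardSpan

/-! ### Weights of Schur functors -/

section SchurWeights

variable {d : ℕ} (lam : YoungDiagram) {V : Type*} [AddCommGroup V] [Module ℂ V]

instance : DecidablePred (IsSemistandard (d := d) lam) := fun _ => Classical.propDecidable _

/-- The semistandard basis of `∇ ^ lam V`. -/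
def schurBasis {G : Type*} [Group G] (ρ : Representation ℂ G V) (b : Basis (Fin d) ℂ V) :
    Basis {T : lam.cells → Fin d // IsSemistandard lam T} ℂ (schurSub lam ρ).toSubmodule :=
  (Basis.span (linearIndependent_semistandard (lam := lam) b)).map
    (LinearEquiv.ofEq _ _ (show _ = (schurSub lam ρ).toSubmodule from (span_semistandard lam b).symm))

lemma coe_schurBasis {G : Type*} [Group G] (ρ : Representation ℂ G V) (b : Basis (Fin d) ℂ V)
    (T : {T : lam.cells → Fin d // IsSemistandard lam T}) :
    (schurBasis lam ρ b T : RowTensor V lam) = polytabloid lam (b ∘ T.1) := by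
  rw [schurBasis, Basis.map_apply]
  exact congrArg Subtype.val (Basis.span_apply (linearIndependent_semistandard (lam := lam) b) T)

lemma schurRep_schurBasis {G : Type*} [Group G] (ρ : Representation ℂ G V) (b : Basis (Fin d) ℂ V)
    (g : G) (χ : Fin d → ℂ) (h : ∀ i, ρ g (b i) = χ i • b i)
    (T : {T : lam.cells → Fin d // IsSemistandard lam T}) :
    schurRep lam ρ g (schurBasis lam ρ b T) = (∏ c, χ (T.1 c)) • schurBasis lam ρ b T := by
  classical
  apply Subtype.ext
  change rowTensorRep lam ρ g (schurBasis lam ρ b T) =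
    (∏ c, χ (T.1 c)) • (schurBasis lam ρ b T : RowTensor V lam)
  rw [coe_schurBasis, rowTensorRep_polytabloid, ← polytabloidMap_apply, ← polytabloidMap_apply]
  simp only [Function.comp_apply, h]
  rw [MultilinearMap.map_smul_univ]
  rfl

end SchurWeights

/-! ### The symmetric powers of the natural representation -/

section SymNat

variable (n : ℕ)

/-- The monomials in the standard basis vectors of `E`. -/
def symMonomial (i : Fin (n + 1)) : SymmetricAlgebra ℂ (Fin 2 → ℂ) :=
  SymmetricAlgebra.ι ℂ _ (Pi.single 0 1) ^ (n - i : ℕ) *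
    SymmetricAlgebra.ι ℂ _ (Pi.single 1 1) ^ (i : ℕ)

lemma linearIndependent_symMonomial : LinearIndependent ℂ (symMonomial n) := by
  let e := SymmetricAlgebra.equivMvPolynomial (Pi.basisFun ℂ (Fin 2))
  have he : ∀ i : Fin (n + 1), e (symMonomial n i) = MvPolynomial.basisMonomials (Fin 2) ℂ
      (Finsupp.single 0 (n - i : ℕ) + Finsupp.single 1 (i : ℕ)) := by
    intro i
    have h : ∀ j : Fin 2, e (SymmetricAlgebra.ι ℂ _ (Pi.single j 1)) = MvPolynomial.X j := by
      intro j
      rw [← Pi.basisFun_apply]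
      exact SymmetricAlgebra.equivMvPolynomial_ι_apply _ _
    rw [symMonomial, map_mul, map_pow, map_pow, h, h, MvPolynomial.coe_basisMonomials,
      MvPolynomial.X_pow_eq_monomial, MvPolynomial.X_pow_eq_monomial, MvPolynomial.monomial_mul,
      one_mul]
  have hli : LinearIndependent ℂ (e.toLinearMap ∘ symMonomial n) := by
    have : e.toLinearMap ∘ symMonomial n = fun i : Fin (n + 1) =>
        MvPolynomial.basisMonomials (Fin 2) ℂ
          (Finsupp.single 0 (n - i : ℕ) + Finsupp.single 1 (i : ℕ)) := funext he
    rw [this]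
    refine (MvPolynomial.basisMonomials (Fin 2) ℂ).linearIndependent.comp _ fun i j hij => ?_
    have := DFunLike.congr_fun hij 1
    simp at this
    exact Fin.ext this
  exact hli.of_comp _

lemma span_symMonomial : Submodule.span ℂ
    (Set.range fun v : Fin n → Fin 2 → ℂ => ∏ j, SymmetricAlgebra.ι ℂ (Fin 2 → ℂ) (v j)) =
      Submodule.span ℂ (Set.range (symMonomial n)) := by
  classical
  refine le_antisymm (Submodule.span_le.2 ?_) (Submodule.span_le.2 ?_)
  · rintro _ ⟨v, rfl⟩
    have hv : ∀ j, SymmetricAlgebra.ι ℂ (Fin 2 → ℂ) (v j) =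
        ∑ i : Fin 2, v j i • SymmetricAlgebra.ι ℂ (Fin 2 → ℂ) (Pi.single i 1) := by
      intro j
      simp only [← map_smul, ← map_sum]
      congr 1
      funext k
      simp [Finset.sum_apply, Pi.single_apply]
    change ∏ j, SymmetricAlgebra.ι ℂ (Fin 2 → ℂ) (v j) ∈ _
    simp only [hv]
    rw [Finset.prod_univ_sum]
    refine Submodule.sum_mem _ fun J _ => ?_
    have hJ : ∏ j, v j (J j) • SymmetricAlgebra.ι ℂ (Fin 2 → ℂ) (Pi.single (J j) 1) =
        (∏ j, v j (J j)) • ∏ j, SymmetricAlgebra.ι ℂ (Fin 2 → ℂ) (Pi.single (J j) 1) :=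
      Finset.prod_smul _ _ _
    rw [hJ]
    refine Submodule.smul_mem _ _ (Submodule.subset_span ?_)
    have hcard : (Finset.univ.filter fun j => J j = 0).card +
        (Finset.univ.filter fun j => J j = 1).card = n := by
      have := Finset.card_eq_sum_card_fiberwise (s := Finset.univ) (t := Finset.univ) (f := J)
        fun _ _ => Finset.mem_coe.2 (Finset.mem_univ _)
      rw [Finset.card_univ, Fintype.card_fin, Fin.sum_univ_two] at this
      exact this.symm
    refine ⟨⟨(Finset.univ.filter fun j => J j = 1).card, by omega⟩, ?_⟩
    rw [← Finset.prod_fiberwise (g := J), Fin.prod_univ_two, symMonomial,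
      Finset.prod_congr rfl (g := fun _ => SymmetricAlgebra.ι ℂ (Fin 2 → ℂ) (Pi.single 0 1))
        fun j hj => by rw [(Finset.mem_filter.1 hj).2],
      Finset.prod_congr rfl (s₁ := Finset.univ.filter fun j => J j = 1)
        (g := fun _ => SymmetricAlgebra.ι ℂ (Fin 2 → ℂ) (Pi.single 1 1))
        fun j hj => by rw [(Finset.mem_filter.1 hj).2], Finset.prod_const, Finset.prod_const]
    congr 2
    simp only
    omega
  · rintro _ ⟨i, rfl⟩
    refine Submodule.subset_span ⟨fun j => if (j : ℕ) < n - i then Pi.single 0 1 else Pi.single 1 1,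
      ?_⟩
    have hi : (i : ℕ) ≤ n := Nat.lt_succ_iff.1 i.2
    have h1 : (Finset.univ.filter fun j : Fin n => (j : ℕ) < n - i).card = n - i := by
      rw [Fin.card_filter_val_lt]; omega
    have h2 : (Finset.univ.filter fun j : Fin n => ¬ (j : ℕ) < n - i).card = i := by
      have := Finset.card_filter_add_card_filter_not (s := (Finset.univ : Finset (Fin n)))
        (fun j : Fin n => (j : ℕ) < n - i)
      rw [Finset.card_univ, Fintype.card_fin, h1] at this
      omega
    simp only [apply_ite (SymmetricAlgebra.ι ℂ (Fin 2 → ℂ))]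
    rw [Finset.prod_ite, Finset.prod_const, Finset.prod_const, h1, h2, symMonomial]

/-- The monomial basis of `Sym ^ n E`. -/
def symBasis : Basis (Fin (n + 1)) ℂ (symPowSub n natRep).toSubmodule :=
  (Basis.span (linearIndependent_symMonomial n)).map
    (LinearEquiv.ofEq _ _ (show _ = (symPowSub n natRep).toSubmodule from (span_symMonomial n).symm))

lemma symPowRep_symBasis (q : ℂˣ) (i : Fin (n + 1)) :
    symPowRep n natRep (torus q) (symBasis n i) =
      (q : ℂ) ^ ((n : ℤ) - 2 * (i : ℕ)) • symBasis n i := by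
  have hb : (symBasis n i : SymmetricAlgebra ℂ (Fin 2 → ℂ)) = symMonomial n i := by
    rw [symBasis, Basis.map_apply]
    exact congrArg Subtype.val (Basis.span_apply (linearIndependent_symMonomial n) i)
  apply Subtype.ext
  change symAlgRep natRep (torus q) (symBasis n i) =
    (q : ℂ) ^ ((n : ℤ) - 2 * (i : ℕ)) • (symBasis n i : SymmetricAlgebra ℂ (Fin 2 → ℂ))
  rw [hb, symMonomial]
  have h0 : natRep (torus q) (Pi.single 0 1) = (q : ℂ) • (Pi.single 0 1 : Fin 2 → ℂ) := by
    ext j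
    fin_cases j <;> simp [natRep, coe_torus]
  have h1 : natRep (torus q) (Pi.single 1 1) = (q : ℂ)⁻¹ • (Pi.single 1 1 : Fin 2 → ℂ) := by
    ext j
    fin_cases j <;> simp [natRep, coe_torus]
  have hmul : ∀ x y, symAlgRep natRep (torus q) (x * y) =
      symAlgRep natRep (torus q) x * symAlgRep natRep (torus q) y := fun x y =>
    map_mul (SymmetricAlgebra.lift (SymmetricAlgebra.ι ℂ (Fin 2 → ℂ) ∘ₗ natRep (torus q))) x y
  have hpow : ∀ x (k : ℕ), symAlgRep natRep (torus q) (x ^ k) =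
      symAlgRep natRep (torus q) x ^ k := fun x k =>
    map_pow (SymmetricAlgebra.lift (SymmetricAlgebra.ι ℂ (Fin 2 → ℂ) ∘ₗ natRep (torus q))) x k
  rw [hmul, hpow, hpow, symAlgRep_ι, symAlgRep_ι, h0, h1, map_smul, map_smul, smul_pow, smul_pow,
    smul_mul_smul_comm]
  congr 1
  have hi : (i : ℕ) ≤ n := Nat.lt_succ_iff.1 i.2
  have hq : (q : ℂ) ≠ 0 := q.ne_zero
  rw [inv_pow, ← zpow_natCast, ← zpow_natCast, ← zpow_neg, ← zpow_add₀ hq]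
  congr 1
  push_cast [Nat.cast_sub hi]
  ring

end SymNat

/-! ### The torus action on Schur functors of symmetric powers -/

section Character

variable (n : ℕ) (lam : YoungDiagram)

/-- The weight of a tableau in `∇ ^ lam Sym ^ n E`. -/
def tableauWeight (T : lam.cells → Fin (n + 1)) : ℤ := ∑ c, ((n : ℤ) - 2 * (T c : ℕ))

lemma schurRep_torus (q : ℂˣ)
    (T : {T : lam.cells → Fin (n + 1) // IsSemistandard lam T}) :
    schurRep lam (symPowRep n natRep) (torus q) (schurBasis lam _ (symBasis n) T) =
      (q : ℂ) ^ tableauWeight n lam T.1 • schurBasis lam _ (symBasis n) T := by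
  rw [schurRep_schurBasis lam _ _ _ _ (symPowRep_symBasis n q)]
  congr 1
  rw [tableauWeight]
  induction (Finset.univ : Finset lam.cells) using Finset.cons_induction with
  | empty => simp
  | cons a s ha ih => rw [Finset.prod_cons, Finset.sum_cons, ih, zpow_add₀ q.ne_zero]

lemma trace_schurRep_torus (q : ℂˣ) :
    LinearMap.trace ℂ (schurSub lam (symPowRep n natRep)).toSubmodule
      (schurRep lam (symPowRep n natRep) (torus q)) =
      ∑ T : {T : lam.cells → Fin (n + 1) // IsSemistandard lam T},
        (q : ℂ) ^ tableauWeight n lam T.1 :=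
  trace_torus (V := (schurSub lam (symPowRep n natRep)).toSubmodule)
    (schurRep lam (symPowRep n natRep)) (schurBasis lam _ (symBasis n)) _
    (fun T q => schurRep_torus n lam q T) q

lemma span_weightVectors_schurRep :
    Submodule.span ℂ (weightVectors (V := (schurSub lam (symPowRep n natRep)).toSubmodule)
      (schurRep lam (symPowRep n natRep))) = ⊤ := by
  rw [eq_top_iff, ← (schurBasis lam (symPowRep n natRep) (symBasis n)).span_eq]
  refine Submodule.span_mono ?_
  rintro _ ⟨T, rfl⟩
  exact ⟨_, fun q => schurRep_torus n lam q T⟩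

/-- Plethystic equivalence is equality of the weights of semistandard tableaux. -/
theorem plethysticEquiv_iff (mu : YoungDiagram) (m : ℕ) : PlethysticEquiv lam n mu m ↔
    ∀ q : ℝ, 1 < q →
      ∑ T : {T : lam.cells → Fin (n + 1) // IsSemistandard lam T}, q ^ tableauWeight n lam T.1 =
      ∑ T : {T : mu.cells → Fin (m + 1) // IsSemistandard mu T}, q ^ tableauWeight m mu T.1 := by
  constructor
  · rintro ⟨e⟩ q hq
    have hq0 : (q : ℂ) ≠ 0 := by
      have : q ≠ 0 := by linarith
      exact_mod_cast this
    have h := (trace_schurRep_torus n lam (Units.mk0 _ hq0)).symm.trans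
      ((trace_eq_of_equiv (V := (schurSub lam (symPowRep n natRep)).toSubmodule)
        (W := (schurSub mu (symPowRep m natRep)).toSubmodule) e (torus (Units.mk0 _ hq0))).trans
        (trace_schurRep_torus m mu (Units.mk0 _ hq0)))
    simp only [Units.val_mk0] at h
    exact_mod_cast h
  · intro h
    have hM := multiset_eq_of_sum_zpow_eq
      (M := Finset.univ.val.map fun T : {T : lam.cells → Fin (n + 1) // IsSemistandard lam T} =>
        tableauWeight n lam T.1)
      (N := Finset.univ.val.map fun T : {T : mu.cells → Fin (m + 1) // IsSemistandard mu T} =>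
        tableauWeight m mu T.1) fun q hq => by
          rw [Multiset.map_map, Multiset.map_map]; exact h q hq
    refine HasStar.nonempty_equiv (V := (schurSub lam (symPowRep n natRep)).toSubmodule)
      (W := (schurSub mu (symPowRep m natRep)).toSubmodule)
      (hasStar_schurRep lam (hasStar_symPowRep n hasStar_natRep))
      (hasStar_schurRep mu (hasStar_symPowRep m hasStar_natRep))
      (span_weightVectors_schurRep n lam) (span_weightVectors_schurRep m mu) fun q => ?_
    refine (trace_schurRep_torus n lam q).trans (Eq.trans ?_ (trace_schurRep_torus m mu q).symm)
    have := congrArg (fun M : Multiset ℤ => (M.map fun k => (q : ℂ) ^ k).sum) hM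
    simp only [Multiset.map_map] at this
    exact this

end Character

/-! ### Young diagrams from row lengths -/

section Rows

lemma rowLen_eq_of_mem_iff {μ : YoungDiagram} {i n : ℕ} (h : ∀ j, (i, j) ∈ μ ↔ j < n) :
    μ.rowLen i = n := by
  refine le_antisymm ?_ ?_
  · by_contra hlt
    exact lt_irrefl n ((h n).1 (YoungDiagram.mem_iff_lt_rowLen.2 (not_le.1 hlt)))
  · by_contra hlt
    exact lt_irrefl _ (YoungDiagram.mem_iff_lt_rowLen.1 ((h _).2 (not_le.1 hlt)))

lemma colLen_zero_le_iff {μ : YoungDiagram} {d : ℕ} : μ.colLen 0 ≤ d ↔ μ.rowLen d = 0 := by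
  rw [← not_lt, ← YoungDiagram.mem_iff_lt_colLen, YoungDiagram.mem_iff_lt_rowLen]
  omega

lemma rowLen_eq_zero {μ : YoungDiagram} {d i : ℕ} (h : μ.colLen 0 ≤ d) (hi : d ≤ i) :
    μ.rowLen i = 0 := colLen_zero_le_iff.1 (h.trans hi)

lemma youngDiagram_ext {μ ν : YoungDiagram} (h : ∀ i, μ.rowLen i = ν.rowLen i) : μ = ν := by
  ext ⟨i, j⟩
  rw [YoungDiagram.mem_cells, YoungDiagram.mem_cells, YoungDiagram.mem_iff_lt_rowLen,
    YoungDiagram.mem_iff_lt_rowLen, h]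

lemma exists_youngDiagram {d : ℕ} (g : ℕ → ℕ) (hg : Antitone g) (hd : g d = 0) :
    ∃ μ : YoungDiagram, ∀ i, μ.rowLen i = g i := by
  refine ⟨⟨(Finset.range d ×ˢ Finset.range (g 0)).filter fun c => c.2 < g c.1, ?_⟩, fun i =>
    rowLen_eq_of_mem_iff fun j => ?_⟩
  · rintro ⟨i, j⟩ ⟨i', j'⟩ ⟨hi : i' ≤ i, hj : j' ≤ j⟩ h
    simp only [Finset.coe_filter, Finset.mem_product, Finset.mem_range, Set.mem_ofPred_eq] at h ⊢
    have := hg hi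
    omega
  · refine (YoungDiagram.mem_mk _ _ _).trans ?_
    simp only [Finset.mem_filter, Finset.mem_product, Finset.mem_range]
    have h0 := hg (Nat.zero_le i)
    constructor
    · exact fun h => h.2
    · intro h
      refine ⟨⟨?_, by omega⟩, h⟩
      by_contra hi
      have := hg (not_lt.1 hi)
      omega

lemma card_cells_eq {μ : YoungDiagram} {d : ℕ} (h : μ.colLen 0 ≤ d) :
    μ.cells.card = ∑ j : Fin d, μ.rowLen (d - 1 - j) := by
  have h1 : μ.cells.card = ∑ i ∈ Finset.range d, μ.rowLen i := by
    rw [Finset.card_eq_sum_card_fiberwise (f := Prod.fst) (t := Finset.range d)]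
    · refine Finset.sum_congr rfl fun i _ => ?_
      rw [YoungDiagram.rowLen_eq_card]
      rfl
    · rintro ⟨i, j⟩ hc
      have h2 := YoungDiagram.mem_iff_lt_rowLen.1 ((YoungDiagram.mem_cells _).1 hc)
      by_contra hi
      have := rowLen_eq_zero h (not_lt.1 fun h' => hi (Finset.mem_coe.2 (Finset.mem_range.2 h')))
      change j < μ.rowLen i at h2
      change μ.rowLen i = 0 at this
      omega
  rw [h1, ← Finset.sum_range_reflect, Finset.sum_range]

end Rows

/-! ### Alternants -/

section Alternant

variable {R : Type*} [CommRing R]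

/-- The determinant of the matrix of powers `x i ^ β j`. -/
def alternant (x : ℕ → R) {d : ℕ} (β : Fin d → ℕ) : R :=
  Matrix.det (Matrix.of fun i j : Fin d => x i ^ β j)

lemma det_sum_columns {d : ℕ} (s : Fin d → Finset ℕ) (f : Fin d → Fin d → ℕ → R) :
    Matrix.det (Matrix.of fun i j => ∑ γ ∈ s j, f i j γ) =
      ∑ γ ∈ Fintype.piFinset s, Matrix.det (Matrix.of fun i j => f i j (γ j)) := by
  rw [← Matrix.det_transpose]
  have := (Matrix.detRowAlternating (n := Fin d) (R := R)).toMultilinearMap.map_sum_finset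
    (fun j γ i => f i j γ) s
  have h1 : (Matrix.of fun i j => ∑ γ ∈ s j, f i j γ).transpose =
      fun j => ∑ γ ∈ s j, fun i => f i j γ := by
    ext j i
    simp
  rw [h1]
  refine Eq.trans this (Finset.sum_congr rfl fun γ _ => ?_)
  rw [← Matrix.det_transpose]
  rfl

/-- Branching rule for alternants. -/
lemma alternant_succ (x : ℕ → R) {d : ℕ} (β : Fin (d + 1) → ℕ)
    (hβ : ∀ j : Fin d, β j.castSucc ≤ β j.succ) :
    alternant x β = (-1) ^ d * (∏ i : Fin d, (x i - x d)) *
      ∑ γ ∈ Fintype.piFinset fun j : Fin d => Finset.Ico (β j.castSucc) (β j.succ),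
        x d ^ (β 0 + ∑ j : Fin d, (β j.succ - 1 - γ j)) * alternant x γ := by
  -- Subtracting from each column a multiple of the preceding one clears the last row except in
  -- column 0. Each remaining entry is divisible by `x i - x d`, with a geometric sum over the
  -- interval between consecutive exponents as quotient.
  let B : Matrix (Fin (d + 1)) (Fin (d + 1)) R := Matrix.of fun i j =>
    Fin.cases (x i ^ β 0)
      (fun j : Fin d => x i ^ β j.succ - x d ^ (β j.succ - β j.castSucc) * x i ^ β j.castSucc) j
  have hB0 : ∀ i, B i 0 = x i ^ β 0 := fun i => rfl
  have hBs : ∀ i (j : Fin d), B i j.succ =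
      x i ^ β j.succ - x d ^ (β j.succ - β j.castSucc) * x i ^ β j.castSucc := fun i j => rfl
  have h1 : alternant x β = B.det :=
    Matrix.det_eq_of_forall_col_eq_smul_add_pred (fun j => x d ^ (β j.succ - β j.castSucc))
      (fun i => rfl) fun i j => by rw [hBs]; simp
  have h2 : B.det = (-1) ^ d * x d ^ β 0 *
      (Matrix.of fun i j : Fin d => B i.castSucc j.succ).det := by
    rw [Matrix.det_succ_row B (Fin.last d), Finset.sum_eq_single 0]
    · rw [hB0, Fin.succAbove_last]
      simp only [Fin.val_last, Fin.val_zero, add_zero]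
      congr 1
    · intro j _ hj
      obtain ⟨k, rfl⟩ := Fin.exists_succ_eq.2 hj
      rw [hBs, Fin.val_last, ← pow_add, Nat.sub_add_cancel (hβ k), sub_self]
      simp
    · simp
  have h3 : ∀ i j : Fin d, B i.castSucc j.succ = (x i - x d) *
      ∑ γ ∈ Finset.Ico (β j.castSucc) (β j.succ), x d ^ (β j.succ - 1 - γ) * x i ^ γ := by
    intro i j
    rw [hBs, Finset.sum_Ico_eq_sum_range, Fin.val_castSucc]
    have hg := (Commute.all (x i) (x d)).geom_sum₂_mul (β j.succ - β j.castSucc)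
    have h4 : ∑ k ∈ Finset.range (β j.succ - β j.castSucc),
        x d ^ (β j.succ - 1 - (β j.castSucc + k)) * x i ^ (β j.castSucc + k) =
        x i ^ β j.castSucc * ∑ k ∈ Finset.range (β j.succ - β j.castSucc),
          x i ^ k * x d ^ (β j.succ - β j.castSucc - 1 - k) := by
      rw [Finset.mul_sum]
      refine Finset.sum_congr rfl fun k _ => ?_
      rw [show β j.succ - 1 - (β j.castSucc + k) = β j.succ - β j.castSucc - 1 - k by omega]
      ring
    rw [h4]
    have h5 : x i ^ β j.succ = x i ^ β j.castSucc * x i ^ (β j.succ - β j.castSucc) := by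
      rw [← pow_add, Nat.add_sub_cancel' (hβ j)]
    rw [h5]
    linear_combination (-(x i ^ β j.castSucc)) * hg
  have h4 : (Matrix.of fun i j : Fin d => B i.castSucc j.succ).det = (∏ i : Fin d, (x i - x d)) *
      (Matrix.of fun i j : Fin d => ∑ γ ∈ Finset.Ico (β j.castSucc) (β j.succ),
        x d ^ (β j.succ - 1 - γ) * x i ^ γ).det := by
    rw [← Matrix.det_mul_column]
    congr 1
    ext i j
    exact h3 i j
  rw [h1, h2, h4, det_sum_columns, Finset.mul_sum, Finset.mul_sum, Finset.mul_sum]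
  refine Finset.sum_congr rfl fun γ _ => ?_
  have h5 : (Matrix.of fun i j : Fin d => x d ^ (β j.succ - 1 - γ j) * x i ^ γ j).det =
      (∏ j : Fin d, x d ^ (β j.succ - 1 - γ j)) * alternant x γ := by
    rw [alternant, ← Matrix.det_mul_row]
    rfl
  rw [h5, pow_add, Finset.prod_pow_eq_pow_sum]
  ring

end Alternant

/-! ### Branching of semistandard tableaux -/

section Branching

/-- The set of beads of a partition with at most `d` parts, in increasing order. -/
def beads (d : ℕ) (lam : YoungDiagram) (j : Fin d) : ℕ := lam.rowLen (d - 1 - j) + j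

lemma beads_injective {d : ℕ} {μ ν : YoungDiagram} (hμ : μ.colLen 0 ≤ d) (hν : ν.colLen 0 ≤ d)
    (h : beads d μ = beads d ν) : μ = ν := by
  refine youngDiagram_ext fun i => ?_
  by_cases hi : i < d
  · have := congrFun h ⟨d - 1 - i, by omega⟩
    simp only [beads] at this
    rw [show d - 1 - (d - 1 - i) = i by omega] at this
    omega
  · rw [rowLen_eq_zero hμ (not_lt.1 hi), rowLen_eq_zero hν (not_lt.1 hi)]

lemma beads_castSucc_lt_succ {d : ℕ} (lam : YoungDiagram) (j : Fin d) :
    beads (d + 1) lam j.castSucc < beads (d + 1) lam j.succ := by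
  have := lam.rowLen_anti (d + 1 - 1 - (j.succ : Fin (d + 1))) (d + 1 - 1 - j.castSucc) (by simp; omega)
  simp only [beads, Fin.val_succ, Fin.val_castSucc] at this ⊢
  omega

variable {d : ℕ} {lam : YoungDiagram}

/-- Bead `j` of a `d`-row shape carries the shift `j`, while its upper neighbour in `lam` carries `j
+ 1`. Thus the half-open intervals for `γ` are exactly the closed interlacing inequalities between
row lengths. -/
lemma exists_beads_eq {γ : Fin d → ℕ}
    (hγ : γ ∈ Fintype.piFinset fun j : Fin d =>
      Finset.Ico (beads (d + 1) lam j.castSucc) (beads (d + 1) lam j.succ)) :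
    ∃ μ : YoungDiagram, μ.colLen 0 ≤ d ∧ beads d μ = γ ∧
      ∀ i < d, lam.rowLen (i + 1) ≤ μ.rowLen i ∧ μ.rowLen i ≤ lam.rowLen i := by
  have hγ' : ∀ i (h : i < d), lam.rowLen (i + 1) ≤ γ ⟨d - 1 - i, by omega⟩ - (d - 1 - i) ∧
      γ ⟨d - 1 - i, by omega⟩ - (d - 1 - i) ≤ lam.rowLen i ∧ d - 1 - i ≤ γ ⟨d - 1 - i, by omega⟩ := by
    intro i hi
    have h1 := Finset.mem_Ico.1 (Fintype.mem_piFinset.1 hγ ⟨d - 1 - i, by omega⟩)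
    simp only [beads, Fin.val_succ, Fin.val_castSucc] at h1
    rw [show d + 1 - 1 - (d - 1 - i) = i + 1 by omega,
      show d + 1 - 1 - (d - 1 - i + 1) = i by omega] at h1
    omega
  let g : ℕ → ℕ := fun i => if h : i < d then γ ⟨d - 1 - i, by omega⟩ - (d - 1 - i) else 0
  have hg : ∀ i (h : i < d), g i = γ ⟨d - 1 - i, by omega⟩ - (d - 1 - i) := fun i h => dif_pos h
  have hg0 : ∀ i, ¬ i < d → g i = 0 := fun i h => dif_neg h
  obtain ⟨μ, hμ⟩ := exists_youngDiagram (d := d) g (antitone_nat_of_succ_le fun i => by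
    by_cases h : i + 1 < d
    · rw [hg _ h, hg i (by omega)]
      exact (hγ' _ h).2.1.trans (hγ' i (by omega)).1
    · rw [hg0 _ h]; exact Nat.zero_le _) (hg0 d (lt_irrefl d))
  refine ⟨μ, colLen_zero_le_iff.2 ((hμ d).trans (hg0 d (lt_irrefl d))), ?_, fun i hi => ?_⟩
  · funext j
    have hj := j.2
    have h1 : d - 1 - (d - 1 - (j : ℕ)) = j := by omega
    have h2 := (hγ' (d - 1 - j) (by omega)).2.2
    rw [beads, hμ, hg _ (by omega)]
    simp only [h1] at h2 ⊢
    change γ j - (j : ℕ) + j = γ j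
    change (j : ℕ) ≤ γ j at h2
    omega
  · rw [hμ, hg i hi]
    exact ⟨(hγ' i hi).1, (hγ' i hi).2.1⟩

lemma IsSemistandard.row_le {T : lam.cells → Fin d} (hT : IsSemistandard lam T) :
    ∀ i j (h : (i, j) ∈ lam.cells), i ≤ T ⟨(i, j), h⟩ := by
  intro i
  induction i with
  | zero => intros; exact Nat.zero_le _
  | succ i ih =>
    intro j h
    have h' : (i, j) ∈ lam.cells := (YoungDiagram.mem_cells _).2
      (lam.up_left_mem (Nat.le_succ i) le_rfl ((YoungDiagram.mem_cells _).1 h))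
    have h1 := ih j h'
    have h2 := hT.2 ⟨(i, j), h'⟩ ⟨(i + 1, j), h⟩ rfl (Nat.lt_succ_self i)
    rw [Fin.lt_def] at h2
    omega

/-- The shape formed by the entries of a semistandard tableau that are not maximal. -/
lemma IsSemistandard.exists_shape {T : lam.cells → Fin (d + 1)} (hT : IsSemistandard lam T) :
    ∃ μ : YoungDiagram, (∀ c : lam.cells, c.1 ∈ μ ↔ T c ≠ Fin.last d) ∧ μ ≤ lam := by
  classical
  refine ⟨⟨(Finset.univ.filter fun c => T c ≠ Fin.last d).map (Function.Embedding.subtype _), ?_⟩,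
    fun c => ?_, ?_⟩
  · rintro ⟨i, j⟩ ⟨i', j'⟩ ⟨hi : i' ≤ i, hj : j' ≤ j⟩ h
    simp only [Finset.coe_map, Function.Embedding.subtype_apply, Finset.coe_filter,
      Finset.mem_univ, true_and, Set.mem_image] at h ⊢
    obtain ⟨⟨c, hc⟩, hcT, rfl⟩ := h
    have hmem : ∀ i' j', i' ≤ i → j' ≤ j → (i', j') ∈ lam.cells := fun i' j' hi hj =>
      (YoungDiagram.mem_cells _).2 (lam.up_left_mem hi hj ((YoungDiagram.mem_cells _).1 hc))
    refine ⟨⟨(i', j'), hmem _ _ hi hj⟩, ?_, rfl⟩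
    refine ne_of_lt (lt_of_le_of_lt ?_ (lt_of_le_of_ne (Fin.le_last _) hcT))
    refine (hT.1 ⟨(i', j'), hmem _ _ hi hj⟩ ⟨(i', j), hmem _ _ hi le_rfl⟩ rfl hj).trans ?_
    rcases hi.lt_or_eq with h | rfl
    · exact (hT.2 ⟨(i', j), hmem _ _ hi le_rfl⟩ ⟨(i, j), hc⟩ rfl h).le
    · exact le_rfl
  · refine (YoungDiagram.mem_mk _ _ _).trans ?_
    simp
  · intro c hc
    obtain ⟨c, -, rfl⟩ := Finset.mem_map.1 ((YoungDiagram.mem_mk _ _ _).1 hc)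
    exact (YoungDiagram.mem_cells _).1 c.2

/-- Column strictness allows at most one maximal entry in a column, which is the interlacing
condition. Entries in row `d` are at least `d`, so that row disappears. -/
lemma shape_mem_piFinset {T : lam.cells → Fin (d + 1)} (hT : IsSemistandard lam T)
    {μ : YoungDiagram} (hμ : ∀ c : lam.cells, c.1 ∈ μ ↔ T c ≠ Fin.last d) (hle : μ ≤ lam) :
    μ.colLen 0 ≤ d ∧ beads d μ ∈ Fintype.piFinset fun j : Fin d =>
      Finset.Ico (beads (d + 1) lam j.castSucc) (beads (d + 1) lam j.succ) := by
  constructor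
  · rw [← not_lt, ← YoungDiagram.mem_iff_lt_colLen]
    intro h
    have hc : (d, 0) ∈ lam.cells := (YoungDiagram.mem_cells _).2 (hle h)
    have h1 := (hμ ⟨_, hc⟩).1 h
    have h2 := hT.row_le d 0 hc
    exact h1 (Fin.ext (le_antisymm (Fin.le_last _) h2))
  · rw [Fintype.mem_piFinset]
    intro j
    have hj := j.2
    rw [Finset.mem_Ico]
    simp only [beads, Fin.val_castSucc, Fin.val_succ]
    rw [show d + 1 - 1 - (j : ℕ) = d - 1 - j + 1 by omega,
      show d + 1 - 1 - ((j : ℕ) + 1) = d - 1 - j by omega]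
    set i := d - 1 - (j : ℕ) with hi
    have h1 : lam.rowLen (i + 1) ≤ μ.rowLen i := by
      by_contra hlt
      have hm : (i + 1, μ.rowLen i) ∈ lam.cells :=
        (YoungDiagram.mem_cells _).2 (YoungDiagram.mem_iff_lt_rowLen.2 (not_le.1 hlt))
      have hm' : (i, μ.rowLen i) ∈ lam.cells := (YoungDiagram.mem_cells _).2
        (lam.up_left_mem (Nat.le_succ i) le_rfl ((YoungDiagram.mem_cells _).1 hm))
      have h2 := hT.2 ⟨_, hm'⟩ ⟨_, hm⟩ rfl (Nat.lt_succ_self i)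
      have h3 := (hμ ⟨_, hm'⟩).2 (ne_of_lt (h2.trans_le (Fin.le_last _)))
      exact lt_irrefl _ (YoungDiagram.mem_iff_lt_rowLen.1 h3)
    have h2 : μ.rowLen i ≤ lam.rowLen i := by
      by_contra hlt
      exact lt_irrefl _ (YoungDiagram.mem_iff_lt_rowLen.1
        (hle (YoungDiagram.mem_iff_lt_rowLen.2 (not_le.1 hlt))))
    omega

variable {R : Type*} [CommRing R]

/-- The Schur polynomial, as a sum over semistandard tableaux. -/
def schurSum (d : ℕ) (lam : YoungDiagram) (x : ℕ → R) : R :=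
  ∑ T : {T : lam.cells → Fin d // IsSemistandard lam T}, ∏ c, x (T.1 c)

/-- The tableaux whose non-maximal entries form the diagram `μ`. -/
lemma sum_shape_eq (x : ℕ → R) (hlam : lam.colLen 0 ≤ d + 1) {μ : YoungDiagram}
    (hμd : μ.colLen 0 ≤ d)
    (hμ : ∀ i < d, lam.rowLen (i + 1) ≤ μ.rowLen i ∧ μ.rowLen i ≤ lam.rowLen i) :
    ∑ T : {T : lam.cells → Fin (d + 1) // IsSemistandard lam T} with
      ∀ c : lam.cells, c.1 ∈ μ ↔ T.1 c ≠ Fin.last d, ∏ c, x (T.1 c) =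
    x d ^ (lam.cells.card - μ.cells.card) * schurSum d μ x := by
  classical
  have hle : ∀ c, c ∈ μ → c ∈ lam := by
    rintro ⟨i, j⟩ hc
    rw [YoungDiagram.mem_iff_lt_rowLen] at hc ⊢
    have hi : i < d := by
      by_contra hi
      rw [rowLen_eq_zero hμd (not_lt.1 hi)] at hc
      exact absurd hc (Nat.not_lt_zero _)
    exact hc.trans_le (hμ i hi).2
  have hcell : ∀ c : μ.cells, c.1 ∈ lam.cells := fun c =>
    (YoungDiagram.mem_cells _).2 (hle _ ((YoungDiagram.mem_cells _).1 c.2))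
  rw [schurSum, Finset.mul_sum]
  -- The inverse construction fills `lam` outside `μ` with the maximal entry. By interlacing, a box
  -- above such a box lies in `μ`, so columns remain strict.
  have hS : ∀ T' : μ.cells → Fin d, IsSemistandard μ T' → IsSemistandard lam fun c : lam.cells =>
      if h : c.1 ∈ μ.cells then (T' ⟨c.1, h⟩).castSucc else Fin.last d := by
    intro T' hT'
    constructor
    · intro b c hrow hcol
      by_cases hc : c.1 ∈ μ.cells
      · have hb : b.1 ∈ μ.cells := (YoungDiagram.mem_cells _).2
          (μ.up_left_mem hrow.le hcol ((YoungDiagram.mem_cells _).1 hc))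
        simp only [hc, hb, dif_pos]
        exact Fin.castSucc_le_castSucc_iff.2 (hT'.1 ⟨b.1, hb⟩ ⟨c.1, hc⟩ hrow hcol)
      · simp only [hc, dif_neg, not_false_eq_true]
        exact Fin.le_last _
    · intro b c hcol hrow
      by_cases hc : c.1 ∈ μ.cells
      · have hb : b.1 ∈ μ.cells := (YoungDiagram.mem_cells _).2
          (μ.up_left_mem hrow.le hcol.le ((YoungDiagram.mem_cells _).1 hc))
        simp only [hc, hb, dif_pos]
        exact Fin.castSucc_lt_castSucc_iff.2 (hT'.2 ⟨b.1, hb⟩ ⟨c.1, hc⟩ hcol hrow)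
      · have hcl := YoungDiagram.mem_iff_lt_rowLen.1 ((YoungDiagram.mem_cells _).1 c.2)
        have hcd : c.1.1 < d + 1 := by
          by_contra hi
          rw [rowLen_eq_zero hlam (not_lt.1 hi)] at hcl
          exact absurd hcl (Nat.not_lt_zero _)
        have hb : b.1 ∈ μ.cells := by
          refine (YoungDiagram.mem_cells _).2 (YoungDiagram.mem_iff_lt_rowLen.2 ?_)
          have h1 := (hμ b.1.1 (by omega)).1
          have h2 := lam.rowLen_anti (b.1.1 + 1) c.1.1 hrow
          change c.1.2 < lam.rowLen c.1.1 at hcl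
          change b.1.2 < μ.rowLen b.1.1
          omega
        simp only [hc, hb, dif_pos, dif_neg, not_false_eq_true]
        exact Fin.castSucc_lt_last _
  refine Finset.sum_bij' (t := Finset.univ)
    (fun T hT => ⟨fun c => (T.1 ⟨c.1, hcell c⟩).castPred
      (((Finset.mem_filter.1 hT).2 _).1 ((YoungDiagram.mem_cells _).1 c.2)), ?_, ?_⟩)
    (fun T' _ => ⟨_, hS T'.1 T'.2⟩) ?_ ?_ ?_ ?_ ?_
  · intro b c h1 h2
    exact Fin.castPred_le_castPred_iff.2 (T.2.1 _ _ h1 h2)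
  · intro b c h1 h2
    exact Fin.castPred_lt_castPred_iff.2 (T.2.2 _ _ h1 h2)
  · intro T _
    exact Finset.mem_univ _
  · intro T' _
    rw [Finset.mem_filter]
    refine ⟨Finset.mem_univ _, fun c => ?_⟩
    by_cases hc : c.1 ∈ μ.cells
    · simp only [hc, dif_pos]
      exact ⟨fun _ => (Fin.castSucc_lt_last _).ne, fun _ => (YoungDiagram.mem_cells _).1 hc⟩
    · simp only [hc, dif_neg, not_false_eq_true, ne_eq, not_true_eq_false, iff_false]
      rwa [YoungDiagram.mem_cells] at hc
  · intro T hT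
    apply Subtype.ext
    funext c
    by_cases hc : c.1 ∈ μ.cells
    · simp [hc]
    · simp only [hc, dif_neg, not_false_eq_true]
      have := ((Finset.mem_filter.1 hT).2 c).not
      rw [not_not, ← YoungDiagram.mem_cells] at this
      exact (this.1 hc).symm
  · intro T' _
    apply Subtype.ext
    funext c
    simp
  · intro T hT
    have hT' := (Finset.mem_filter.1 hT).2
    rw [← Finset.prod_filter_mul_prod_filter_not Finset.univ fun c : lam.cells => c.1 ∈ μ, mul_comm]
    congr 1
    · rw [Finset.prod_congr rfl (g := fun _ => x d), Finset.prod_const]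
      · congr 1
        have h1 := Finset.card_filter_add_card_filter_not (s := (Finset.univ : Finset lam.cells))
          fun c => c.1 ∈ μ
        have h2 : (Finset.univ.filter fun c : lam.cells => c.1 ∈ μ).card = μ.cells.card := by
          rw [← Finset.card_map (Function.Embedding.subtype _)]
          congr 1
          ext c
          simp only [Finset.mem_map, Finset.mem_filter, Finset.mem_univ, true_and,
            Function.Embedding.subtype_apply, YoungDiagram.mem_cells]
          exact ⟨by rintro ⟨c, hc, rfl⟩; exact hc, fun hc => ⟨⟨c, hle c hc⟩, hc, rfl⟩⟩
        rw [Finset.card_univ, Fintype.card_coe] at h1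
        omega
      · intro c hc
        have := (not_iff_not.2 (hT' c)).1 (Finset.mem_filter.1 hc).2
        rw [not_not] at this
        rw [this, Fin.val_last]
    · refine Finset.prod_bij' (fun c hc => ⟨c.1, (YoungDiagram.mem_cells _).2
        (Finset.mem_filter.1 hc).2⟩) (fun c _ => ⟨c.1, hcell c⟩) ?_ ?_ ?_ ?_ ?_
      · intros; exact Finset.mem_univ _
      · intro c _
        exact Finset.mem_filter.2 ⟨Finset.mem_univ _, (YoungDiagram.mem_cells _).1 c.2⟩
      · intros; rfl
      · intros; rfl
      · intro c _
        simp

/-- The bialternant formula for Schur polynomials. -/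
theorem schurSum_mul_alternant (x : ℕ → R) (d : ℕ) : ∀ lam : YoungDiagram, lam.colLen 0 ≤ d →
    schurSum d lam x * alternant x (fun j : Fin d => (j : ℕ)) = alternant x (beads d lam) := by
  classical
  induction d with
  | zero =>
    intro lam hlam
    have : IsEmpty lam.cells := by
      refine ⟨fun c => ?_⟩
      have h := YoungDiagram.mem_iff_lt_rowLen.1 ((YoungDiagram.mem_cells _).1 c.2)
      rw [rowLen_eq_zero hlam (Nat.zero_le _)] at h
      exact absurd h (Nat.not_lt_zero _)
    have hu : Unique {T : lam.cells → Fin 0 // IsSemistandard lam T} :=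
      { default := ⟨isEmptyElim, isEmptyElim, isEmptyElim⟩
        uniq := fun T => Subtype.ext (Subsingleton.elim _ _) }
    have h1 : schurSum 0 lam x = 1 := by
      rw [schurSum, Fintype.sum_unique]
      simp
    rw [h1, one_mul, alternant, alternant, Matrix.det_isEmpty, Matrix.det_isEmpty]
  | succ d ih =>
    intro lam hlam
    set P := Fintype.piFinset fun j : Fin d =>
      Finset.Ico (beads (d + 1) lam j.castSucc) (beads (d + 1) lam j.succ) with hP
    -- For consecutive exponents the intervals are singletons, so the branching sum has a single
    -- term.
    have hδ : alternant x (fun j : Fin (d + 1) => (j : ℕ)) =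
        (-1) ^ d * (∏ i : Fin d, (x i - x d)) * alternant x (fun j : Fin d => (j : ℕ)) := by
      rw [alternant_succ x _ fun j => by simp]
      have h1 : (Fintype.piFinset fun j : Fin d => Finset.Ico ((j.castSucc : Fin (d + 1)) : ℕ)
          ((j.succ : Fin (d + 1)) : ℕ)) = {fun j : Fin d => (j : ℕ)} := by
        ext γ
        simp only [Fintype.mem_piFinset, Finset.mem_Ico, Fin.val_castSucc, Fin.val_succ,
          Finset.mem_singleton, funext_iff]
        exact forall_congr' fun j => by omega
      rw [h1, Finset.sum_singleton]
      simp
    choose! μ hμd hμb hμi using fun γ (hγ : γ ∈ P) => exists_beads_eq hγ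
    have hbranch : schurSum (d + 1) lam x =
        ∑ γ ∈ P, x d ^ (lam.cells.card - (μ γ).cells.card) * schurSum d (μ γ) x := by
      have h1 : ∀ T : {T : lam.cells → Fin (d + 1) // IsSemistandard lam T},
          ∃ ν : YoungDiagram, (∀ c : lam.cells, c.1 ∈ ν ↔ T.1 c ≠ Fin.last d) ∧ ν ≤ lam :=
        fun T => T.2.exists_shape
      choose ν hν hνle using h1
      have h2 : ∀ T, (ν T).colLen 0 ≤ d ∧ beads d (ν T) ∈ P :=
        fun T => shape_mem_piFinset T.2 (hν T) (hνle T)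
      rw [schurSum, ← Finset.sum_fiberwise_of_maps_to (s := Finset.univ) (t := P)
        (g := fun T => beads d (ν T)) fun T _ => (h2 T).2]
      refine Finset.sum_congr rfl fun γ hγ => ?_
      rw [← sum_shape_eq x hlam (hμd γ hγ) (hμi γ hγ)]
      refine Finset.sum_congr ?_ fun T _ => rfl
      ext T
      simp only [Finset.mem_filter, Finset.mem_univ, true_and]
      constructor
      · intro h
        have : ν T = μ γ := beads_injective (h2 T).1 (hμd γ hγ) (h.trans (hμb γ hγ).symm)
        rw [← this]
        exact hν T
      · intro h
        have : ν T = μ γ := by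
          ext c
          rw [YoungDiagram.mem_cells, YoungDiagram.mem_cells]
          have hsub : c ∈ μ γ → c ∈ lam := by
            obtain ⟨i, j⟩ := c
            intro hc
            rw [YoungDiagram.mem_iff_lt_rowLen] at hc ⊢
            have hi : i < d := by
              by_contra hi
              rw [rowLen_eq_zero (hμd γ hγ) (not_lt.1 hi)] at hc
              exact absurd hc (Nat.not_lt_zero _)
            exact hc.trans_le (hμi γ hγ i hi).2
          by_cases hc : c ∈ lam
          · exact (hν T ⟨c, (YoungDiagram.mem_cells _).2 hc⟩).trans
              (h ⟨c, (YoungDiagram.mem_cells _).2 hc⟩).symm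
          · exact ⟨fun h' => absurd (hνle T h') hc, fun h' => absurd (hsub h') hc⟩
        rw [this, hμb γ hγ]
    rw [hbranch, hδ, alternant_succ x (beads (d + 1) lam) fun j => (beads_castSucc_lt_succ lam j).le,
      Finset.sum_mul, Finset.mul_sum]
    refine Finset.sum_congr rfl fun γ hγ => ?_
    -- The power of `x d` in the alternant branching counts the boxes removed from `lam`, as it does
    -- for tableaux.
    have hexp : lam.cells.card - (μ γ).cells.card =
        beads (d + 1) lam 0 + ∑ j : Fin d, (beads (d + 1) lam j.succ - 1 - γ j) := by
      rw [card_cells_eq hlam, card_cells_eq (hμd γ hγ), Fin.sum_univ_succ]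
      have h1 : ∑ j : Fin d, lam.rowLen (d + 1 - 1 - (j.succ : Fin (d + 1))) =
          ∑ j : Fin d, (μ γ).rowLen (d - 1 - j) +
            ∑ j : Fin d, (beads (d + 1) lam j.succ - 1 - γ j) := by
        rw [← Finset.sum_add_distrib]
        refine Finset.sum_congr rfl fun j _ => ?_
        have hj := j.2
        have h2 := (hμi γ hγ (d - 1 - j) (by omega)).2
        have h3 := congrFun (hμb γ hγ) j
        simp only [beads, Fin.val_succ] at h3 ⊢
        rw [show d + 1 - 1 - ((j : ℕ) + 1) = d - 1 - j by omega]
        omega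
      rw [h1]
      simp only [beads, Fin.val_zero]
      omega
    rw [hexp]
    have := ih (μ γ) (hμd γ hγ)
    rw [hμb γ hγ] at this
    linear_combination (-1) ^ d * (∏ i : Fin d, (x i - x d)) *
      x d ^ (beads (d + 1) lam 0 + ∑ j : Fin d, (beads (d + 1) lam j.succ - 1 - γ j)) * this

end Branching

/-! ### The principal specialisation -/

section Specialisation

lemma prod_prod_Ioi_mul {n : ℕ} (f : Fin (n + 1) → ℝ) :
    ∏ i, ∏ j ∈ Finset.Ioi i, (f i * f j) = ∏ i, f i ^ n := by
  have h1 : ∏ i, ∏ j ∈ Finset.Ioi i, f j = ∏ j, ∏ i ∈ Finset.Iio j, f j :=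
    Finset.prod_comm' (by simp)
  simp only [Finset.prod_mul_distrib]
  rw [h1, ← Finset.prod_mul_distrib]
  refine Finset.prod_congr rfl fun i _ => ?_
  rw [Finset.prod_const, Finset.prod_const, ← pow_add, Fin.card_Ioi, Fin.card_Iio]
  congr 1
  omega

/-- The difference product of a family of exponents. -/
def diffProd {d : ℕ} (β : Fin d → ℕ) (q : ℝ) : ℝ :=
  ∏ i, ∏ j ∈ Finset.Ioi i, (q ^ ((β i : ℤ) - β j) - q ^ ((β j : ℤ) - β i))

/-- After extracting q^(nβⱼ) from column j a Vandermonde matrix in the q^(-2βⱼ) remains. Each index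
lies in `n` pairs, so the extracted powers distribute over the factors and make them antisymmetric.
-/
lemma alternant_principal {n : ℕ} (β : Fin (n + 1) → ℕ) {q : ℝ} (hq : 1 < q) :
    alternant (fun i => q ^ ((n : ℤ) - 2 * i)) β = diffProd β q := by
  have hq0 : q ≠ 0 := by linarith
  have h1 : (Matrix.of fun i j : Fin (n + 1) => (q ^ ((n : ℤ) - 2 * (i : ℕ))) ^ β j) =
      Matrix.of fun i j => ((q ^ β j) ^ n) *
        (Matrix.vandermonde fun j => q ^ (-2 * (β j : ℤ))).transpose i j := by
    ext i j
    simp only [Matrix.of_apply, Matrix.transpose_apply, Matrix.vandermonde_apply]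
    rw [← zpow_natCast, ← zpow_natCast, ← zpow_natCast, ← zpow_natCast, ← zpow_mul, ← zpow_mul,
      ← zpow_mul, ← zpow_add₀ hq0]
    congr 1
    ring
  rw [alternant, h1, Matrix.det_mul_row, Matrix.det_transpose, Matrix.det_vandermonde,
    ← prod_prod_Ioi_mul fun j => q ^ β j, ← Finset.prod_mul_distrib, diffProd]
  refine Finset.prod_congr rfl fun i _ => ?_
  rw [← Finset.prod_mul_distrib]
  refine Finset.prod_congr rfl fun j _ => ?_
  rw [← zpow_natCast, ← zpow_natCast, ← zpow_add₀ hq0, mul_sub, ← zpow_add₀ hq0, ← zpow_add₀ hq0]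
  congr 2 <;> ring

lemma diffProd_ne_zero {d : ℕ} {β : Fin d → ℕ} (hβ : StrictMono β) {q : ℝ} (hq : 1 < q) :
    diffProd β q ≠ 0 := by
  refine Finset.prod_ne_zero_iff.2 fun i _ => Finset.prod_ne_zero_iff.2 fun j hj => ?_
  have h := hβ (Finset.mem_Ioi.1 hj)
  rw [sub_ne_zero]
  exact ((zpow_right_strictMono₀ hq) (by omega)).ne

lemma strictMono_beads (n : ℕ) (lam : YoungDiagram) : StrictMono (beads (n + 1) lam) :=
  Fin.strictMono_iff_lt_succ.2 fun j => beads_castSucc_lt_succ lam j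

/-- Because the degrees are equal, both Schur polynomials have the same nonzero bialternant
denominator, which cancels. -/
theorem plethysticEquiv_iff_diffProd {n : ℕ} {lam mu : YoungDiagram}
    (hlam : lam.colLen 0 ≤ n + 1) (hmu : mu.colLen 0 ≤ n + 1) : PlethysticEquiv lam n mu n ↔
      ∀ q : ℝ, 1 < q → diffProd (beads (n + 1) lam) q = diffProd (beads (n + 1) mu) q := by
  have key : ∀ ν : YoungDiagram, ν.colLen 0 ≤ n + 1 → ∀ q : ℝ, 1 < q →
      (∑ T : {T : ν.cells → Fin (n + 1) // IsSemistandard ν T}, q ^ tableauWeight n ν T.1) *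
        diffProd (fun j : Fin (n + 1) => (j : ℕ)) q = diffProd (beads (n + 1) ν) q := by
    intro ν hν q hq
    have hq0 : q ≠ 0 := by linarith
    rw [← alternant_principal _ hq, ← alternant_principal _ hq, ← schurSum_mul_alternant _ _ ν hν,
      schurSum]
    congr 1
    refine Finset.sum_congr rfl fun T _ => ?_
    rw [tableauWeight]
    induction (Finset.univ : Finset ν.cells) using Finset.cons_induction with
    | empty => simp
    | cons a s ha ih => rw [Finset.prod_cons, Finset.sum_cons, ← ih, zpow_add₀ hq0]
  rw [plethysticEquiv_iff]
  refine forall_congr' fun q => forall_congr' fun hq => ?_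
  rw [← key lam hlam q hq, ← key mu hmu q hq]
  exact (mul_left_inj' (diffProd_ne_zero (fun i j h => h) hq)).symm

end Specialisation

/-! ### The multiset of differences -/

section Differences

/-- A multiset of positive integers is determined by the product of the `X ^ (2 * a) - 1`. -/
lemma multiset_eq_of_prod_eq (N : ℕ) : ∀ (A B : Multiset ℕ) (s t : ℕ), A.card = N →
    (∀ a ∈ A, 0 < a) → (∀ b ∈ B, 0 < b) →
    (Polynomial.X ^ s * (A.map fun a => (Polynomial.X ^ (2 * a) - 1 : Polynomial ℂ)).prod =
      Polynomial.X ^ t * (B.map fun b => (Polynomial.X ^ (2 * b) - 1 : Polynomial ℂ)).prod) →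
    A = B := by
  have step : ∀ (A B : Multiset ℕ) (s t : ℕ) (c : ℕ), (∀ b ∈ B, 0 < b) → 0 < c → c ∈ A →
      (∀ b ∈ B, b ≤ c) →
      (Polynomial.X ^ s * (A.map fun a => (Polynomial.X ^ (2 * a) - 1 : Polynomial ℂ)).prod =
      Polynomial.X ^ t * (B.map fun b => (Polynomial.X ^ (2 * b) - 1 : Polynomial ℂ)).prod) →
      c ∈ B := by
    intro A B s t c hB hc hcA hmax h
    -- A primitive 2c-th root of unity kills the factor of `c`, hence some factor of `b ∈ B`. Then
    -- 2c divides 2b while `b ≤ c`, so `b = c`. Applied to the largest element overall, this gives a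
    -- common factor to cancel.
    have hζ := Complex.isPrimitiveRoot_exp (2 * c) (by omega)
    set ζ := Complex.exp (2 * Real.pi * Complex.I / ((2 * c : ℕ) : ℂ))
    have he := congrArg (Polynomial.eval ζ) h
    simp only [Polynomial.eval_mul, Polynomial.eval_pow, Polynomial.eval_X,
      Polynomial.eval_multiset_prod, Multiset.map_map] at he
    have hA0 : (A.map (Polynomial.eval ζ ∘ fun a => (Polynomial.X ^ (2 * a) - 1))).prod = 0 := by
      refine Multiset.prod_eq_zero (Multiset.mem_map.2 ⟨c, hcA, ?_⟩)
      simp [hζ.pow_eq_one]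
    rw [hA0, mul_zero] at he
    have hζ0 : ζ ^ t ≠ 0 := pow_ne_zero _ (Complex.exp_ne_zero _)
    have hB0 := (mul_eq_zero.1 he.symm).resolve_left hζ0
    obtain ⟨b, hb, hb0⟩ := Multiset.mem_map.1 (Multiset.prod_eq_zero_iff.1 hB0)
    simp only [Function.comp_apply, Polynomial.eval_sub, Polynomial.eval_pow, Polynomial.eval_X,
      Polynomial.eval_one, sub_eq_zero] at hb0
    have hdvd := (hζ.pow_eq_one_iff_dvd _).1 hb0
    have hle := Nat.le_of_dvd (by have := hB b hb; omega) hdvd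
    have := hmax b hb
    rwa [show c = b by omega]
  induction N with
  | zero =>
    intro A B s t hA _ hBpos h
    rw [Multiset.card_eq_zero] at hA
    subst hA
    rcases Multiset.empty_or_exists_mem B with rfl | ⟨b, hb⟩
    · rfl
    · obtain ⟨c, hc, hmax⟩ := Finset.exists_max_image B.toFinset id ⟨b, by simpa using hb⟩
      rw [Multiset.mem_toFinset] at hc
      exact absurd (step B 0 t s c (by simp) (hBpos c hc) hc (by simp) h.symm) (by simp)
  | succ N ih =>
    intro A B s t hA hApos hBpos h
    obtain ⟨a, ha⟩ := Multiset.card_pos_iff_exists_mem.1 (by omega : 0 < A.card)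
    obtain ⟨c, hc, hmax⟩ := Finset.exists_max_image (A + B).toFinset id ⟨a, by simp [ha]⟩
    simp only [Multiset.mem_toFinset, Multiset.mem_add, id] at hc hmax
    have hboth : c ∈ A ∧ c ∈ B := by
      rcases hc with hc | hc
      · exact ⟨hc, step A B s t c hBpos (hApos c hc) hc (fun b hb => hmax b (.inr hb)) h⟩
      · exact ⟨step B A t s c hApos (hBpos c hc) hc (fun b hb => hmax b (.inl hb)) h.symm, hc⟩
    obtain ⟨A', rfl⟩ := Multiset.exists_cons_of_mem hboth.1
    obtain ⟨B', rfl⟩ := Multiset.exists_cons_of_mem hboth.2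
    have hc0 : (Polynomial.X ^ (2 * c) - 1 : Polynomial ℂ) ≠ 0 := by
      have := hApos c hboth.1
      simpa using Polynomial.X_pow_sub_C_ne_zero (R := ℂ) (n := 2 * c) (by omega) 1
    rw [ih A' B' s t (by simpa using hA) (fun a ha => hApos a (Multiset.mem_cons_of_mem ha))
      (fun b hb => hBpos b (Multiset.mem_cons_of_mem hb))]
    rw [Multiset.map_cons, Multiset.map_cons, Multiset.prod_cons, Multiset.prod_cons,
      mul_left_comm, mul_left_comm (Polynomial.X ^ t)] at h
    exact mul_left_cancel₀ hc0 h

/-- The multiset of differences of a strictly increasing family. -/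
def diffs {d : ℕ} (β : Fin d → ℕ) : Multiset ℕ :=
  (Finset.univ.filter fun p : Fin d × Fin d => p.1 < p.2).val.map fun p => β p.2 - β p.1

lemma card_diffs {d : ℕ} (β γ : Fin d → ℕ) : (diffs β).card = (diffs γ).card := by
  rw [diffs, diffs, Multiset.card_map, Multiset.card_map]

lemma pos_of_mem_diffs {d : ℕ} {β : Fin d → ℕ} (hβ : StrictMono β) : ∀ a ∈ diffs β, 0 < a := by
  intro a ha
  obtain ⟨p, hp, rfl⟩ := Multiset.mem_map.1 ha
  have := hβ (Finset.mem_filter.1 hp).2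
  omega

lemma diffProd_eq {d : ℕ} {β : Fin d → ℕ} (hβ : StrictMono β) (q : ℝ) :
    diffProd β q = ((diffs β).map fun a : ℕ => q ^ (-(a : ℤ)) - q ^ (a : ℤ)).prod := by
  rw [diffProd, diffs, Multiset.map_map, Finset.prod_sigma']
  refine Eq.trans (Finset.prod_bij' (t := Finset.univ.filter fun p : Fin d × Fin d => p.1 < p.2)
    (g := (fun a : ℕ => q ^ (-(a : ℤ)) - q ^ (a : ℤ)) ∘ fun p : Fin d × Fin d => β p.2 - β p.1)
    (fun p _ => (p.1, p.2)) (fun p _ => ⟨p.1, p.2⟩) ?_ ?_ ?_ ?_ ?_) rfl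
  · intro p hp; simpa using hp
  · intro p hp; simpa using hp
  · intros; rfl
  · intros; rfl
  · intro p hp
    have h := hβ (show p.1 < p.2 by simpa using hp)
    simp only [Function.comp_apply]
    rw [Nat.cast_sub h.le]
    congr 2
    ring

/-- Multiplying by qᵃ turns the factor of a into -(q²ᵃ - 1). The signs agree because both multisets
have the same size, and the resulting polynomial identity is moved to ℂ, where roots of unity are
available. -/
lemma diffs_eq_of_diffProd_eq {d : ℕ} {β γ : Fin d → ℕ} (hβ : StrictMono β) (hγ : StrictMono γ)
    (h : ∀ q : ℝ, 1 < q → diffProd β q = diffProd γ q) : diffs β = diffs γ := by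
  have key : ∀ A : Multiset ℕ, ∀ q : ℝ, q ≠ 0 →
      q ^ A.sum * (A.map fun a : ℕ => q ^ (-(a : ℤ)) - q ^ (a : ℤ)).prod =
        (-1) ^ A.card * (A.map fun a : ℕ => q ^ (2 * a) - 1).prod := by
    intro A q hq
    induction A using Multiset.induction_on with
    | empty => simp
    | cons a A ih =>
      rw [Multiset.sum_cons, Multiset.map_cons, Multiset.map_cons, Multiset.prod_cons,
        Multiset.prod_cons, Multiset.card_cons, pow_add, pow_succ]
      have h1 : q ^ a * (q ^ (-(a : ℤ)) - q ^ (a : ℤ)) = -(q ^ (2 * a) - 1) := by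
        rw [zpow_neg, zpow_natCast, mul_sub, mul_inv_cancel₀ (pow_ne_zero _ hq)]
        ring
      linear_combination (q ^ A.sum * (A.map fun a : ℕ => q ^ (-(a : ℤ)) - q ^ (a : ℤ)).prod) * h1 -
        (q ^ (2 * a) - 1) * ih
  have hpoly : (Polynomial.X ^ (diffs γ).sum *
      ((diffs β).map fun a => (Polynomial.X ^ (2 * a) - 1 : Polynomial ℝ)).prod) =
      Polynomial.X ^ (diffs β).sum *
        ((diffs γ).map fun a => (Polynomial.X ^ (2 * a) - 1 : Polynomial ℝ)).prod := by
    refine Polynomial.eq_of_infinite_eval_eq _ _ ((Set.Ioi_infinite (1 : ℝ)).mono ?_)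
    intro q hq
    have hq1 : 1 < q := hq
    have hq0 : q ≠ 0 := by linarith
    have h1 := h q hq1
    rw [diffProd_eq hβ, diffProd_eq hγ] at h1
    have h2 := key (diffs β) q hq0
    have h3 := key (diffs γ) q hq0
    rw [card_diffs γ β] at h3
    have hs : ((-1 : ℝ) ^ (diffs β).card) ≠ 0 := pow_ne_zero _ (by norm_num)
    change Polynomial.eval q _ = Polynomial.eval q _
    simp only [Polynomial.eval_mul, Polynomial.eval_pow, Polynomial.eval_X,
      Polynomial.eval_multiset_prod, Multiset.map_map, Function.comp_def, Polynomial.eval_sub,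
      Polynomial.eval_one]
    refine mul_left_cancel₀ hs ?_
    linear_combination (-q ^ (diffs γ).sum) * h2 + q ^ (diffs β).sum * h3 +
      q ^ (diffs γ).sum * q ^ (diffs β).sum * h1
  have hC := congrArg (Polynomial.map (algebraMap ℝ ℂ)) hpoly
  simp only [Polynomial.map_mul, Polynomial.map_pow, Polynomial.map_X,
    Polynomial.map_multiset_prod, Multiset.map_map, Function.comp_def, Polynomial.map_sub,
    Polynomial.map_one] at hC
  exact multiset_eq_of_prod_eq _ _ _ _ _ rfl (pos_of_mem_diffs hβ) (pos_of_mem_diffs hγ) hC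

/-- In equal degrees, plethystic equivalence is equality of the multisets of differences. -/
theorem plethysticEquiv_iff_diffs {n : ℕ} {lam mu : YoungDiagram}
    (hlam : lam.colLen 0 ≤ n + 1) (hmu : mu.colLen 0 ≤ n + 1) : PlethysticEquiv lam n mu n ↔
      diffs (beads (n + 1) lam) = diffs (beads (n + 1) mu) := by
  rw [plethysticEquiv_iff_diffProd hlam hmu]
  refine ⟨diffs_eq_of_diffProd_eq (strictMono_beads n lam) (strictMono_beads n mu),
    fun h q _ => ?_⟩
  rw [diffProd_eq (strictMono_beads n lam), diffProd_eq (strictMono_beads n mu), h]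

/-- The differences are determined by the norm of the generating function. -/
lemma diffs_eq_of_sum_mul_sum_eq {d : ℕ} {β γ : Fin d → ℕ} (hβ : StrictMono β) (hγ : StrictMono γ)
    (h : ∀ q : ℝ, 1 < q → (∑ i, q ^ β i) * (∑ i, q⁻¹ ^ β i) = (∑ i, q ^ γ i) * (∑ i, q⁻¹ ^ γ i)) :
    diffs β = diffs γ := by
  -- The product enumerates the differences over all ordered pairs; its positive exponents are those
  -- counted by `diffs`.
  have hsum : ∀ (δ : Fin d → ℕ) (q : ℝ), 1 < q → (∑ i, q ^ δ i) * (∑ i, q⁻¹ ^ δ i) =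
      ((Finset.univ : Finset (Fin d × Fin d)).val.map fun p =>
        q ^ ((δ p.2 : ℤ) - δ p.1)).sum := by
    intro δ q hq
    have hq0 : q ≠ 0 := by linarith
    change _ = ∑ p : Fin d × Fin d, q ^ ((δ p.2 : ℤ) - δ p.1)
    rw [Fintype.sum_prod_type_right, Finset.sum_mul_sum]
    refine Finset.sum_congr rfl fun i _ => Finset.sum_congr rfl fun j _ => ?_
    rw [zpow_sub₀ hq0, zpow_natCast, zpow_natCast, inv_pow, div_eq_mul_inv]
  have hfull := multiset_eq_of_sum_zpow_eq
    (M := (Finset.univ : Finset (Fin d × Fin d)).val.map fun p => (β p.2 : ℤ) - β p.1)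
    (N := (Finset.univ : Finset (Fin d × Fin d)).val.map fun p => (γ p.2 : ℤ) - γ p.1)
    fun q hq => by
      rw [Multiset.map_map, Multiset.map_map]
      exact (hsum β q hq).symm.trans ((h q hq).trans (hsum γ q hq))
  have hdiffs : ∀ δ : Fin d → ℕ, StrictMono δ → diffs δ =
      (((Finset.univ : Finset (Fin d × Fin d)).val.map fun p => (δ p.2 : ℤ) - δ p.1).filter
        (0 < ·)).map Int.toNat := by
    intro δ hδ
    rw [Multiset.filter_map, Multiset.map_map, diffs, Finset.filter_val]
    have : (Finset.univ : Finset (Fin d × Fin d)).val.filter (fun p => p.1 < p.2) =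
        (Finset.univ : Finset (Fin d × Fin d)).val.filter
          ((0 < ·) ∘ fun p => (δ p.2 : ℤ) - δ p.1) := by
      refine Multiset.filter_congr fun p _ => ?_
      simp only [Function.comp_apply, sub_pos, Nat.cast_lt]
      exact hδ.lt_iff_lt.symm
    rw [this]
    refine Multiset.map_congr rfl fun p _ => ?_
    simp only [Function.comp_apply]
    omega
  rw [hdiffs β hβ, hdiffs γ hγ, hfull]

/-! ### Complements -/

lemma rowLen_complement {r : ℕ} {lam : YoungDiagram} {i : ℕ} (hi : i < r) :
    (complement r lam).rowLen i = lam.rowLen 0 - lam.rowLen (r - 1 - i) := by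
  refine rowLen_eq_of_mem_iff fun j => ?_
  refine (YoungDiagram.mem_mk _ _ _).trans ?_
  simp only [Finset.mem_filter, Finset.mem_product, Finset.mem_range]
  omega

lemma colLen_complement_le (r : ℕ) (lam : YoungDiagram) : (complement r lam).colLen 0 ≤ r := by
  rw [← not_lt, ← YoungDiagram.mem_iff_lt_colLen]
  intro h
  have := (Finset.mem_filter.1 ((YoungDiagram.mem_mk _ _ _).1 h)).1
  simp at this

/-- The complement replaces each bead b by a + n - b, where a is the first row length, and reverses
their order. -/
lemma diffs_complement (n : ℕ) (lam : YoungDiagram) :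
    diffs (beads (n + 1) (complement (n + 1) lam)) = diffs (beads (n + 1) lam) := by
  refine diffs_eq_of_diffProd_eq (strictMono_beads _ _) (strictMono_beads _ _) fun q _ => ?_
  rw [diffProd, diffProd, Finset.prod_sigma', Finset.prod_sigma']
  have hb : ∀ j : Fin (n + 1), (beads (n + 1) (complement (n + 1) lam) j : ℤ) =
      lam.rowLen 0 + n - beads (n + 1) lam (Fin.rev j) := by
    intro j
    have hj := j.2
    simp only [beads, Fin.val_rev]
    rw [rowLen_complement (by omega), show n + 1 - 1 - (n + 1 - 1 - (j : ℕ)) = j by omega,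
      show n + 1 - 1 - (n + 1 - ((j : ℕ) + 1)) = j by omega]
    have := lam.rowLen_anti 0 j (Nat.zero_le _)
    omega
  refine Finset.prod_bij' (fun p _ => ⟨Fin.rev p.2, Fin.rev p.1⟩)
    (fun p _ => ⟨Fin.rev p.2, Fin.rev p.1⟩) ?_ ?_ ?_ ?_ ?_
  · intro p hp; simpa using hp
  · intro p hp; simpa using hp
  · intro p _; simp
  · intro p _; simp
  · intro p _
    rw [hb, hb]
    congr 2 <;> ring

end Differences

/-! ### Sets of at most five integers with the same multiset of differences -/

section Homometric

lemma gaps_eq_of_diffs_eq_three {a b a' b' : ℕ}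
    (h : ({a, b, a + b} : Multiset ℕ) = {a', b', a' + b'}) :
    (a = a' ∧ b = b') ∨ (a = b' ∧ b = a') := by
  have hs := congrArg Multiset.sum h
  have h1 : a ∈ ({a', b', a' + b'} : Multiset ℕ) := h ▸ by simp
  have h2 : b ∈ ({a', b', a' + b'} : Multiset ℕ) := h ▸ by simp
  simp at hs h1 h2
  omega

/-- The maximum gives L = a + b + c, and the sum of all differences is 3L + b, which gives b. The
larger of a + b and b + c then gives max(a, c). -/
lemma gaps_eq_of_diffs_eq_four {a b c a' b' c' : ℕ} (ha : 0 < a) (hb : 0 < b) (hc : 0 < c)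
    (ha' : 0 < a') (hb' : 0 < b') (hc' : 0 < c')
    (h : ({a, b, c, a + b, b + c, a + b + c} : Multiset ℕ) =
      {a', b', c', a' + b', b' + c', a' + b' + c'}) :
    (a = a' ∧ b = b' ∧ c = c') ∨ (a = c' ∧ b = b' ∧ c = a') := by
  have hs := congrArg Multiset.sum h
  have h1 : a + b + c ∈ ({a', b', c', a' + b', b' + c', a' + b' + c'} : Multiset ℕ) :=
    h ▸ by simp
  have h2 : a' + b' + c' ∈ ({a, b, c, a + b, b + c, a + b + c} : Multiset ℕ) := h ▸ by simp
  have h3 : a + b ∈ ({a', b', c', a' + b', b' + c', a' + b' + c'} : Multiset ℕ) := h ▸ by simp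
  have h4 : b + c ∈ ({a', b', c', a' + b', b' + c', a' + b' + c'} : Multiset ℕ) := h ▸ by simp
  have h5 : a' + b' ∈ ({a, b, c, a + b, b + c, a + b + c} : Multiset ℕ) := h ▸ by simp
  have h6 : b' + c' ∈ ({a, b, c, a + b, b + c, a + b + c} : Multiset ℕ) := h ▸ by simp
  simp at hs h1 h2 h3 h4 h5 h6
  have hL : a + b + c = a' + b' + c' := by
    clear h3 h4 h5 h6 hs
    omega
  have hB : b = b' := by
    clear h1 h2 h3 h4 h5 h6
    omega
  have l1 : max a c ≤ max a' c' := by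
    clear h1 h2 h5 h6 hs
    omega
  have l2 : max a' c' ≤ max a c := by
    clear h1 h2 h3 h4 hs
    omega
  omega

/-- With the outer gaps and b + c known, all but b, c, a + b, c + e cancel. Comparing sums of
squares of these gives (b - b')(2(b - c') + a - e) = 0, and membership settles the second
alternative. -/
lemma gaps_eq_of_diffs_eq_five_of_ends {a b c e b' c' : ℕ} (ha : 0 < a) (he : 0 < e)
    (hbc : b + c = b' + c')
    (h : ({a, b, c, e, a + b, b + c, c + e, a + b + c, b + c + e, a + b + c + e} : Multiset ℕ) =
      {a, b', c', e, a + b', b' + c', c' + e, a + b' + c', b' + c' + e, a + b' + c' + e}) :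
    (b = b' ∧ c = c') ∨ (a = e ∧ b = c' ∧ c = b') := by
  have key : ∀ x y : ℕ,
      ({a, x, y, e, a + x, x + y, y + e, a + x + y, x + y + e, a + x + y + e} : Multiset ℕ) =
        {a, e, x + y, a + (x + y), x + y + e, a + (x + y) + e} + {x, y, a + x, y + e} := by
    intro x y
    simp only [Multiset.insert_eq_cons, ← Multiset.singleton_add, add_assoc a x y]
    abel
  rw [key, key, hbc, Multiset.add_right_inj] at h
  have hs := congrArg (fun s => (s.map fun n => (n : ℤ) ^ 2).sum) h
  have h1 : b ∈ ({b', c', a + b', c' + e} : Multiset ℕ) := h ▸ by simp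
  have h2 : c ∈ ({b', c', a + b', c' + e} : Multiset ℕ) := h ▸ by simp
  have h3 : b' ∈ ({b, c, a + b, c + e} : Multiset ℕ) := h ▸ by simp
  have h4 : c' ∈ ({b, c, a + b, c + e} : Multiset ℕ) := h ▸ by simp
  simp at hs h1 h2 h3 h4
  have hz : (b : ℤ) + c = b' + c' := by exact_mod_cast hbc
  obtain rfl : c = b' + c' - b := by omega
  have hc : (c' : ℤ) = b + (b' + c' - b : ℕ) - b' := by omega
  have hm : ((b : ℤ) - b') * (2 * ((b : ℤ) - c') + a - e) = 0 := by
    generalize (b' + c' - b : ℕ) = c at *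
    rw [hc] at hs ⊢
    linarith
  rcases mul_eq_zero.1 hm with hm | hm <;> omega

/-- With L the maximum, the sum of all differences is 4L + 2(b + c), which gives b + c and a + e.
The second largest difference L - min(a, e) then fixes the outer gaps up to reflection. -/
lemma gaps_eq_of_diffs_eq_five {a b c e a' b' c' e' : ℕ} (ha : 0 < a) (hb : 0 < b) (hc : 0 < c)
    (he : 0 < e) (ha' : 0 < a') (hb' : 0 < b') (hc' : 0 < c') (he' : 0 < e')
    (h : ({a, b, c, e, a + b, b + c, c + e, a + b + c, b + c + e, a + b + c + e} : Multiset ℕ) =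
      {a', b', c', e', a' + b', b' + c', c' + e', a' + b' + c', b' + c' + e',
        a' + b' + c' + e'}) :
    (a = a' ∧ b = b' ∧ c = c' ∧ e = e') ∨ (a = e' ∧ b = c' ∧ c = b' ∧ e = a') := by
  have hs := congrArg Multiset.sum h
  have hL : a + b + c + e = a' + b' + c' + e' := by
    have h1 : a + b + c + e ∈ ({a', b', c', e', a' + b', b' + c', c' + e', a' + b' + c',
      b' + c' + e', a' + b' + c' + e'} : Multiset ℕ) := h ▸ by simp
    have h2 : a' + b' + c' + e' ∈ ({a, b, c, e, a + b, b + c, c + e, a + b + c, b + c + e,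
      a + b + c + e} : Multiset ℕ) := h ▸ by simp
    simp at h1 h2
    omega
  have h1 : a + b + c ∈ ({a', b', c', e', a' + b', b' + c', c' + e', a' + b' + c',
    b' + c' + e', a' + b' + c' + e'} : Multiset ℕ) := h ▸ by simp
  have h2 : b + c + e ∈ ({a', b', c', e', a' + b', b' + c', c' + e', a' + b' + c',
    b' + c' + e', a' + b' + c' + e'} : Multiset ℕ) := h ▸ by simp
  have h3 : a' + b' + c' ∈ ({a, b, c, e, a + b, b + c, c + e, a + b + c, b + c + e,
    a + b + c + e} : Multiset ℕ) := h ▸ by simp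
  have h4 : b' + c' + e' ∈ ({a, b, c, e, a + b, b + c, c + e, a + b + c, b + c + e,
    a + b + c + e} : Multiset ℕ) := h ▸ by simp
  simp at hs h1 h2 h3 h4
  have hbc : b + c = b' + c' := by omega
  have hae : a + e = a' + e' := by omega
  have hends : (a = a' ∧ e = e') ∨ (a = e' ∧ e = a') := by
    have l1 : min a e ≤ min a' e' := by
      clear h1 h2 hs
      omega
    have l2 : min a' e' ≤ min a e := by
      clear h3 h4 hs
      omega
    omega
  rcases hends with ⟨rfl, rfl⟩ | ⟨rfl, rfl⟩
  · have := gaps_eq_of_diffs_eq_five_of_ends ha he hbc h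
    omega
  · have := gaps_eq_of_diffs_eq_five_of_ends (b' := c') (c' := b') ha he (by omega) (h.trans (by
      rw [show a + c' + b' + e = e + b' + c' + a by omega,
        show c' + b' + e = e + b' + c' by omega, show a + c' + b' = b' + c' + a by omega,
        add_comm a c', add_comm c' b', add_comm b' e]
      simp only [Multiset.insert_eq_cons, ← Multiset.singleton_add]
      abel))
    omega

end Homometric

/-! ### Equal degree at most four -/

section SmallDegree

lemma diffs_two (β : Fin 2 → ℕ) : diffs β = {β 1 - β 0} := rfl

lemma diffs_three (β : Fin 3 → ℕ) {a b : ℕ} (h1 : β 1 = β 0 + a) (h2 : β 2 = β 1 + b) :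
    diffs β = {a, b, a + b} := by
  have h : diffs β = {β 1 - β 0, β 2 - β 0, β 2 - β 1} := rfl
  rw [h, show β 1 - β 0 = a by omega, show β 2 - β 0 = a + b by omega,
    show β 2 - β 1 = b by omega]
  simp only [Multiset.insert_eq_cons, ← Multiset.singleton_add]
  abel

lemma diffs_four (β : Fin 4 → ℕ) {a b c : ℕ} (h1 : β 1 = β 0 + a) (h2 : β 2 = β 1 + b)
    (h3 : β 3 = β 2 + c) : diffs β = {a, b, c, a + b, b + c, a + b + c} := by
  have h : diffs β = {β 1 - β 0, β 2 - β 0, β 3 - β 0, β 2 - β 1, β 3 - β 1, β 3 - β 2} := rfl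
  rw [h, show β 1 - β 0 = a by omega, show β 2 - β 0 = a + b by omega,
    show β 3 - β 0 = a + b + c by omega, show β 2 - β 1 = b by omega,
    show β 3 - β 1 = b + c by omega, show β 3 - β 2 = c by omega]
  simp only [Multiset.insert_eq_cons, ← Multiset.singleton_add]
  abel

lemma diffs_five (β : Fin 5 → ℕ) {a b c e : ℕ} (h1 : β 1 = β 0 + a) (h2 : β 2 = β 1 + b)
    (h3 : β 3 = β 2 + c) (h4 : β 4 = β 3 + e) :
    diffs β = {a, b, c, e, a + b, b + c, c + e, a + b + c, b + c + e, a + b + c + e} := by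
  have h : diffs β = {β 1 - β 0, β 2 - β 0, β 3 - β 0, β 4 - β 0,
    β 2 - β 1, β 3 - β 1, β 4 - β 1, β 3 - β 2, β 4 - β 2, β 4 - β 3} := rfl
  rw [h, show β 1 - β 0 = a by omega, show β 2 - β 0 = a + b by omega,
    show β 3 - β 0 = a + b + c by omega, show β 4 - β 0 = a + b + c + e by omega,
    show β 2 - β 1 = b by omega, show β 3 - β 1 = b + c by omega,
    show β 4 - β 1 = b + c + e by omega, show β 3 - β 2 = c by omega,
    show β 4 - β 2 = c + e by omega, show β 4 - β 3 = e by omega]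
  simp only [Multiset.insert_eq_cons, ← Multiset.singleton_add]
  abel

lemma beads_one_eq_add {n : ℕ} (lam : YoungDiagram) (j : ℕ) (hj : j + 1 < n + 1) :
    beads (n + 1) lam ⟨j + 1, hj⟩ = beads (n + 1) lam ⟨j, by omega⟩ +
      (lam.rowLen (n - (j + 1)) - lam.rowLen (n - j) + 1) := by
  have := lam.rowLen_anti (n - (j + 1)) (n - j) (by omega)
  simp only [beads, Nat.add_sub_cancel]
  omega

lemma eq_or_complement_eq {n : ℕ} {lam mu : YoungDiagram} (hlam : lam.colLen 0 ≤ n)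
    (hmu : mu.colLen 0 ≤ n)
    (h : (∀ i < n, lam.rowLen i = mu.rowLen i) ∨
      ∀ i ≤ n, lam.rowLen 0 - lam.rowLen (n - i) = mu.rowLen i) :
    lam = mu ∨ complement (n + 1) lam = mu := by
  refine h.imp (fun h => youngDiagram_ext fun i => ?_) fun h => youngDiagram_ext fun i => ?_
  · rcases lt_or_ge i n with hi | hi
    · exact h i hi
    · rw [rowLen_eq_zero hlam hi, rowLen_eq_zero hmu hi]
  · rcases lt_or_ge i (n + 1) with hi | hi
    · rw [rowLen_complement hi, Nat.add_sub_cancel]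
      exact h i (by omega)
    · rw [rowLen_eq_zero (colLen_complement_le _ _) hi, rowLen_eq_zero hmu (by omega)]

lemma eq_or_complement_eq_of_diffs_eq {n : ℕ} (hn : n ≤ 4) {lam mu : YoungDiagram}
    (hlam : lam.colLen 0 ≤ n) (hmu : mu.colLen 0 ≤ n)
    (h : diffs (beads (n + 1) lam) = diffs (beads (n + 1) mu)) :
    lam = mu ∨ complement (n + 1) lam = mu := by
  apply eq_or_complement_eq hlam hmu
  have hl := rowLen_eq_zero hlam le_rfl
  have hm := rowLen_eq_zero hmu le_rfl
  have al := fun i => lam.rowLen_anti i (i + 1) (by omega)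
  have am := fun i => mu.rowLen_anti i (i + 1) (by omega)
  interval_cases n
  · simp
  · rw [diffs_two, diffs_two, Multiset.singleton_inj] at h
    simp [beads] at h
    left
    intro i hi
    interval_cases i
    omega
  · rw [diffs_three _ (beads_one_eq_add lam 0 (by omega)) (beads_one_eq_add lam 1 (by omega)),
      diffs_three _ (beads_one_eq_add mu 0 (by omega)) (beads_one_eq_add mu 1 (by omega))] at h
    have := gaps_eq_of_diffs_eq_three h
    have := al 0
    have := am 0
    simp only [Nat.forall_lt_succ_right, Nat.le_iff_lt_add_one] at *
    norm_num at *
    omega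
  · rw [diffs_four _ (beads_one_eq_add lam 0 (by omega)) (beads_one_eq_add lam 1 (by omega))
        (beads_one_eq_add lam 2 (by omega)),
      diffs_four _ (beads_one_eq_add mu 0 (by omega)) (beads_one_eq_add mu 1 (by omega))
        (beads_one_eq_add mu 2 (by omega))] at h
    have := gaps_eq_of_diffs_eq_four (by omega) (by omega) (by omega) (by omega) (by omega)
      (by omega) h
    have := al 0
    have := am 0
    have := al 1
    have := am 1
    simp only [Nat.forall_lt_succ_right, Nat.le_iff_lt_add_one] at *
    norm_num at *
    omega
  · rw [diffs_five _ (beads_one_eq_add lam 0 (by omega)) (beads_one_eq_add lam 1 (by omega))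
        (beads_one_eq_add lam 2 (by omega)) (beads_one_eq_add lam 3 (by omega)),
      diffs_five _ (beads_one_eq_add mu 0 (by omega)) (beads_one_eq_add mu 1 (by omega))
        (beads_one_eq_add mu 2 (by omega)) (beads_one_eq_add mu 3 (by omega))] at h
    have := gaps_eq_of_diffs_eq_five (by omega) (by omega) (by omega) (by omega) (by omega)
      (by omega) (by omega) (by omega) h
    have := al 0
    have := am 0
    have := al 1
    have := am 1
    have := al 2
    have := am 2
    simp only [Nat.forall_lt_succ_right, Nat.le_iff_lt_add_one] at *
    norm_num at *
    omega

theorem plethysticEquiv_iff_of_le_four {n : ℕ} (hn : n ≤ 4) {lam mu : YoungDiagram}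
    (hlam : lam.colLen 0 ≤ n) (hmu : mu.colLen 0 ≤ n) :
    PlethysticEquiv lam n mu n ↔ lam = mu ∨ complement (n + 1) lam = mu := by
  rw [plethysticEquiv_iff_diffs (by omega) (by omega)]
  refine ⟨eq_or_complement_eq_of_diffs_eq hn hlam hmu, ?_⟩
  rintro (rfl | rfl)
  · rfl
  · exact (diffs_complement n lam).symm

end SmallDegree

/-! ### Exceptional pairs -/

section Exceptional

lemma rowLen_ofRowLens_eq_getD (w : List ℕ) (hw : w.SortedGE) (i : ℕ) :
    (YoungDiagram.ofRowLens w hw).rowLen i = w.getD i 0 := by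
  refine rowLen_eq_of_mem_iff fun j => ?_
  rw [YoungDiagram.mem_ofRowLens]
  by_cases h : i < w.length
  · simp [h]
  · simp [h]

/-- The generating function of the beads of `lam`. -/
def beadSum (n : ℕ) (lam : YoungDiagram) (q : ℝ) : ℝ :=
  ∑ i ∈ Finset.range (n + 1), q ^ (lam.rowLen i + (n - i))

lemma sum_pow_beads (n : ℕ) (lam : YoungDiagram) (q : ℝ) :
    ∑ j, q ^ beads (n + 1) lam j = beadSum n lam q := by
  rw [beadSum, ← Finset.sum_range_reflect, ← Fin.sum_univ_eq_sum_range
    (fun j => q ^ (lam.rowLen (n + 1 - 1 - j) + (n - (n + 1 - 1 - j))))]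
  refine Finset.sum_congr rfl fun j _ => ?_
  rw [beads, show n - (n + 1 - 1 - (j : ℕ)) = j by omega]

/-- The second row suffices to tell the diagrams apart: as `mu.rowLen (n - 1) = 0`, the complement
of `mu` has second row `mu.rowLen 0`. -/
lemma isExceptional_of_beadSum {n : ℕ} {lam mu : YoungDiagram} (hn : 2 ≤ n)
    (hlam : lam.rowLen n = 0) (hmu : mu.rowLen (n - 1) = 0) (h1 : lam.rowLen 1 ≠ mu.rowLen 1)
    (h2 : lam.rowLen 1 ≠ mu.rowLen 0)
    (h : ∀ q : ℝ, 1 < q →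
      beadSum n lam q * beadSum n lam q⁻¹ = beadSum n mu q * beadSum n mu q⁻¹) :
    IsExceptional n lam mu := by
  have hmu' : mu.rowLen n = 0 := by
    have := mu.rowLen_anti (n - 1) n (by omega)
    omega
  rw [← colLen_zero_le_iff] at hlam hmu'
  refine ⟨hlam, hmu', (plethysticEquiv_iff_diffs (by omega) (by omega)).2
    (diffs_eq_of_sum_mul_sum_eq (strictMono_beads n lam) (strictMono_beads n mu) fun q hq => ?_),
    ?_, ?_⟩
  · simpa only [sum_pow_beads] using h q hq
  · rintro rfl
    exact h1 rfl
  · rintro rfl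
    rw [rowLen_complement (by omega), show n + 1 - 1 - 1 = n - 1 by omega, hmu] at h2
    exact h2 (by simp)

lemma isExceptional_five (k : ℕ) : IsExceptional 5 (exceptional₁ k 5) (exceptional₂ k 5) := by
  refine isExceptional_of_beadSum (by norm_num) ?_ ?_ ?_ ?_ fun q hq => ?_ <;>
    simp [exceptional₁, exceptional₂, rowLen_ofRowLens_eq_getD, exceptionalParts₁,
      exceptionalParts₂, beadSum, Finset.sum_range_succ]
  · omega
  -- With qᵏ as a second variable `u`, the identity is rational in `q` and `u`, so all `k` are
  -- treated at once.
  · simp only [pow_add, pow_mul']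
    have : 0 < q ^ k := by positivity
    generalize q ^ k = u at *
    field_simp
    ring

lemma isExceptional_six (k : ℕ) : IsExceptional 6 (exceptional₁ k 6) (exceptional₂ k 6) := by
  refine isExceptional_of_beadSum (by norm_num) ?_ ?_ ?_ ?_ fun q hq => ?_ <;>
    simp [exceptional₁, exceptional₂, rowLen_ofRowLens_eq_getD, exceptionalParts₁,
      exceptionalParts₂, beadSum, Finset.sum_range_succ]
  · simp only [pow_add]
    have : 0 < q ^ k := by positivity
    generalize q ^ k = u at *
    field_simp
    ring

lemma isExceptional_seven (k : ℕ) : IsExceptional 7 (exceptional₁ k 7) (exceptional₂ k 7) := by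
  refine isExceptional_of_beadSum (by norm_num) ?_ ?_ ?_ ?_ fun q hq => ?_ <;>
    simp [exceptional₁, exceptional₂, rowLen_ofRowLens_eq_getD, exceptionalParts₁,
      exceptionalParts₂, beadSum, Finset.sum_range_succ]
  · simp only [pow_add]
    have : 0 < q ^ k := by positivity
    generalize q ^ k = u at *
    field_simp
    ring

lemma rowLen_exceptional₁ (k n i : ℕ) : (exceptional₁ k (n + 8)).rowLen i =
    if i = 0 then 5 + k else if i = 1 then 4 + k else if i < 6 then 3 + k else
      if i = 6 then 3 else if i < n + 7 then 1 else 0 := by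
  rw [exceptional₁, rowLen_ofRowLens_eq_getD]
  rcases lt_or_ge i 7 with hi | hi
  · interval_cases i <;> simp [exceptionalParts₁]
  · obtain ⟨j, rfl⟩ := Nat.exists_eq_add_of_le' hi
    simp [exceptionalParts₁, List.getD_eq_getElem?_getD, List.getElem?_replicate]
    split_ifs <;> first | omega | simp

lemma rowLen_exceptional₂ (k n i : ℕ) : (exceptional₂ k (n + 8)).rowLen i =
    if i = 0 then 5 + k else if i < n + 1 then 3 + k else if i < n + 3 then 2 + k else
      if i = n + 3 then 2 else if i = n + 4 then 1 else 0 := by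
  rw [exceptional₂, rowLen_ofRowLens_eq_getD]
  rcases Nat.eq_zero_or_pos i with rfl | hi
  · simp [exceptionalParts₂]
  · obtain ⟨i, rfl⟩ := Nat.exists_eq_add_of_le' hi
    rcases lt_or_ge i n with hi | hi
    · simp [exceptionalParts₂, List.getD_eq_getElem?_getD, List.getElem?_append, hi]
    · obtain ⟨j, rfl⟩ := Nat.exists_eq_add_of_le' hi
      simp [exceptionalParts₂, List.getD_eq_getElem?_getD, List.getElem?_append]
      rcases lt_or_ge j 4 with hj | hj
      · interval_cases j <;> simp <;> split_ifs <;> omega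
      · obtain ⟨j, rfl⟩ := Nat.exists_eq_add_of_le' hj
        simp
        split_ifs <;> omega

lemma beadSum_exceptional₁ (k n : ℕ) (q : ℝ) :
    beadSum (n + 8) (exceptional₁ k (n + 8)) q * (q - 1) =
      q ^ 2 - 1 + (q ^ n * q ^ 3 - q ^ 3) + q ^ n * q ^ 5 * (q - 1) +
        q ^ k * q ^ n * (q ^ 10 - q ^ 6 + (q ^ 11 + q ^ 13) * (q - 1)) := by
  -- The `n` parts equal to 1 give the consecutive beads 3, …, n + 2, whose geometric sum telescopes
  -- after multiplication by `q - 1`.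
  have h : ∑ x ∈ Finset.range n,
      q ^ ((exceptional₁ k (n + 8)).rowLen (7 + x) + (n + 8 - (7 + x))) =
      q ^ 3 * ∑ x ∈ Finset.range n, q ^ x := by
    rw [← Finset.sum_range_reflect, Finset.mul_sum]
    refine Finset.sum_congr rfl fun x hx => ?_
    rw [Finset.mem_range] at hx
    rw [rowLen_exceptional₁, ← pow_add]
    congr 1
    split_ifs <;> omega
  have ht : ∑ x ∈ Finset.range 2,
      q ^ ((exceptional₁ k (n + 8)).rowLen (7 + n + x) + (n + 8 - (7 + n + x))) =
      ∑ x ∈ Finset.range 2, q ^ (1 - x) := by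
    refine Finset.sum_congr rfl fun x hx => ?_
    rw [Finset.mem_range] at hx
    rw [rowLen_exceptional₁]
    congr 1
    split_ifs <;> omega
  have hg := geom_sum_mul q n
  rw [beadSum, show n + 8 + 1 = 7 + n + 2 by omega, Finset.sum_range_add, Finset.sum_range_add, h, ht]
  simp [Finset.sum_range_succ, rowLen_exceptional₁, pow_add]
  linear_combination q ^ 3 * hg

lemma beadSum_exceptional₂ (k n : ℕ) (q : ℝ) :
    beadSum (n + 8) (exceptional₂ k (n + 8)) q * (q - 1) =
      q ^ 4 - 1 + (q ^ 5 + q ^ 7) * (q - 1) + q ^ k * (q ^ 10 - q ^ 8) +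
        q ^ k * (q ^ n * q ^ 11 - q ^ 11) + q ^ k * q ^ n * q ^ 13 * (q - 1) := by
  -- The `n` parts equal to 3 + k give the consecutive beads k + 11, …, k + n + 10.
  have h : ∑ x ∈ Finset.range n,
      q ^ ((exceptional₂ k (n + 8)).rowLen (1 + x) + (n + 8 - (1 + x))) =
      q ^ k * q ^ 11 * ∑ x ∈ Finset.range n, q ^ x := by
    rw [← Finset.sum_range_reflect, Finset.mul_sum]
    refine Finset.sum_congr rfl fun x hx => ?_
    rw [Finset.mem_range] at hx
    rw [rowLen_exceptional₂, ← pow_add, ← pow_add]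
    congr 1
    split_ifs <;> omega
  have ht : ∑ x ∈ Finset.range 8,
      q ^ ((exceptional₂ k (n + 8)).rowLen (1 + n + x) + (n + 8 - (1 + n + x))) =
      ∑ x ∈ Finset.range 8, q ^ (if x < 2 then k + 9 - x else if x = 2 then 7 else if x = 3 then 5 else 7 - x) := by
    refine Finset.sum_congr rfl fun x hx => ?_
    rw [Finset.mem_range] at hx
    rw [rowLen_exceptional₂]
    congr 1
    split_ifs <;> omega
  have hg := geom_sum_mul q n
  rw [beadSum, show n + 8 + 1 = 1 + n + 8 by omega, Finset.sum_range_add, Finset.sum_range_add, h, ht]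
  simp [Finset.sum_range_succ, rowLen_exceptional₂, pow_add]
  linear_combination q ^ k * q ^ 11 * hg

lemma isExceptional_add_eight (k n : ℕ) :
    IsExceptional (n + 8) (exceptional₁ k (n + 8)) (exceptional₂ k (n + 8)) := by
  refine isExceptional_of_beadSum (by omega) ?_ ?_ ?_ ?_ fun q hq => ?_
  · simp [rowLen_exceptional₁]
  · simp [rowLen_exceptional₂]
  · simp only [rowLen_exceptional₁, rowLen_exceptional₂]
    norm_num
    split_ifs <;> omega
  · simp [rowLen_exceptional₁, rowLen_exceptional₂]
  · have h1 : q - 1 ≠ 0 := by linarith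
    have h2 : q⁻¹ - 1 ≠ 0 := by
      have := inv_lt_one_of_one_lt₀ hq
      linarith
    -- Multiplying by (q - 1)(q⁻¹ - 1) puts the bead sums in closed form, so that qᵏ and qⁿ can be
    -- treated as independent variables.
    apply mul_right_cancel₀ (mul_ne_zero h1 h2)
    rw [mul_mul_mul_comm (beadSum _ (exceptional₁ _ _) q),
      mul_mul_mul_comm (beadSum _ (exceptional₂ _ _) q), beadSum_exceptional₁,
      beadSum_exceptional₁, beadSum_exceptional₂, beadSum_exceptional₂]
    simp only [inv_pow]
    have : 0 < q ^ k := by positivity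
    have : 0 < q ^ n := by positivity
    generalize q ^ k = u at *
    generalize q ^ n = v at *
    field_simp
    ring

theorem isExceptional_exceptional {n : ℕ} (hn : 5 ≤ n) (k : ℕ) :
    IsExceptional n (exceptional₁ k n) (exceptional₂ k n) := by
  rcases lt_or_ge n 8 with h | h
  · interval_cases n
    · exact isExceptional_five k
    · exact isExceptional_six k
    · exact isExceptional_seven k
  · obtain ⟨n, rfl⟩ := Nat.exists_eq_add_of_le' h
    exact isExceptional_add_eight k n

/-- The first row already determines `k`; this makes the set of exceptional pairs infinite. -/
lemma exceptional₁_injective (n : ℕ) : Function.Injective fun k => exceptional₁ k n := by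
  intro k k' h
  have h0 := congrArg (fun lam => lam.rowLen 0) h
  simp only [exceptional₁, rowLen_ofRowLens_eq_getD, exceptionalParts₁] at h0
  split_ifs at h0 <;> simp at h0 <;> exact h0

end Exceptional

end Plethysm

end

theorem theorem1p10 :
    (∀ (ℓ : ℕ) (lam mu : YoungDiagram), ℓ ≤ 4 → lam.colLen 0 ≤ ℓ → mu.colLen 0 ≤ ℓ →
      (Plethysm.PlethysticEquiv lam ℓ mu ℓ ↔
        lam = mu ∨ Plethysm.complement (ℓ + 1) lam = mu)) ∧
    (∀ ℓ : ℕ, 5 ≤ ℓ →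
      {p : YoungDiagram × YoungDiagram | Plethysm.IsExceptional ℓ p.1 p.2}.Infinite ∧
      ∀ k : ℕ, Plethysm.IsExceptional ℓ
        (Plethysm.exceptional₁ k ℓ) (Plethysm.exceptional₂ k ℓ)) :=
  ⟨fun _ _ _ h hlam hmu => Plethysm.plethysticEquiv_iff_of_le_four h hlam hmu, fun ℓ h =>
    ⟨Set.infinite_of_injective_forall_mem
      (f := fun k => (Plethysm.exceptional₁ k ℓ, Plethysm.exceptional₂ k ℓ))
      (fun _ _ hk => Plethysm.exceptional₁_injective ℓ (Prod.ext_iff.1 hk).1)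
      fun k => Plethysm.isExceptional_exceptional h k,
      Plethysm.isExceptional_exceptional h⟩⟩
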